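/- **Setup.** Let $\mathcal L$ be the tropical line: one vertex $c$ and three unbounded rays $u,v,w$. Fix integers $g\ge 0$, $d\ge 1$ and three marked partitions $\Delta=(\Delta_u,\Delta_v,\Delta_w)$ of $d$, with $\#\Delta$ parts in total, such that $r:=\#\Delta+2g-2-d\ge 0$. A *tropical cover* $h:\Gamma\to\mathcal L$ of genus $g$ and profile $\Delta$ consists of a connected finite metric graph $\Gamma$, with bounded edges of positive length and with ends of infinite length, together with a genus $g_V\ge0$ at every inner vertex $V$ (with $g_V\ge 1$ if $V$ is 2-valent) such that $b^1(\Gamma)+\sum_V g_V=g$, and a continuous map $h$ that sends every edge $e$ into one ray, affine linearly with integral slope $w_e>0$ (up to sign; the *weight* of $e$). The ends over each ray are marked by the parts of the corresponding partition, the weight of an end being its part. The following is required. * Balancing: at each inner vertex $V$, for every direction at $h(V)$ the weights of the edges at $V$ mapped to that direction have the same sum $\deg_hV$. * The number $r_V:=(\mathrm{val}(V)+2g_V-2)-\deg_hV\cdot(\mathrm{val}(h(V))-2)$ is $\ge0$, where $\mathrm{val}(c)=3$ and $\mathrm{val}(p)=2$ for $p\ne c$. * The labels $1,\dots,r$ are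 distributed over the inner vertices, and $V$ carries exactly $r_V$ of them; $V_i$ denotes the vertex with label $i$. Isomorphisms of covers are isomorphisms of the source graphs that respect lengths, genera, labels and markings and commute with the maps to $\mathcal L$; $\mathrm{Aut}(h)$ is the automorphism group of $h$. The *combinatorial type* $\alpha$ of $h$ forgets the lengths. The covers of type $\alpha$ form an open cone $D_\alpha\subset\mathbb R_{>0}^{B}$, where $B$ is the number of bounded edges. It is cut out by the integral equations saying that the images of the loops of $\Gamma'$ close up, where $\Gamma'$ is $\Gamma$ with all vertices over $c$ identified. They define a linear map $A_\alpha:\mathbb Z^B\to \mathrm{Hom}(H_1(\Gamma',\mathbb Z),\mathbb Z)\cong\mathbb Z^{b^1(\Gamma')}$, $\ell\mapsto\big(z\mapsto\sum_e z_ew_e\ell_e\big)$, with all edges directed away from $c$. Let $I_\alpha$ be the index of the image of $A_\alpha$. A type is *trivalent* if $r_V=0$ for all $V$ over $c$ and all other inner vertices are 3-valent of genus $0$. A *contraction* of $\alpha$ is the cover at a point of $\overline{D_\alpha}$: the edges of length zero are removed, and each connected subgraph formed by them becomes one vertex, whose genus is the sum of the genera of its vertices plus its first Betti number, and which carries all their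 labels and ends. Let $M=M_g^{\mathrm{trop}}(\mathcal L,\Delta)$ be the space of isomorphism classes of covers whose type is trivalent or a contraction of a trivalent type. Its maximal cones are the $D_\alpha$ with $\alpha$ trivalent. Such a cone has the weight $$\omega(\alpha)=\frac1{|\mathrm{Aut}(h)|}\cdot I_\alpha\cdot\prod_{V\mapsto c}H_V ,$$ where $h$ is any cover of type $\alpha$ and $H_V$ is the triple Hurwitz number of genus $g_V$ and degree $\deg_hV$ whose profiles are given by the weights of the edges at $V$ over $u,v,w$. Here the Hurwitz number with all preimages of the three special points marked is $\frac1{d'!}$ times the number of tuples $(\sigma_u,\sigma_v,\sigma_w,\tau_1,\dots,\tau_s)$ in $S_{d'}$ with $\sigma_u,\sigma_v,\sigma_w$ marked permutations of the given marked cycle types, $\tau_i$ transpositions, product the identity, and generating a transitive subgroup, where $s$ is given by the Riemann–Hurwitz formula ($s=0$ for $H_V$). The *branch map* is $\mathrm{br}^{\mathrm{trop}}:M\to\mathcal L^r$, $h\mapsto(h(V_1),\dots,h(V_r))$. For $\alpha$ trivalent, $\mathrm{mult}_{D_\alpha}\mathrm{br}^{\mathrm{trop}}$ is the index in $\mathbb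 Z^r$ of the image of the lattice $\ker A_\alpha$ under the linear extension of $\mathrm{br}^{\mathrm{trop}}|_{D_\alpha}$. A point $P\in\mathcal L^r$ is in *general position* if none of its components is $c$ and every point of $M$ over $P$ lies in the interior of a maximal cone, i.e. is of trivalent type. **Theorem 3.3.** The degree of the tropical branch map $\mathrm{br}^{\mathrm{trop}}:M_g^{\mathrm{trop}}(\mathcal L,\Delta)\to\mathcal L^r$ does not depend on the point in general position that is pulled back. That is, there is exactly one rational number $N$ such that for every $P\in\mathcal L^r$ in general position the fibre over $P$ is finite and $$\sum_{Q\in M,\ \mathrm{br}^{\mathrm{trop}}(Q)=P}\omega(D(Q))\cdot \mathrm{mult}_{D(Q)}\,\mathrm{br}^{\mathrm{trop}}=N ,$$ where $D(Q)$ is the maximal cone containing $Q$ in its interior. Consequently the tropical triple Hurwitz number $H^{g,\mathrm{trop}}_d(\Delta)$ can be defined as this number $N$. -/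

import Mathlib

open scoped Nat

noncomputable section

open scoped Classical

/-- The tropical line `𝓛`: one vertex (the center `c`) and three unbounded rays, the rays
`u`, `v`, `w` being numbered `0`, `1`, `2`. A point of the open ray `k` is given by its
lattice distance `t > 0` from the center. -/
inductive TropLine : Type
  | center : TropLine
  | ray (k : Fin 3) (t : ℝ) (ht : 0 < t) : TropLine

namespace TropLine

/-- The open cell of `𝓛` that contains a point: `none` for the center, `some k` for ray `k`. -/
def cell : TropLine → Option (Fin 3)
  | center => none
  | ray k _ _ => some k

/-- The lattice distance of a point of `𝓛` from the center. -/
def height : TropLine → ℝ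
  | center => 0
  | ray _ t _ => t

end TropLine

/-! ### Triple Hurwitz numbers -/

/-- Monodromy data of a connected degree `d` cover of `ℙ¹` of genus `g` with marked ramification
profiles `Δ 0`, `Δ 1`, `Δ 2` over three points, and with simple ramification over `s` further
points. The points over the `k`-th special point are marked by `ι k`; they correspond
to the cycles of `σ k`, and `mark k` sends an element of `{1, …, d}` to the mark of its cycle. -/
structure MonodromyDatum (g d s : ℕ) {ι : Fin 3 → Type} [∀ k, Fintype (ι k)]
    (Δ : ∀ k, ι k → ℕ) where
  σ : Fin 3 → Equiv.Perm (Fin d)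
  τ : Fin s → Equiv.Perm (Fin d)
  mark : ∀ k, Fin d → ι k
  mark_eq_iff : ∀ k x y, mark k x = mark k y ↔ (σ k).SameCycle x y
  mark_card : ∀ k i, Nat.card {x // mark k x = i} = Δ k i
  isSwap : ∀ j, (τ j).IsSwap
  prod_eq_one : (List.ofFn τ).prod * σ 0 * σ 1 * σ 2 = 1
  transitive : ∀ x y : Fin d,
    ∃ ρ ∈ Subgroup.closure (Set.range σ ∪ Set.range τ), ρ x = y
  riemannHurwitz : s + d + 2 = (∑ k, Fintype.card (ι k)) + 2 * g

/-- The triple Hurwitz number `H^g_d(Δ)` with all preimages of the three special points marked.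
The number `s` of simple branch points is the one of the Riemann-Hurwitz formula;
if that formula gives a negative number, then there are no data and the Hurwitz number is `0`. -/
def hurwitzNumber (g d : ℕ) {ι : Fin 3 → Type} [∀ k, Fintype (ι k)] (Δ : ∀ k, ι k → ℕ) : ℚ :=
  (Nat.card (MonodromyDatum g d ((∑ k, Fintype.card (ι k)) + 2 * g - (d + 2)) Δ) : ℚ) / (d ! : ℚ)

/-! ### Combinatorial types of covers of `𝓛` -/

/-- The discrete data of a map from a marked tropical curve to `𝓛`.
* `V` is the set of inner vertices, `E` the set of bounded edges. No bounded edge is contracted,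
  so it lies over a single ray; it is directed from its endpoint `src` closer to the center
  of `𝓛` to its endpoint `tgt` farther away.
* There are `n k` ends over the ray `k`, marked by `Fin (n k)`; `ends k i` is the inner
  vertex adjacent to the end marked `i`.
* `label i` is the vertex that carries the label `i`.
* `cell v` is the open cell of `𝓛` to which `v` is mapped (`none` is the center). -/
structure CoverGraph (r : ℕ) (n : Fin 3 → ℕ) where
  V : Type
  E : Type
  [fintypeV : Fintype V]
  [fintypeE : Fintype E]
  genus : V → ℕ
  src : E → V
  tgt : E → V
  weight : E → ℕ
  ends : ∀ k, Fin (n k) → V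
  label : Fin r → V
  cell : V → Option (Fin 3)

attribute [instance] CoverGraph.fintypeV CoverGraph.fintypeE

namespace CoverGraph

variable {r : ℕ} {n : Fin 3 → ℕ} (G : CoverGraph r n) (Δ : ∀ k, Fin (n k) → ℕ)

/-- The valence of an inner vertex; ends are counted. -/
def val (v : G.V) : ℕ :=
  Fintype.card {e // G.src e = v} + Fintype.card {e // G.tgt e = v}
    + ∑ k, Fintype.card {i // G.ends k i = v}

/-- The edges and ends at `v` that leave `v` in the outward direction of the ray `k`. -/
abbrev Out (v : G.V) (k : Fin 3) : Type :=
  {e // G.src e = v ∧ G.cell (G.tgt e) = some k} ⊕ {i // G.ends k i = v}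

/-- The weight of an outgoing edge or end; the end marked `i` over the ray `k` has
weight `Δ k i`. -/
def outWeight (v : G.V) (k : Fin 3) : G.Out v k → ℕ :=
  Sum.elim (fun e => G.weight e.1) (fun i => Δ k i.1)

/-- The sum of the weights of the edges and ends leaving `v` in direction `k`. -/
def outflow (v : G.V) (k : Fin 3) : ℕ := ∑ x : G.Out v k, G.outWeight Δ v k x

/-- The sum of the weights of the edges at `v` that lead towards the center. -/
def inflow (v : G.V) : ℕ := ∑ e : {e // G.tgt e = v}, G.weight e.1

/-- The local degree at `v`: by the balancing condition, below, all
directions at the image point give the same number. -/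
def localDegree (v : G.V) : ℕ := if G.cell v = none then G.outflow Δ v 0 else G.inflow v

/-- The valence in `𝓛` of the image point of `v`: `3` at the center, `2` on a ray. -/
def targetVal (v : G.V) : ℕ := if G.cell v = none then 3 else 2

/-- The RH-number `r_v = (val v + 2 g_v - 2) - deg v * (val (h v) - 2)`. -/
def rhNumber (v : G.V) : ℤ :=
  ((G.val v : ℤ) + 2 * (G.genus v : ℤ) - 2)
    - (G.localDegree Δ v : ℤ) * ((G.targetVal v : ℤ) - 2)

/-- Two vertices are joined by a path of bounded edges from the set `S`. -/
def Joined (S : Set G.E) : G.V → G.V → Prop :=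
  Relation.EqvGen fun a b => ∃ e ∈ S, G.src e = a ∧ G.tgt e = b

end CoverGraph

/-- A combinatorial type of covers of `𝓛` of genus `g`, with `r` labels and with
(marked) ramification profile `Δ`. -/
structure CoverType (g r : ℕ) {n : Fin 3 → ℕ} (Δ : ∀ k, Fin (n k) → ℕ)
    extends CoverGraph r n where
  weight_pos : ∀ e, 0 < weight e
  /-- every bounded edge lies over one ray -/
  edge_cell : ∀ e, ∃ k, cell (tgt e) = some k ∧ (cell (src e) = none ∨ cell (src e) = some k)
  /-- the ends over the ray `k` start at the center or on the ray `k` -/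
  ends_cell : ∀ k i, cell (ends k i) = none ∨ cell (ends k i) = some k
  /-- balancing over the center -/
  balanced_center : ∀ v, cell v = none →
    ∀ k l, toCoverGraph.outflow Δ v k = toCoverGraph.outflow Δ v l
  /-- balancing over the ray `k` -/
  balanced_ray : ∀ v k, cell v = some k → toCoverGraph.inflow v = toCoverGraph.outflow Δ v k
  two_valent : ∀ v, toCoverGraph.val v = 2 → 1 ≤ genus v
  /-- every vertex has exactly `r_v` labels; in particular `r_v ≥ 0` -/
  card_label : ∀ v, (Fintype.card {i // label i = v} : ℤ) = toCoverGraph.rhNumber Δ v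
  nonempty : Nonempty V
  connected : ∀ v w, toCoverGraph.Joined Set.univ v w
  /-- the genus is the sum of the first Betti number and the genera of the vertices -/
  genus_eq : (g : ℤ) = ((Fintype.card E : ℤ) - (Fintype.card V : ℤ) + 1) + ∑ v, (genus v : ℤ)

namespace CoverType

variable {g r : ℕ} {n : Fin 3 → ℕ} {Δ : ∀ k, Fin (n k) → ℕ} (α : CoverType g r Δ)

/-- A type is trivalent if the vertices over the center have RH-number `0` and all
others are trivalent of genus `0`. -/
def IsTrivalent : Prop :=
  ∀ v, (α.cell v = none → α.rhNumber Δ v = 0) ∧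
    (α.cell v ≠ none → α.val v = 3 ∧ α.genus v = 0)

/-- The vertex of the graph `Γ'`, in which all vertices over the center are
identified to one vertex `none`. -/
def mergedVertex (v : α.V) : Option α.V := if α.cell v = none then none else some v

/-- The simplicial boundary map of `Γ'`. -/
def boundary : (α.E → ℤ) →ₗ[ℤ] (Option α.V → ℤ) :=
  ∑ e, (LinearMap.proj e : (α.E → ℤ) →ₗ[ℤ] ℤ).smulRight
    (Pi.single (α.mergedVertex (α.tgt e)) 1 - Pi.single (α.mergedVertex (α.src e)) 1)

/-- The group `H₁(Γ', ℤ)`. -/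
def cycles : Submodule ℤ (α.E → ℤ) := LinearMap.ker α.boundary

/-- The equations that cut out the cone of `α`: a length vector `ℓ` is sent to the functional
`z ↦ ∑ₑ zₑ wₑ ℓₑ` on `H₁(Γ', ℤ)`, which measures by how much the images of the loops fail to
close up. A choice of generators of `H₁(Γ', ℤ)` makes this a map `ℤ^B → ℤ^{b¹(Γ')}`. -/
def equations : (α.E → ℤ) →ₗ[ℤ] Module.Dual ℤ α.cycles :=
  ∑ e, (LinearMap.proj e : (α.E → ℤ) →ₗ[ℤ] ℤ).smulRight
    ((α.weight e : ℤ) • (LinearMap.proj e : (α.E → ℤ) →ₗ[ℤ] ℤ).comp α.cycles.subtype)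

/-- The index `I_α` of the linear map given by the equations. -/
def latticeIndex : ℕ := (LinearMap.range α.equations).toAddSubgroup.index

/-- The open cone `D_α` of the length vectors of covers of type `α`. -/
def cone : Set (α.E → ℝ) :=
  {ℓ | (∀ e, 0 < ℓ e) ∧ ∀ z ∈ α.cycles, ∑ e, (z e : ℝ) * (α.weight e : ℝ) * ℓ e = 0}

/-- The image under the (linear extension of the) branch map of the lattice `ker A_α`
of integral points in the span of `D_α`. Here `y` gives the
heights of the images of the vertices. The target is the lattice `ℤ^r` of the span of
a maximal cone of `𝓛^r`. -/
def branchLattice : AddSubgroup (Fin r → ℤ) where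
  carrier := {p | ∃ ℓ ∈ LinearMap.ker α.equations, ∃ y : α.V → ℤ,
    (∀ v, α.cell v = none → y v = 0) ∧
    (∀ e, y (α.tgt e) = y (α.src e) + (α.weight e : ℤ) * ℓ e) ∧
    ∀ i, p i = y (α.label i)}
  zero_mem' := ⟨0, Submodule.zero_mem _, 0, by simp, by simp, by simp⟩
  add_mem' := by
    rintro p q ⟨ℓ, hℓ, y, h1, h2, h3⟩ ⟨m, hm, z, k1, k2, k3⟩
    refine ⟨ℓ + m, Submodule.add_mem _ hℓ hm, y + z, ?_, ?_, ?_⟩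
    · intro v hv
      simp [h1 v hv, k1 v hv]
    · intro e
      simp only [Pi.add_apply, h2 e, k2 e]
      ring
    · intro i
      simp [h3 i, k3 i]
  neg_mem' := by
    rintro p ⟨ℓ, hℓ, y, h1, h2, h3⟩
    refine ⟨-ℓ, Submodule.neg_mem _ hℓ, -y, ?_, ?_, ?_⟩
    · intro v hv
      simp [h1 v hv]
    · intro e
      simp only [Pi.neg_apply, h2 e]
      ring
    · intro i
      simp [h3 i]

/-- The local multiplicity of the branch map on the cone `D_α`: the index of the image lattice. -/
def branchMult : ℕ := α.branchLattice.index

/-- The Hurwitz number `H_V` of a vertex over the center, formed with the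
three local ramification profiles at that vertex. -/
def vertexHurwitz (v : α.V) : ℚ :=
  hurwitzNumber (α.genus v) (α.localDegree Δ v) (fun k => α.outWeight Δ v k)

end CoverType

/-! ### Covers and their moduli space -/

/-- A tropical cover `h : Γ → 𝓛`: a combinatorial type, the lengths of the bounded edges, and
the images of the inner vertices. On the bounded edge `e` the map `h` is affine linear with slope
`weight e`, directed away from the center; on an end over the ray `k` it is affine linear with the
given weight, towards infinity. So `h` is determined by these data. -/
structure TropCover (g r : ℕ) {n : Fin 3 → ℕ} (Δ : ∀ k, Fin (n k) → ℕ)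
    extends CoverType g r Δ where
  len : E → ℝ
  len_pos : ∀ e, 0 < len e
  pos : V → TropLine
  pos_cell : ∀ v, (pos v).cell = cell v
  pos_edge : ∀ e, (pos (tgt e)).height = (pos (src e)).height + (weight e : ℝ) * len e

namespace TropCover

variable {g r : ℕ} {n : Fin 3 → ℕ} {Δ : ∀ k, Fin (n k) → ℕ}

/-- Isomorphisms of covers: isomorphisms of the source curves that commute with the maps to `𝓛`.
They respect the direction of the edges, as that is given by the map to `𝓛`. -/
structure Iso (C D : TropCover g r Δ) where
  onV : C.V ≃ D.V
  onE : C.E ≃ D.E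
  src_eq : ∀ e, D.src (onE e) = onV (C.src e)
  tgt_eq : ∀ e, D.tgt (onE e) = onV (C.tgt e)
  len_eq : ∀ e, D.len (onE e) = C.len e
  weight_eq : ∀ e, D.weight (onE e) = C.weight e
  genus_eq : ∀ v, D.genus (onV v) = C.genus v
  label_eq : ∀ i, D.label i = onV (C.label i)
  ends_eq : ∀ k i, D.ends k i = onV (C.ends k i)
  pos_eq : ∀ v, D.pos (onV v) = C.pos v

/-- The identity isomorphism. -/
def Iso.refl (C : TropCover g r Δ) : Iso C C where
  onV := Equiv.refl _
  onE := Equiv.refl _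
  src_eq _ := rfl
  tgt_eq _ := rfl
  len_eq _ := rfl
  weight_eq _ := rfl
  genus_eq _ := rfl
  label_eq _ := rfl
  ends_eq _ _ := rfl
  pos_eq _ := rfl

/-- The inverse isomorphism. -/
def Iso.symm {C D : TropCover g r Δ} (f : Iso C D) : Iso D C where
  onV := f.onV.symm
  onE := f.onE.symm
  src_eq e := by rw [Equiv.eq_symm_apply, ← f.src_eq, Equiv.apply_symm_apply]
  tgt_eq e := by rw [Equiv.eq_symm_apply, ← f.tgt_eq, Equiv.apply_symm_apply]
  len_eq e := by rw [← f.len_eq, Equiv.apply_symm_apply]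
  weight_eq e := by rw [← f.weight_eq, Equiv.apply_symm_apply]
  genus_eq v := by rw [← f.genus_eq, Equiv.apply_symm_apply]
  label_eq i := by rw [Equiv.eq_symm_apply, ← f.label_eq]
  ends_eq k i := by rw [Equiv.eq_symm_apply, ← f.ends_eq]
  pos_eq v := by rw [← f.pos_eq, Equiv.apply_symm_apply]

/-- The composition of isomorphisms. -/
def Iso.trans {C D F : TropCover g r Δ} (a : Iso C D) (b : Iso D F) : Iso C F where
  onV := a.onV.trans b.onV
  onE := a.onE.trans b.onE
  src_eq e := by simp [b.src_eq, a.src_eq]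
  tgt_eq e := by simp [b.tgt_eq, a.tgt_eq]
  len_eq e := by simp [b.len_eq, a.len_eq]
  weight_eq e := by simp [b.weight_eq, a.weight_eq]
  genus_eq v := by simp [b.genus_eq, a.genus_eq]
  label_eq i := by simp [b.label_eq, a.label_eq]
  ends_eq k i := by simp [b.ends_eq, a.ends_eq]
  pos_eq v := by simp [b.pos_eq, a.pos_eq]

/-- The weight `ω(α) = 1/|Aut(h)| * I_α * ∏_V H_V` of the maximal cone of a trivalent
cover `h`; the product is over the vertices over the center. -/
def coneWeight (C : TropCover g r Δ) : ℚ :=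
  1 / (Nat.card (Iso C C) : ℚ) * (C.latticeIndex : ℚ)
    * ∏ v : {v // C.cell v = none}, C.vertexHurwitz v.1

/-- `C` is the contraction of the type `α` at the point `lim` of the closed cone of `α`:
the edges `e` with `lim e = 0` are removed and their endpoints identified. Each connected
subgraph of such edges becomes one vertex, whose genus is the sum of the genera in the subgraph plus
its first Betti number, and which gets all labels and all ends of the subgraph. -/
structure Contraction (α : CoverType g r Δ) (C : TropCover g r Δ) where
  lim : α.E → ℝ
  lim_mem : lim ∈ closure α.cone
  onV : α.V → C.V
  onV_surj : Function.Surjective onV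
  onV_eq_iff : ∀ v w, onV v = onV w ↔ α.Joined {e | lim e = 0} v w
  onE : {e // lim e ≠ 0} ≃ C.E
  src_eq : ∀ e, C.src (onE e) = onV (α.src e.1)
  tgt_eq : ∀ e, C.tgt (onE e) = onV (α.tgt e.1)
  weight_eq : ∀ e, C.weight (onE e) = α.weight e.1
  len_eq : ∀ e, C.len (onE e) = lim e.1
  genus_eq : ∀ x, (C.genus x : ℤ) = ∑ v : {v // onV v = x}, (α.genus v.1 : ℤ)
    + ((Fintype.card {e // lim e = 0 ∧ onV (α.src e) = x} : ℤ)
      - (Fintype.card {v // onV v = x} : ℤ) + 1)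
  label_eq : ∀ i, C.label i = onV (α.label i)
  ends_eq : ∀ k i, C.ends k i = onV (α.ends k i)
  cell_none : ∀ x, C.cell x = none ↔ ∃ v, onV v = x ∧ α.cell v = none
  cell_some : ∀ v, C.cell (onV v) ≠ none → C.cell (onV v) = α.cell v

/-- The covers that occur in the moduli space: those whose type is trivalent or a contraction
of a trivalent type. (A trivalent type is its own contraction at points of its open cone.) -/
def InModuli (C : TropCover g r Δ) : Prop :=
  ∃ α : CoverType g r Δ, α.IsTrivalent ∧ Nonempty (Contraction α C)

end TropCover

/-- Isomorphism of covers, as an equivalence relation on the covers in the moduli space. -/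
instance coverSetoid (g r : ℕ) {n : Fin 3 → ℕ} (Δ : ∀ k, Fin (n k) → ℕ) :
    Setoid {C : TropCover g r Δ // C.InModuli} where
  r C D := Nonempty (TropCover.Iso C.1 D.1)
  iseqv :=
    ⟨fun C => ⟨TropCover.Iso.refl C.1⟩, fun ⟨f⟩ => ⟨f.symm⟩, fun ⟨f⟩ ⟨h⟩ => ⟨f.trans h⟩⟩

/-- The (points of the) moduli space `M_g^trop(𝓛, Δ)` of tropical covers of `𝓛`. -/
def TropModuli (g r : ℕ) {n : Fin 3 → ℕ} (Δ : ∀ k, Fin (n k) → ℕ) : Type 1 :=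
  Quotient (coverSetoid g r Δ)

namespace TropModuli

variable {g r : ℕ} {n : Fin 3 → ℕ} {Δ : ∀ k, Fin (n k) → ℕ}

/-- A cover representing a point of the moduli space. -/
def cover (Q : TropModuli g r Δ) : TropCover g r Δ := (Quotient.out Q).1

/-- The tropical branch map: the images of the labelled vertices. -/
def branchMap : TropModuli g r Δ → (Fin r → TropLine) :=
  Quotient.lift (fun C i => C.1.pos (C.1.label i)) (by
    rintro C D ⟨f⟩
    funext i
    rw [f.label_eq, f.pos_eq])

/-- A point `P` of `𝓛^r` is in general position for the branch map if it lies in the interior of a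
maximal cone of `𝓛^r` and all its preimages lie in the interior of maximal cones of the
moduli space, that is, in cones of trivalent types. -/
def GeneralPosition (g : ℕ) {r : ℕ} {n : Fin 3 → ℕ} (Δ : ∀ k, Fin (n k) → ℕ)
    (P : Fin r → TropLine) : Prop :=
  (∀ i, P i ≠ TropLine.center) ∧
    ∀ Q : TropModuli g r Δ, Q.branchMap = P → Q.cover.IsTrivalent

/-- The degree of the branch map, computed at the point `P`: the sum over the preimages `Q` of `P`
of the weight of the cone of `Q` times the local multiplicity of the branch map there. -/
def branchDegreeAt (g : ℕ) {r : ℕ} {n : Fin 3 → ℕ} (Δ : ∀ k, Fin (n k) → ℕ)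
    (P : Fin r → TropLine) : ℚ :=
  ∑ᶠ Q : {Q : TropModuli g r Δ // Q.branchMap = P},
    Q.1.cover.coneWeight * (Q.1.cover.branchMult : ℚ)

end TropModuli

end

/-!
The degree of the branch map is a count of monodromy representations, in which the point `P` does
not occur.

Let `P` be in general position. The labels are listed by the distances of the components of `P`
from the center (`IsSorted`); `κ` is the list of their rays. Cut a trivalent cover `h` over `P`
between consecutive vertices of this list. At each cut there are over every ray the edges and ends
that pass it (`Front`), and a *state* is a triple of permutations of `{1, …, d}` whose cycles are
marked by these strands, with lengths equal to the weights. A *chain* (`IsChain`) starts with a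
state next to the center, in which the permutations have product one and are transitive over each
vertex over the center; at each further vertex one permutation is multiplied by a transposition
that cuts or joins the cycles belonging to the edges at this vertex.

* There are `d! * ∏ H_V` states next to the center (`card_isStart`), and across a trivalent vertex
  there are as many continuations as the product of the weights of the incoming edges
  (`card_isStep`). So `h` has `d! * ∏ H_V * ∏ w_e` chains (`card_isChain`).
* `I_α` times the multiplicity of the branch map is the product `∏ w_e`
  (`latticeIndex_mul_branchMult`). The vertices outside the center carry the labels, so that the
  positions of the labelled vertices are the height functions on `Γ'`; their coboundaries form the
  kernel of the pairing of `ℤ^E` with the cycles, and the two numbers are the indices of the two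
  steps of `ℤ^E ⊇ K + wℤ^E ⊇ wℤ^E`, where `K` is this kernel.

Hence `h` contributes to the degree the number of its chains divided by `d! * |Aut(h)|`. Forgetting
the graph, a chain becomes a *path* (`IsPath`): a sequence of triples of permutations, the first
with product one, in which the `j`-th step multiplies the permutation over the ray `κ j` by a
transposition; the cycles of the last triple are marked by the ends. The cover can be recovered
from the path: two covers with chains over the same path are isomorphic, by an isomorphism that
takes one chain to the other (`Iso.exists_of_chains`). So the chains of `h` over one path form a
torsor under `Aut(h)` (`card_isChain_eq`), and `h` contributes the number of its paths divided by
`d!` (`coneWeight_mul_branchMult`).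

Conversely, every path is carried by a trivalent type (`pathType`), whose vertices over the center
are the orbits of the first triple and whose bounded edges are the cycles changed in some step; the
genera come from the Riemann-Hurwitz formula (`exists_genus`). This type is realized by a cover over
`P`. Indeed, placing its vertices over the components of `P` gives non-negative lengths of the
edges, hence a point of `M` over `P`, and if a length were zero, then the contraction would have a
vertex with two labels and `P` would not be in general position (`exists_cover`). So the degree over
`P` is the number of all paths, divided by `d!` (`branchDegreeAt_eq`).

The number of paths does not depend on the rays `κ`, which are all that is left of `P`: the last
triple and the sequence of the products of the triples determine the path, and the products are any
sequence that is multiplied by a transposition in each step (`card_isPath_eq`).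

The fibres are finite because the graph of a cover over `P` is bounded in size, genus and weights,
and determines the cover (`finite_fibre`). The number is unique because there are points in general
position: those whose components are at different heights of one ray (`exists_generalPosition`).
-/

noncomputable section

open scoped Classical

namespace TropHurwitz

open Equiv Equiv.Perm

/-! ### Cycles of a permutation and of its product with a transposition -/

section Cycles

variable {X : Type}

theorem mem_of_sameCycle [Finite X] {σ : Perm X} {S : Set X} (hS : ∀ z ∈ S, σ z ∈ S) {z w : X}
    (hz : z ∈ S) (h : σ.SameCycle z w) : w ∈ S := by
  obtain ⟨n, rfl⟩ := h.exists_nat_pow_eq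
  induction n with
  | zero => simpa using hz
  | succ n ih =>
    rw [pow_succ', Perm.mul_apply]
    exact hS _ (ih ⟨n, by simp⟩)

/-- A point is touched by the passage from `σ` to `σ'` if the two permutations differ somewhere on
its `σ`-cycle. -/
def Touched (σ σ' : Perm X) (z : X) : Prop := ∃ y, σ.SameCycle z y ∧ σ y ≠ σ' y

theorem Touched.congr {σ σ' : Perm X} {z w : X} (h : σ.SameCycle z w) :
    Touched σ σ' z ↔ Touched σ σ' w :=
  ⟨fun ⟨y, hy, h'⟩ => ⟨y, h.symm.trans hy, h'⟩, fun ⟨y, hy, h'⟩ => ⟨y, h.trans hy, h'⟩⟩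

theorem sameCycle_of_not_touched [Finite X] {σ σ' : Perm X} {z w : X} (h : ¬ Touched σ σ' z)
    (hzw : σ.SameCycle z w) : σ'.SameCycle z w := by
  refine mem_of_sameCycle (σ := σ) (S := {w | σ.SameCycle z w ∧ σ'.SameCycle z w}) ?_
    ⟨SameCycle.refl _ _, SameCycle.refl _ _⟩ hzw |>.2
  rintro y ⟨h1, h2⟩
  refine ⟨sameCycle_apply_right.2 h1, ?_⟩
  have : σ y = σ' y := by
    by_contra hne
    exact h ⟨y, h1, hne⟩
  rw [this]
  exact sameCycle_apply_right.2 h2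

theorem not_touched_symm [Finite X] {σ σ' : Perm X} {z : X} (h : ¬ Touched σ σ' z) :
    ¬ Touched σ' σ z := by
  have key : ∀ y, σ'.SameCycle z y → σ.SameCycle z y := by
    intro y hy
    refine mem_of_sameCycle (σ := σ') (S := {w | σ.SameCycle z w}) ?_ (SameCycle.refl _ _) hy
    intro w hw
    have : σ w = σ' w := by
      by_contra hne
      exact h ⟨w, hw, hne⟩
    show σ.SameCycle z (σ' w)
    rw [← this]
    exact sameCycle_apply_right.2 hw
  rintro ⟨y, hy, hne⟩
  exact h ⟨y, key y hy, hne.symm⟩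

theorem touched_comm [Finite X] {σ σ' : Perm X} {z : X} : Touched σ σ' z ↔ Touched σ' σ z :=
  ⟨fun h => by_contra fun h' => not_touched_symm h' h,
    fun h => by_contra fun h' => not_touched_symm h' h⟩

theorem sameCycle_iff_of_not_touched [Finite X] {σ σ' : Perm X} {z w : X} (h : ¬ Touched σ σ' z) :
    σ.SameCycle z w ↔ σ'.SameCycle z w :=
  ⟨sameCycle_of_not_touched h, sameCycle_of_not_touched (not_touched_symm h)⟩

theorem touched_congr_right [Finite X] {σ σ' : Perm X} {z w : X} (h : σ'.SameCycle z w) :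
    Touched σ σ' z ↔ Touched σ σ' w := by
  rw [touched_comm, touched_comm (z := w)]
  exact Touched.congr h

theorem touched_mul_swap {σ : Perm X} {x y z : X} (hxy : x ≠ y) :
    Touched σ (σ * swap x y) z ↔ σ.SameCycle z x ∨ σ.SameCycle z y := by
  constructor
  · rintro ⟨w, hw, hne⟩
    rw [Perm.mul_apply] at hne
    have : w ≠ swap x y w := fun h => hne (by rw [← h])
    by_cases h1 : w = x
    · exact Or.inl (h1 ▸ hw)
    by_cases h2 : w = y
    · exact Or.inr (h2 ▸ hw)
    exact absurd (swap_apply_of_ne_of_ne h1 h2).symm this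
  · rintro (h | h)
    · exact ⟨x, h, by simpa using hxy⟩
    · exact ⟨y, h, by simpa using hxy.symm⟩

theorem touched_mul_swap' [Finite X] {σ : Perm X} {x y z : X} (hxy : x ≠ y) :
    Touched σ (σ * swap x y) z ↔ (σ * swap x y).SameCycle z x ∨ (σ * swap x y).SameCycle z y := by
  have h := touched_mul_swap (σ := σ * swap x y) (z := z) hxy
  rw [mul_assoc, swap_mul_self, mul_one, touched_comm] at h
  exact h

/-- Multiplication by a transposition of points in different cycles joins these cycles. -/
theorem sameCycle_mul_swap_of_not [Finite X] {σ : Perm X} {x y : X} (h : ¬ σ.SameCycle x y) :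
    (σ * swap x y).SameCycle x y := by
  by_contra hy
  have hS : σ y ∈ {z | σ.SameCycle y z ∧ (σ * swap x y).SameCycle x z} := by
    refine ⟨sameCycle_apply_right.2 (SameCycle.refl _ _), ?_⟩
    have : (σ * swap x y) x = σ y := by simp
    rw [← this]
    exact sameCycle_apply_right.2 (SameCycle.refl _ _)
  have := mem_of_sameCycle (σ := σ) (w := y) ?_ hS
    (sameCycle_apply_left.2 (SameCycle.refl _ _))
  · exact hy this.2
  · rintro z ⟨h1, h2⟩
    refine ⟨sameCycle_apply_right.2 h1, ?_⟩
    have hzx : z ≠ x := fun e => h (e ▸ h1).symm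
    have hzy : z ≠ y := fun e => hy (e ▸ h2)
    have : (σ * swap x y) z = σ z := by
      rw [Perm.mul_apply, swap_apply_of_ne_of_ne hzx hzy]
    rw [← this]
    exact sameCycle_apply_right.2 h2

theorem sameCycle_iff_iterate [Finite X] {σ : Perm X} {x y : X} :
    σ.SameCycle x y ↔ ∃ i < Function.minimalPeriod σ x, σ^[i] x = y := by
  constructor
  · intro h
    obtain ⟨n, rfl⟩ := h.exists_nat_pow_eq
    refine ⟨n % Function.minimalPeriod σ x, Nat.mod_lt _ ?_, ?_⟩
    · exact Function.minimalPeriod_pos_of_mem_periodicPts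
        (σ.injective.mem_periodicPts x)
    · rw [Function.iterate_mod_minimalPeriod_eq, Perm.iterate_eq_pow]
  · rintro ⟨i, -, rfl⟩
    rw [Perm.iterate_eq_pow]
    exact ⟨i, by simp⟩

theorem card_sameCycle [Finite X] (σ : Perm X) (x : X) :
    Nat.card {z // σ.SameCycle x z} = Function.minimalPeriod σ x := by
  have : {z | σ.SameCycle x z} = (fun i => σ^[i] x) '' Set.Iio (Function.minimalPeriod σ x) := by
    ext z
    simp only [Set.mem_ofPred_eq, sameCycle_iff_iterate, Set.mem_image, Set.mem_Iio]
  change Nat.card ({z | σ.SameCycle x z} : Set X) = _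
  rw [this, Nat.card_image_of_injOn Function.iterate_injOn_Iio_minimalPeriod]
  simp

/-- Multiplication by the transposition of `x` and `σ^b x` cuts off the cycle
`(σ x, …, σ^b x)`. -/
theorem sameCycle_mul_swap_iterate [Finite X] {σ : Perm X} {x : X} {b : ℕ} (hb : 0 < b)
    (hb' : b < Function.minimalPeriod σ x) (z : X) :
    (σ * swap x (σ^[b] x)).SameCycle (σ^[b] x) z ↔ ∃ i ∈ Set.Icc 1 b, σ^[i] x = z := by
  set y := σ^[b] x with hy
  have hinj := Function.iterate_injOn_Iio_minimalPeriod (f := σ) (x := x)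
  have hstep : ∀ i, 1 ≤ i → i < b → (σ * swap x y) (σ^[i] x) = σ^[i + 1] x := by
    intro i h1 h2
    have e1 : σ^[i] x ≠ x := by
      intro e
      have := hinj (Set.mem_Iio.2 (h2.trans hb')) (Set.mem_Iio.2 (hb.trans hb'))
        (show σ^[i] x = σ^[0] x from e)
      omega
    have e2 : σ^[i] x ≠ y := by
      intro e
      have := hinj (Set.mem_Iio.2 (h2.trans hb')) (Set.mem_Iio.2 hb') e
      omega
    rw [Perm.mul_apply, swap_apply_of_ne_of_ne e1 e2, Function.iterate_succ_apply']
  have hlast : (σ * swap x y) y = σ^[1] x := by simp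
  constructor
  · intro h
    refine mem_of_sameCycle (S := {z | ∃ i ∈ Set.Icc 1 b, σ^[i] x = z}) ?_ ⟨b, ⟨hb, le_rfl⟩, rfl⟩ h
    rintro _ ⟨i, ⟨h1, h2⟩, rfl⟩
    rcases h2.lt_or_eq with h3 | rfl
    · exact ⟨i + 1, ⟨by omega, h3⟩, (hstep i h1 h3).symm⟩
    · exact ⟨1, ⟨le_rfl, h1⟩, hlast.symm⟩
  · rintro ⟨i, ⟨h1, h2⟩, rfl⟩
    induction i, h1 using Nat.le_induction with
    | base =>
      rw [← hlast]
      exact sameCycle_apply_right.2 (SameCycle.refl _ _)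
    | succ i h1 ih =>
      rw [← hstep i h1 h2]
      exact sameCycle_apply_right.2 (ih (by omega))

theorem card_sameCycle_mul_swap_iterate [Finite X] {σ : Perm X} {x : X} {b : ℕ} (hb : 0 < b)
    (hb' : b < Function.minimalPeriod σ x) :
    Nat.card {z // (σ * swap x (σ^[b] x)).SameCycle (σ^[b] x) z} = b := by
  have : {z | (σ * swap x (σ^[b] x)).SameCycle (σ^[b] x) z}
      = (fun i => σ^[i] x) '' Set.Icc 1 b := by
    ext z
    simp only [Set.mem_ofPred_eq, sameCycle_mul_swap_iterate hb hb', Set.mem_image]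
  change Nat.card ({z | (σ * swap x (σ^[b] x)).SameCycle (σ^[b] x) z} : Set X) = _
  rw [this, Nat.card_image_of_injOn]
  · simp
  · exact Function.iterate_injOn_Iio_minimalPeriod.mono fun i hi => lt_of_le_of_lt hi.2 hb'

theorem not_sameCycle_mul_swap_iterate [Finite X] {σ : Perm X} {x : X} {b : ℕ} (hb : 0 < b)
    (hb' : b < Function.minimalPeriod σ x) :
    ¬ (σ * swap x (σ^[b] x)).SameCycle (σ^[b] x) x := by
  rw [sameCycle_mul_swap_iterate hb hb']
  rintro ⟨i, ⟨h1, h2⟩, e⟩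
  have := Function.iterate_injOn_Iio_minimalPeriod (f := σ) (x := x)
    (Set.mem_Iio.2 (h2.trans_lt hb')) (Set.mem_Iio.2 (hb.trans hb'))
    (show σ^[i] x = σ^[0] x from e)
  omega

/-- Multiplication by a transposition of points in the same cycle cuts this cycle. -/
theorem not_sameCycle_mul_swap [Finite X] {σ : Perm X} {x y : X} (hxy : x ≠ y)
    (h : σ.SameCycle x y) :
    ¬ (σ * swap x y).SameCycle x y := by
  obtain ⟨b, hb', rfl⟩ := sameCycle_iff_iterate.1 h
  have hb : 0 < b := by
    rcases Nat.eq_zero_or_pos b with rfl | h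
    · simp at hxy
    · exact h
  exact fun h' => not_sameCycle_mul_swap_iterate hb hb' h'.symm

end Cycles

/-! ### Passing a vertex: the number of continuations -/

section Step

variable {X Y : Type} [Finite X]

/-- The continuations of a marked permutation `(σ, m)` across a vertex with incoming strands
`In` and outgoing strands `Out`: the permutation is multiplied by a transposition, the cycles
marked by the incoming strands are the touched ones, and the new cycles are marked by the outgoing
strands. -/
structure IsStep (In Out : Finset Y) (wt : Y → ℕ) (σ : Perm X) (m : X → Y)
    (σ' : Perm X) (m' : X → Y) : Prop where
  swap : ∃ x y, x ≠ y ∧ σ' = σ * Equiv.swap x y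
  touched : ∀ x, m x ∈ In ↔ Touched σ σ' x
  keep : ∀ x, m x ∉ In → m' x = m x
  out : ∀ x, m x ∈ In → m' x ∈ Out
  fibre : ∀ x y, m' x = m' y ↔ σ'.SameCycle x y
  size : ∀ e ∈ Out, Nat.card {x // m' x = e} = wt e

variable {In Out : Finset Y} {wt : Y → ℕ} {σ : Perm X} {m : X → Y}

theorem card_fibre_eq_minimalPeriod (hm : ∀ x y, m x = m y ↔ σ.SameCycle x y) (x : X) :
    Nat.card {z // m z = m x} = Function.minimalPeriod σ x := by
  rw [← card_sameCycle]
  exact Nat.card_congr (Equiv.subtypeEquivRight fun z => by rw [← hm, eq_comm])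

/-- The marking after a cycle marked `e₀` has been cut: the new cycle of `y` is marked `e₂`, the
other one `e₁`. -/
def splitMark (m : X → Y) (e₀ e₁ e₂ : Y) (σ' : Perm X) (y : X) (z : X) : Y :=
  if m z = e₀ then (if σ'.SameCycle y z then e₂ else e₁) else m z

/-- The marking after the cycles marked `e₁` and `e₂` have been joined to one marked `e₀`. -/
def joinMark (m : X → Y) (e₀ e₁ e₂ : Y) (z : X) : Y :=
  if m z = e₁ ∨ m z = e₂ then e₀ else m z

/-- The continuation that cuts off the part `(σ x, …, σ^b x)` of a cycle. -/
theorem isStep_split {e₀ e₁ e₂ : Y} (h12 : e₁ ≠ e₂)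
    (hm : ∀ x y, m x = m y ↔ σ.SameCycle x y)
    (hout : ∀ x, m x ≠ e₁ ∧ m x ≠ e₂) (hw1 : 0 < wt e₁) (hw2 : 0 < wt e₂)
    (hcard : Nat.card {x // m x = e₀} = wt e₁ + wt e₂) {x : X} (hx : m x = e₀) :
    IsStep {e₀} {e₁, e₂} wt σ m (σ * swap x (σ^[wt e₂] x))
      (splitMark m e₀ e₁ e₂ (σ * swap x (σ^[wt e₂] x)) (σ^[wt e₂] x)) := by
  have hper : Function.minimalPeriod σ x = wt e₁ + wt e₂ := by
    rw [← card_fibre_eq_minimalPeriod hm x, hx, hcard]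
  have hlt : wt e₂ < Function.minimalPeriod σ x := by omega
  -- multiplication by the transposition of `x` and `y` cuts the cycle into those of `x` and of `y`
  set y := σ^[wt e₂] x with hy
  set σ' := σ * swap x y with hσ'
  have hxy : σ.SameCycle x y := sameCycle_iff_iterate.2 ⟨_, hlt, rfl⟩
  have hnot : ¬ σ'.SameCycle y x := not_sameCycle_mul_swap_iterate hw2 hlt
  have hne : x ≠ y := fun e => hnot (e ▸ SameCycle.refl _ _)
  have htouch : ∀ z, m z = e₀ ↔ Touched σ σ' z := by
    intro z
    rw [hσ', touched_mul_swap hne, ← hx, hm]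
    exact ⟨Or.inl, fun h => h.elim id fun h => h.trans hxy.symm⟩
  have htouch' : ∀ z, m z = e₀ ↔ σ'.SameCycle y z ∨ σ'.SameCycle x z := by
    intro z
    rw [htouch, hσ', touched_mul_swap' hne, ← hσ', or_comm, sameCycle_comm,
      sameCycle_comm (x := z) (y := x)]
  have hsz : Nat.card {z // σ'.SameCycle y z} = wt e₂ :=
    card_sameCycle_mul_swap_iterate hw2 hlt
  have hm2 : ∀ z, splitMark m e₀ e₁ e₂ σ' y z = e₂
      ↔ σ'.SameCycle y z := by
    intro z
    have h1 := htouch' z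
    have h2 := (hout z).2
    unfold splitMark
    split_ifs with h3 h4
    · simp [h4]
    · simp [h4, h12]
    · constructor
      · intro h; exact absurd h h2
      · intro h; tauto
  have hm1 : ∀ z, splitMark m e₀ e₁ e₂ σ' y z = e₁
      ↔ σ'.SameCycle x z := by
    intro z
    have h1 := htouch' z
    have h2 := (hout z).1
    unfold splitMark
    split_ifs with h3 h4
    · constructor
      · intro h; exact absurd h h12.symm
      · intro h; exact absurd (h4.trans h.symm) hnot
    · simp only [true_iff]; tauto
    · constructor
      · intro h; exact absurd h h2
      · intro h; tauto
  refine ⟨⟨x, y, hne, rfl⟩, by simpa using htouch, ?_, ?_, ?_, ?_⟩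
  · intro z hz
    rw [Finset.mem_singleton] at hz
    simp [splitMark, hz]
  · intro z hz
    rw [Finset.mem_singleton] at hz
    rw [splitMark, if_pos hz]
    split_ifs <;> simp
  · intro z w
    by_cases h2 : σ'.SameCycle y z
    · rw [(hm2 z).2 h2, eq_comm, hm2]
      exact ⟨fun h => h2.symm.trans h, fun h => h2.trans h⟩
    by_cases h1 : σ'.SameCycle x z
    · rw [(hm1 z).2 h1, eq_comm, hm1]
      exact ⟨fun h => h1.symm.trans h, fun h => h1.trans h⟩
    have hz : m z ≠ e₀ := fun h => ((htouch' z).1 h).elim h2 h1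
    have hz' : ¬ Touched σ σ' z := fun h => hz ((htouch z).2 h)
    rw [splitMark, if_neg hz, ← sameCycle_iff_of_not_touched hz', ← hm, splitMark]
    by_cases hw : m w = e₀
    · rw [if_pos hw]
      have : m z ≠ m w := fun h => hz (h.trans hw)
      have := hout z
      split_ifs <;> tauto
    · rw [if_neg hw]
  · intro e he
    rw [Finset.mem_insert, Finset.mem_singleton] at he
    rcases he with rfl | rfl
    · rw [Nat.card_congr (Equiv.subtypeEquivRight hm1)]
      have hsum : Nat.card {z // m z = e₀}
          = Nat.card {z // σ'.SameCycle y z} + Nat.card {z // σ'.SameCycle x z} := by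
        rw [← Nat.card_sum]
        refine Nat.card_congr ((Equiv.subtypeEquivRight htouch').trans
          (subtypeOrEquiv _ _ ?_))
        rw [Pi.disjoint_iff]
        intro z
        rw [Prop.disjoint_iff]
        exact fun h => hnot (h.1.trans h.2.symm)
      omega
    · rw [Nat.card_congr (Equiv.subtypeEquivRight hm2), hsz]

/-- A cycle of length `wt e₁ + wt e₂` can be cut into two cycles marked `e₁` and `e₂` in as many
ways as it has elements: the continuation is determined by the element `x` of `isStep_split`. -/
theorem card_isStep_split {e₀ e₁ e₂ : Y} (h12 : e₁ ≠ e₂)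
    (hm : ∀ x y, m x = m y ↔ σ.SameCycle x y)
    (hout : ∀ x, m x ≠ e₁ ∧ m x ≠ e₂) (hw1 : 0 < wt e₁) (hw2 : 0 < wt e₂)
    (hcard : Nat.card {x // m x = e₀} = wt e₁ + wt e₂) :
    Nat.card {p : Perm X × (X → Y) // IsStep {e₀} {e₁, e₂} wt σ m p.1 p.2}
      = wt e₁ + wt e₂ := by
  rw [← hcard]
  symm
  refine Nat.card_eq_of_bijective
    (fun x : {x // m x = e₀} =>
      ⟨(σ * swap x.1 (σ^[wt e₂] x.1),
        splitMark m e₀ e₁ e₂ (σ * swap x.1 (σ^[wt e₂] x.1)) (σ^[wt e₂] x.1)),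
        isStep_split h12 hm hout hw1 hw2 hcard x.2⟩) ⟨?_, ?_⟩
  · rintro ⟨x, hx⟩ ⟨x', hx'⟩ h
    have h := Prod.ext_iff.1 (congrArg Subtype.val h)
    dsimp only at h
    obtain ⟨h1, h2⟩ := h
    have hper : ∀ x, m x = e₀ → wt e₂ < Function.minimalPeriod σ x := by
      intro x hx
      rw [← card_fibre_eq_minimalPeriod hm x, hx, hcard]
      omega
    have hne : ∀ x, m x = e₀ → x ≠ σ^[wt e₂] x := by
      intro x hx e
      have := not_sameCycle_mul_swap_iterate hw2 (hper x hx)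
      rw [← e] at this
      exact this (SameCycle.refl _ _)
    have hsw : swap x (σ^[wt e₂] x) = swap x' (σ^[wt e₂] x') := mul_left_cancel h1
    have hx1 : swap x' (σ^[wt e₂] x') x ≠ x := by
      rw [← hsw, swap_apply_left]
      exact (hne x hx).symm
    by_contra hxx
    have hxx' : x ≠ x' := fun h => hxx (by simp [h])
    -- `x` can only be the other end of the transposition, where the markings differ
    by_cases hxy : x = σ^[wt e₂] x'
    · have h3 := congrFun h2 x
      rw [splitMark, splitMark, if_pos hx, if_pos hx,
        if_neg (not_sameCycle_mul_swap_iterate hw2 (hper x hx)), ← hxy,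
        if_pos (SameCycle.refl _ _)] at h3
      exact h12 h3
    · exact hx1 (swap_apply_of_ne_of_ne hxx' hxy)
  · rintro ⟨⟨σ', m'⟩, ⟨x, y, hne, hσ⟩, htouch, hkeep, hO, hfib, hsize⟩
    simp only at hσ htouch hkeep hO hfib hsize
    subst hσ
    simp only [Finset.mem_singleton, Finset.mem_insert] at htouch hkeep hO hsize
    -- the two ends of the transposition may be exchanged so that `x` is in the part marked `e₁`
    have main : ∀ x y : X, x ≠ y → ∀ σ', σ' = σ * swap x y →
        (∀ z, m z = e₀ ↔ Touched σ σ' z) →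
        (∀ z w, m' z = m' w ↔ σ'.SameCycle z w) →
        m' x = e₁ → m' y = e₂ → ∃ a : {x // m x = e₀},
          (σ * swap a.1 (σ^[wt e₂] a.1) = σ' ∧
            splitMark m e₀ e₁ e₂ (σ * swap a.1 (σ^[wt e₂] a.1)) (σ^[wt e₂] a.1) = m') := by
      rintro x y hne σ' rfl htouch hfib hx hy
      have hxe : m x = e₀ := (htouch x).2 ((touched_mul_swap hne).2 (Or.inl (SameCycle.refl _ _)))
      have hye : m y = e₀ := (htouch y).2 ((touched_mul_swap hne).2 (Or.inr (SameCycle.refl _ _)))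
      obtain ⟨i, hi, hiy⟩ := sameCycle_iff_iterate.1 ((hm x y).1 (hxe.trans hye.symm))
      have hi0 : 0 < i := by
        rcases Nat.eq_zero_or_pos i with rfl | h
        · exact absurd hiy hne
        · exact h
      -- the distance from `x` to `y` is the length of the new cycle of `y`
      have hcy := card_sameCycle_mul_swap_iterate hi0 hi
      rw [hiy] at hcy
      have hie : i = wt e₂ := by
        rw [← hcy, ← hsize e₂ (Or.inr rfl)]
        exact Nat.card_congr (Equiv.subtypeEquivRight fun z => by
          rw [← hfib, hy, eq_comm])
      subst hie
      refine ⟨⟨x, hxe⟩, by rw [hiy], ?_⟩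
      funext z
      simp only [hiy, splitMark]
      by_cases hz : m z = e₀
      · rw [if_pos hz]
        by_cases hyz : (σ * swap x y).SameCycle y z
        · rw [if_pos hyz, ← hy, hfib]
          exact hyz
        · rw [if_neg hyz]
          rcases hO z hz with h | h
          · exact h.symm
          · exact absurd ((hfib _ _).1 (hy.trans h.symm)) hyz
      · rw [if_neg hz, hkeep z hz]
    have hxe : m x = e₀ := (htouch x).2 ((touched_mul_swap hne).2 (Or.inl (SameCycle.refl _ _)))
    have hye : m y = e₀ := (htouch y).2 ((touched_mul_swap hne).2 (Or.inr (SameCycle.refl _ _)))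
    have hdiff : m' x ≠ m' y := by
      rw [Ne, hfib]
      exact not_sameCycle_mul_swap hne ((hm x y).1 (hxe.trans hye.symm))
    rcases hO x hxe with hx | hx <;> rcases hO y hye with hy | hy
    · exact absurd (hx.trans hy.symm) hdiff
    · obtain ⟨a, ha⟩ := main x y hne _ rfl htouch hfib hx hy
      exact ⟨a, Subtype.ext (Prod.ext ha.1 ha.2)⟩
    · obtain ⟨a, ha⟩ := main y x hne.symm _ (by rw [swap_comm]) htouch hfib hy hx
      exact ⟨a, Subtype.ext (Prod.ext ha.1 ha.2)⟩
    · exact absurd (hx.trans hy.symm) hdiff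

/-- The continuation that joins the cycles marked `e₁` and `e₂` by a transposition of `x` and `y`.
-/
theorem isStep_join {e₀ e₁ e₂ : Y} (h12 : e₁ ≠ e₂)
    (hm : ∀ x y, m x = m y ↔ σ.SameCycle x y) (hout : ∀ x, m x ≠ e₀)
    (hc1 : Nat.card {x // m x = e₁} = wt e₁) (hc2 : Nat.card {x // m x = e₂} = wt e₂)
    (hw : wt e₁ + wt e₂ = wt e₀) {x y : X} (hx : m x = e₁) (hy : m y = e₂) :
    IsStep {e₁, e₂} {e₀} wt σ m (σ * swap x y)
      (joinMark m e₀ e₁ e₂) := by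
  have hxy : ¬ σ.SameCycle x y := by
    rw [← hm, hx, hy]
    exact h12
  have hne : x ≠ y := fun e => hxy (e ▸ SameCycle.refl _ _)
  have htouch : ∀ z, m z = e₁ ∨ m z = e₂ ↔ Touched σ (σ * swap x y) z := by
    intro z
    rw [touched_mul_swap hne, ← hm, ← hm, hx, hy]
  have hj := sameCycle_mul_swap_of_not hxy
  have htouch' : ∀ z, m z = e₁ ∨ m z = e₂ ↔ (σ * swap x y).SameCycle z x := by
    intro z
    rw [htouch, touched_mul_swap' hne]
    exact ⟨fun h => h.elim id fun h => h.trans hj.symm, Or.inl⟩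
  have hm0 : ∀ z, joinMark m e₀ e₁ e₂ z = e₀ ↔ (m z = e₁ ∨ m z = e₂) := by
    intro z
    have := hout z
    unfold joinMark
    split_ifs <;> simp_all
  refine ⟨⟨x, y, hne, rfl⟩, by simpa using htouch, ?_, ?_, ?_, ?_⟩
  · intro z hz
    simp only [Finset.mem_insert, Finset.mem_singleton] at hz
    exact if_neg hz
  · intro z hz
    simp only [Finset.mem_insert, Finset.mem_singleton] at hz
    simp [joinMark, hz]
  · intro z w
    by_cases hz : m z = e₁ ∨ m z = e₂
    · rw [(hm0 z).2 hz, eq_comm, hm0, htouch']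
      have := (htouch' z).1 hz
      exact ⟨fun h => this.trans h.symm, fun h => h.symm.trans this⟩
    · have hz' : ¬ Touched σ (σ * swap x y) z := fun h => hz ((htouch z).2 h)
      rw [joinMark, if_neg hz, ← sameCycle_iff_of_not_touched hz', ← hm, joinMark]
      split_ifs with hw
      · have := hout z
        constructor
        · intro h; exact absurd h this
        · intro h; rw [h] at hz; exact absurd hw hz
      · rfl
  · intro e he
    rw [Finset.mem_singleton] at he
    subst he
    rw [Nat.card_congr (Equiv.subtypeEquivRight hm0), ← hw, ← hc1, ← hc2, ← Nat.card_sum]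
    refine Nat.card_congr (subtypeOrEquiv _ _ ?_)
    rw [Pi.disjoint_iff]
    intro z
    rw [Prop.disjoint_iff]
    exact fun h => h12 (h.1.symm.trans h.2)

/-- Two cycles can be joined by a transposition in as many ways as there are pairs of elements of
the two cycles. -/
theorem card_isStep_join {e₀ e₁ e₂ : Y} (h12 : e₁ ≠ e₂)
    (hm : ∀ x y, m x = m y ↔ σ.SameCycle x y) (hout : ∀ x, m x ≠ e₀)
    (hc1 : Nat.card {x // m x = e₁} = wt e₁) (hc2 : Nat.card {x // m x = e₂} = wt e₂)
    (hw : wt e₁ + wt e₂ = wt e₀) :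
    Nat.card {p : Perm X × (X → Y) // IsStep {e₁, e₂} {e₀} wt σ m p.1 p.2}
      = wt e₁ * wt e₂ := by
  rw [← hc1, ← hc2, ← Nat.card_prod]
  symm
  refine Nat.card_eq_of_bijective
    (fun x : {x // m x = e₁} × {x // m x = e₂} =>
      ⟨(σ * swap x.1.1 x.2.1, joinMark m e₀ e₁ e₂),
        isStep_join h12 hm hout hc1 hc2 hw x.1.2 x.2.2⟩) ⟨?_, ?_⟩
  · rintro ⟨⟨x, hx⟩, ⟨y, hy⟩⟩ ⟨⟨x', hx'⟩, ⟨y', hy'⟩⟩ h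
    have h := Prod.ext_iff.1 (congrArg Subtype.val h)
    dsimp only at h
    have hsw : swap x y = swap x' y' := mul_left_cancel h.1
    have hxy : x ≠ y := fun e => h12 (by rw [← hx, ← hy, e])
    have hxy' : x ≠ y' := fun e => h12 (by rw [← hx, ← hy', e])
    have hxx : x = x' := by
      by_contra hxx
      have : swap x' y' x = x := swap_apply_of_ne_of_ne hxx hxy'
      rw [← hsw, swap_apply_left] at this
      exact hxy this.symm
    subst hxx
    have hyy : y = y' := by
      have := congrArg (fun s => s x) hsw
      simpa using this
    subst hyy
    rfl
  · rintro ⟨⟨σ', m'⟩, ⟨x, y, hne, hσ⟩, htouch, hkeep, hO, hfib, hsize⟩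
    simp only at hσ htouch hkeep hO hfib hsize
    subst hσ
    simp only [Finset.mem_singleton, Finset.mem_insert] at htouch hkeep hO hsize
    have hm' : joinMark m e₀ e₁ e₂ = m' := by
      funext z
      unfold joinMark
      split_ifs with hz
      · exact (hO z hz).symm
      · exact (hkeep z hz).symm
    have hxe := (htouch x).2 ((touched_mul_swap hne).2 (Or.inl (SameCycle.refl _ _)))
    have hye := (htouch y).2 ((touched_mul_swap hne).2 (Or.inr (SameCycle.refl _ _)))
    have hdiff : m x ≠ m y := by
      rw [Ne, hm]
      intro h
      have := not_sameCycle_mul_swap hne h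
      rw [← hfib, hO x hxe, hO y hye] at this
      exact this rfl
    rcases hxe with hx | hx <;> rcases hye with hy | hy
    · exact absurd (hx.trans hy.symm) hdiff
    · exact ⟨⟨⟨x, hx⟩, ⟨y, hy⟩⟩, Subtype.ext (Prod.ext rfl hm')⟩
    · exact ⟨⟨⟨y, hy⟩, ⟨x, hx⟩⟩, Subtype.ext (Prod.ext (by simp only [swap_comm]) hm')⟩
    · exact absurd (hx.trans hy.symm) hdiff

/-- The number of continuations across a trivalent vertex is the product of the weights of the
incoming strands. -/
theorem card_isStep (hcard : In.card + Out.card = 3) (hIn : ∀ e ∈ In, 0 < wt e)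
    (hOut : ∀ e ∈ Out, 0 < wt e) (hsum : ∑ e ∈ In, wt e = ∑ e ∈ Out, wt e)
    (hm : ∀ x y, m x = m y ↔ σ.SameCycle x y)
    (hsize : ∀ e ∈ In, Nat.card {x // m x = e} = wt e) (hdis : ∀ x, m x ∉ Out) :
    Nat.card {p : Perm X × (X → Y) // IsStep In Out wt σ m p.1 p.2} = ∏ e ∈ In, wt e := by
  have h0 : In.card ≠ 0 := by
    intro h
    have hO : Out.Nonempty := Finset.card_pos.1 (by omega)
    rw [Finset.card_eq_zero.1 h, Finset.sum_empty] at hsum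
    have := Finset.sum_pos hOut hO
    omega
  have h0' : Out.card ≠ 0 := by
    intro h
    have hI : In.Nonempty := Finset.card_pos.1 (by omega)
    rw [Finset.card_eq_zero.1 h, Finset.sum_empty] at hsum
    have := Finset.sum_pos hIn hI
    omega
  rcases (by omega : (In.card = 1 ∧ Out.card = 2) ∨ (In.card = 2 ∧ Out.card = 1))
    with ⟨h1, h2⟩ | ⟨h1, h2⟩
  · obtain ⟨e₀, rfl⟩ := Finset.card_eq_one.1 h1
    obtain ⟨e₁, e₂, h12, rfl⟩ := Finset.card_eq_two.1 h2
    rw [Finset.sum_singleton, Finset.sum_pair h12] at hsum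
    rw [Finset.prod_singleton, hsum]
    refine card_isStep_split h12 hm ?_ (hOut _ (by simp)) (hOut _ (by simp)) ?_
    · intro x
      have := hdis x
      simpa [not_or] using this
    · rw [hsize e₀ (by simp), hsum]
  · obtain ⟨e₀, rfl⟩ := Finset.card_eq_one.1 h2
    obtain ⟨e₁, e₂, h12, rfl⟩ := Finset.card_eq_two.1 h1
    rw [Finset.sum_singleton, Finset.sum_pair h12] at hsum
    rw [Finset.prod_pair h12]
    exact card_isStep_join h12 hm (by simpa using hdis) (hsize _ (by simp)) (hsize _ (by simp)) hsum

end Step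

/-! ### The Riemann-Hurwitz formula for permutations -/

section RiemannHurwitz

/-- A surjection that identifies exactly one pair of elements lowers the cardinality by one. -/
theorem card_eq_card_add_one {A B : Type} [Finite A] {f : A → B} (hf : Function.Surjective f)
    {a b : A} (hab : a ≠ b) (hfab : f a = f b)
    (h : ∀ u v, f u = f v → u = v ∨ (u = a ∧ v = b) ∨ (u = b ∧ v = a)) :
    Nat.card A = Nat.card B + 1 := by
  have h1 : Nat.card {u // u ≠ a} = Nat.card B := by
    refine Nat.card_eq_of_bijective (fun u => f u.1) ⟨?_, ?_⟩
    · rintro ⟨u, hu⟩ ⟨v, hv⟩ huv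
      rcases h u v huv with h | h | h
      · exact Subtype.ext h
      · exact absurd h.1 hu
      · exact absurd h.2 hv
    · intro y
      obtain ⟨u, rfl⟩ := hf y
      by_cases hu : u = a
      · exact ⟨⟨b, hab.symm⟩, by rw [hu, hfab]⟩
      · exact ⟨⟨u, hu⟩, rfl⟩
  have := Fintype.ofFinite A
  rw [← h1, Nat.card_eq_fintype_card, Nat.card_eq_fintype_card, Fintype.card_subtype_compl,
    Fintype.card_subtype_eq]
  have : 0 < Fintype.card A := Fintype.card_pos_iff.2 ⟨a⟩
  omega

variable {X : Type}

/-- The number of cycles of a permutation; fixed points are counted. -/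
def cycleCount (σ : Perm X) : ℕ := Nat.card (Quotient (SameCycle.setoid σ))

theorem cycleCount_eq_card {B : Type} {σ : Perm X} {q : X → B} (hq : Function.Surjective q)
    (h : ∀ x y, q x = q y ↔ σ.SameCycle x y) : cycleCount σ = Nat.card B := by
  have : SameCycle.setoid σ = Setoid.ker q := Setoid.ext fun x y => (h x y).symm
  rw [cycleCount, this]
  exact Nat.card_congr (Setoid.quotientKerEquivOfSurjective q hq)

theorem cycleCount_mul_swap_of_not [Finite X] {σ : Perm X} {x y : X} (h : ¬ σ.SameCycle x y) :
    cycleCount σ = cycleCount (σ * swap x y) + 1 := by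
  have hne : x ≠ y := fun e => h (e ▸ SameCycle.refl _ _)
  have hj := sameCycle_mul_swap_of_not h
  have ht : ∀ z, Touched σ (σ * swap x y) z → (σ * swap x y).SameCycle x z := by
    intro z hz
    rcases (touched_mul_swap' hne).1 hz with h | h
    · exact h.symm
    · exact hj.trans h.symm
  have hle : ∀ z w, σ.SameCycle z w → (σ * swap x y).SameCycle z w := by
    intro z w hzw
    by_cases hz : Touched σ (σ * swap x y) z
    · exact (ht z hz).symm.trans (ht w ((Touched.congr hzw).1 hz))
    · exact sameCycle_of_not_touched hz hzw
  refine card_eq_card_add_one (A := Quotient (SameCycle.setoid σ))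
    (B := Quotient (SameCycle.setoid (σ * swap x y)))
    (f := Quotient.map' (s₁ := SameCycle.setoid σ)
      (s₂ := SameCycle.setoid (σ * swap x y)) id hle)
    (a := Quotient.mk _ x) (b := Quotient.mk _ y) ?_ ?_ ?_ ?_
  · rintro ⟨z⟩
    exact ⟨Quotient.mk _ z, rfl⟩
  · exact fun e => h (Quotient.exact e)
  · exact Quotient.sound hj
  · rintro ⟨z⟩ ⟨w⟩ hzw
    have hzw : (σ * swap x y).SameCycle z w := Quotient.exact hzw
    by_cases hz : Touched σ (σ * swap x y) z
    · have hw := (touched_congr_right hzw).1 hz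
      rw [touched_mul_swap hne] at hz hw
      rcases hz with hz | hz <;> rcases hw with hw | hw
      · exact Or.inl (Quotient.sound (hz.trans hw.symm))
      · exact Or.inr (Or.inl ⟨Quotient.sound hz, Quotient.sound hw⟩)
      · exact Or.inr (Or.inr ⟨Quotient.sound hz, Quotient.sound hw⟩)
      · exact Or.inl (Quotient.sound (hz.trans hw.symm))
    · exact Or.inl (Quotient.sound ((sameCycle_iff_of_not_touched hz).2 hzw))

end RiemannHurwitz

section Fintype

variable {X : Type}

theorem sign_eq_pow_cycleCount [Fintype X] (σ : Perm X) :
    sign σ = (-1) ^ (Fintype.card X + cycleCount σ) := by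
  induction σ using swap_induction_on' with
  | one =>
    have : cycleCount (1 : Perm X) = Fintype.card X := by
      rw [cycleCount_eq_card (q := id) Function.surjective_id (fun x y => by simp),
        Nat.card_eq_fintype_card]
    rw [this, Perm.sign_one, ← two_mul, pow_mul]
    simp
  | mul_swap f x y hxy ih =>
    rw [Perm.sign_mul, sign_swap hxy, ih]
    by_cases h : f.SameCycle x y
    · have h' := cycleCount_mul_swap_of_not (not_sameCycle_mul_swap hxy h)
      rw [mul_assoc, swap_mul_self, mul_one] at h'
      rw [h', ← add_assoc, pow_succ]
    · rw [cycleCount_mul_swap_of_not h, ← add_assoc, pow_succ, mul_assoc]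
      simp

/-- The functions that are invariant under a permutation are the functions on the set of its
cycles. -/
theorem finrank_ker_one_sub_funLeft [Fintype X] (σ : Perm X) :
    Module.finrank ℚ (LinearMap.ker (1 - LinearMap.funLeft ℚ ℚ σ)) = cycleCount σ := by
  have := Fintype.ofFinite (Quotient (SameCycle.setoid σ))
  set q : X → Quotient (SameCycle.setoid σ) := fun x => Quotient.mk _ x with hq
  have hinj : Function.Injective (LinearMap.funLeft ℚ ℚ q) :=
    LinearMap.funLeft_injective_of_surjective _ _ _ Quotient.mk_surjective
  have hker : LinearMap.ker (1 - LinearMap.funLeft ℚ ℚ σ)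
      = LinearMap.range (LinearMap.funLeft ℚ ℚ q) := by
    ext f
    rw [LinearMap.mem_ker, LinearMap.sub_apply, sub_eq_zero, LinearMap.mem_range]
    constructor
    · intro h
      have hf : ∀ x, f (σ x) = f x := fun x => (congrFun h x).symm
      have : ∀ x y, σ.SameCycle x y → f x = f y := by
        intro x y hxy
        exact mem_of_sameCycle (S := {y | f x = f y}) (fun z hz => by
          show f x = f (σ z)
          rw [hf]; exact hz) rfl hxy
      exact ⟨Quotient.lift f this, rfl⟩
    · rintro ⟨g, rfl⟩
      funext x
      show g (q x) = g (q (σ x))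
      congr 1
      exact Quotient.sound (sameCycle_apply_right.2 (SameCycle.refl σ x))
  rw [hker, LinearMap.finrank_range_of_inj hinj, Module.finrank_fintype_fun_eq_card,
    cycleCount, Nat.card_eq_fintype_card]

theorem finrank_span_le_one (v : X → ℚ) : Module.finrank ℚ (Submodule.span ℚ {v}) ≤ 1 := by
  simpa using finrank_span_le_card (R := ℚ) ({v} : Set (X → ℚ))

theorem funLeft_single (σ : Perm X) (x : X) :
    LinearMap.funLeft ℚ ℚ σ (Pi.single (σ x) 1) = Pi.single x 1 := by
  funext y
  rw [LinearMap.funLeft_apply]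
  by_cases h : y = x
  · rw [h, Pi.single_eq_same, Pi.single_eq_same]
  · rw [Pi.single_eq_of_ne h, Pi.single_eq_of_ne fun e => h (σ.injective e)]

/-- A subspace that contains all `v - v ∘ p k` has codimension at most one if the group generated
by the `p k` is transitive. -/
theorem card_le_finrank_add_one [Fintype X] (p : Fin 3 → Perm X)
    (htr : ∀ S : X → Prop, (∀ k z, S z → S (p k z)) → ∀ x, S x → ∀ y, S y) [Nonempty X]
    (U : Submodule ℚ (X → ℚ)) (hk : ∀ k v, v - LinearMap.funLeft ℚ ℚ (p k) v ∈ U) :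
    Fintype.card X ≤ Module.finrank ℚ U + 1 := by
  obtain ⟨x₀⟩ := ‹Nonempty X›
  obtain ⟨L, hL⟩ : ∃ L : Submodule ℚ (X → ℚ), L = Submodule.span ℚ {Pi.single x₀ (1 : ℚ)} :=
    ⟨_, rfl⟩
  have hx₀ : (Pi.single x₀ 1 : X → ℚ) ∈ U ⊔ L := by
    rw [hL]
    exact Submodule.mem_sup_right (Submodule.mem_span_singleton_self (R := ℚ) _)
  have hall : ∀ y, (Pi.single y 1 : X → ℚ) ∈ U ⊔ L := by
    intro y
    refine htr (fun y => (Pi.single y 1 : X → ℚ) ∈ U ⊔ L) ?_ x₀ hx₀ y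
    intro k z hz
    have h := hk k (Pi.single (p k z) 1)
    rw [funLeft_single] at h
    have := Submodule.add_mem _ (Submodule.mem_sup_left h) hz
    rwa [sub_add_cancel] at this
  have htop : U ⊔ L = ⊤ := by
    rw [eq_top_iff]
    rintro f -
    rw [pi_eq_sum_univ' f]
    refine Submodule.sum_mem _ fun i _ => Submodule.smul_mem _ _ ?_
    exact hall i
  have := Submodule.finrank_add_le_finrank_add_finrank U L
  rw [htop, finrank_top, Module.finrank_fintype_fun_eq_card] at this
  exact this.trans (Nat.add_le_add_left (hL ▸ finrank_span_le_one _) _)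

/-- Scott's inequality for a transitive triple of permutations with product one. The vector space
`ℚ^X` is mapped by `v ↦ ((1 - M 2) v, (1 - M 1) v, (1 - M 0) v)` into the kernel of `(v₂, v₁, v₀) ↦
v₂ + M 2 v₁ + M 2 (M 1 v₀)`, where `M k` is composition with `p k`; the kernel of the first map
consists of the invariant vectors, and the image of the second has codimension at most one. -/
theorem cycleCount_le [Fintype X] (p : Fin 3 → Perm X) (hp : p 0 * p 1 * p 2 = 1)
    (htr : ∀ S : X → Prop, (∀ k z, S z → S (p k z)) → ∀ x, S x → ∀ y, S y) [Nonempty X] :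
    ∑ k, cycleCount (p k) ≤ Fintype.card X + 2 := by
  obtain ⟨M, hM⟩ : ∃ M : Fin 3 → ((X → ℚ) →ₗ[ℚ] (X → ℚ)), ∀ k, M k = LinearMap.funLeft ℚ ℚ (p k) :=
    ⟨_, fun _ => rfl⟩
  have hMMM : ∀ v, M 2 (M 1 (M 0 v)) = v := by
    intro v
    simp only [hM]
    funext x
    show v (p 0 (p 1 (p 2 x))) = v x
    rw [← Perm.mul_apply, ← Perm.mul_apply, hp, Perm.one_apply]
  let W : Fin 3 → Submodule ℚ (X → ℚ) := fun k => LinearMap.range (1 - M k)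
  let β : (X → ℚ) →ₗ[ℚ] (W 2 × W 1 × W 0) :=
    (LinearMap.rangeRestrict (1 - M 2)).prod
      ((LinearMap.rangeRestrict (1 - M 1)).prod (LinearMap.rangeRestrict (1 - M 0)))
  let δ : (W 2 × W 1 × W 0) →ₗ[ℚ] (X → ℚ) :=
    (W 2).subtype.coprod ((M 2 ∘ₗ (W 1).subtype).coprod (M 2 ∘ₗ M 1 ∘ₗ (W 0).subtype))
  have hδ : ∀ w, δ w = (w.1 : X → ℚ) + (M 2 w.2.1 + M 2 (M 1 w.2.2)) := fun w => rfl
  have hβδ : LinearMap.range β ≤ LinearMap.ker δ := by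
    rintro _ ⟨v, rfl⟩
    rw [LinearMap.mem_ker, hδ]
    show (v - M 2 v) + (M 2 (v - M 1 v) + M 2 (M 1 (v - M 0 v))) = 0
    simp only [map_sub, hMMM]
    abel
  have hkerβ : Module.finrank ℚ (LinearMap.ker β) ≤ 1 := by
    have : LinearMap.ker β ≤ Submodule.span ℚ {fun _ => (1 : ℚ)} := by
      intro f hf
      rw [LinearMap.mem_ker, Prod.ext_iff, Prod.ext_iff] at hf
      have hinv : ∀ k x, f (p k x) = f x := by
        intro k x
        have h2 : f - M 2 f = 0 := congrArg Subtype.val hf.1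
        have h1 : f - M 1 f = 0 := congrArg Subtype.val hf.2.1
        have h0 : f - M 0 f = 0 := congrArg Subtype.val hf.2.2
        have hk : ∀ k, M k f = f := by
          rw [Fin.forall_fin_succ, Fin.forall_fin_succ, Fin.forall_fin_succ]
          exact ⟨(sub_eq_zero.1 h0).symm, (sub_eq_zero.1 h1).symm, (sub_eq_zero.1 h2).symm,
            fun i => i.elim0⟩
        have := congrFun (hk k) x
        rwa [hM] at this
      obtain ⟨x₀⟩ := ‹Nonempty X›
      rw [Submodule.mem_span_singleton]
      refine ⟨f x₀, funext fun y => ?_⟩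
      have := htr (fun y => f y = f x₀) (fun k z hz => (hinv k z).trans hz) x₀ rfl y
      simpa using this.symm
    exact (Submodule.finrank_mono this).trans (finrank_span_le_one _)
  have hrangeδ : Fintype.card X ≤ Module.finrank ℚ (LinearMap.range δ) + 1 := by
    obtain ⟨U, hU⟩ : ∃ U, U = LinearMap.range δ := ⟨_, rfl⟩
    rw [← hU]
    have h2 : ∀ v, v - M 2 v ∈ U := fun v => hU ▸ ⟨(⟨_, v, rfl⟩, 0, 0), by rw [hδ]; simp⟩
    have h1 : ∀ v, v - M 1 v ∈ U := by
      intro v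
      have h3 : M 2 (v - M 1 v) ∈ U := hU ▸ ⟨(0, ⟨_, v, rfl⟩, 0), by rw [hδ]; simp⟩
      simpa using U.add_mem (h2 (v - M 1 v)) h3
    have h0 : ∀ v, v - M 0 v ∈ U := by
      intro v
      have h3 : M 2 (M 1 (v - M 0 v)) ∈ U := hU ▸ ⟨(0, 0, ⟨_, v, rfl⟩), by rw [hδ]; simp⟩
      have h4 := U.add_mem (h2 (M 1 (v - M 0 v))) h3
      rw [sub_add_cancel] at h4
      simpa using U.add_mem (h1 (v - M 0 v)) h4
    have hk : ∀ k v, v - M k v ∈ U := by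
      rw [Fin.forall_fin_succ, Fin.forall_fin_succ, Fin.forall_fin_succ]
      exact ⟨h0, h1, h2, fun i => i.elim0⟩
    exact card_le_finrank_add_one p htr U fun k v => by rw [← hM]; exact hk k v
  have e1 := LinearMap.finrank_range_add_finrank_ker β
  have e2 := LinearMap.finrank_range_add_finrank_ker δ
  have e3 := Submodule.finrank_mono hβδ
  -- the dimension of the image of `1 - M k` is the number of points minus the number of cycles
  have e4 : ∀ k, Module.finrank ℚ (W k) + cycleCount (p k) = Fintype.card X := by
    intro k
    have := LinearMap.finrank_range_add_finrank_ker (1 - M k)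
    rwa [hM, finrank_ker_one_sub_funLeft, ← hM, Module.finrank_fintype_fun_eq_card] at this
  rw [Module.finrank_fintype_fun_eq_card] at e1
  rw [Module.finrank_prod, Module.finrank_prod] at e2
  have e5 := e4 0
  have e6 := e4 1
  have e7 := e4 2
  rw [Fin.sum_univ_three]
  omega

/-- The Riemann-Hurwitz formula for a transitive triple of permutations with product one: the genus
it determines is a natural number. -/
theorem exists_genus [Fintype X] (p : Fin 3 → Perm X) (hp : p 0 * p 1 * p 2 = 1)
    (htr : ∀ S : X → Prop, (∀ k z, S z → S (p k z)) → ∀ x, S x → ∀ y, S y) [Nonempty X] :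
    ∃ g, ∑ k, cycleCount (p k) + 2 * g = Fintype.card X + 2 := by
  have hle := cycleCount_le p hp htr
  have hs : sign (p 0) * sign (p 1) * sign (p 2) = 1 := by
    rw [← Perm.sign_mul, ← Perm.sign_mul, hp, Perm.sign_one]
  rw [sign_eq_pow_cycleCount, sign_eq_pow_cycleCount, sign_eq_pow_cycleCount, ← pow_add, ← pow_add]
    at hs
  -- comparing signs shows that the genus is not a half-integer
  have hev : Even (Fintype.card X + cycleCount (p 0) + (Fintype.card X + cycleCount (p 1))
      + (Fintype.card X + cycleCount (p 2))) := by
    by_contra h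
    rw [Nat.not_even_iff_odd] at h
    rw [h.neg_one_pow] at hs
    exact absurd hs (by decide)
  rw [Fin.sum_univ_three] at hle ⊢
  obtain ⟨c, hc⟩ := hev
  exact ⟨(Fintype.card X + 2 - (cycleCount (p 0) + cycleCount (p 1) + cycleCount (p 2))) / 2,
    by omega⟩

end Fintype

/-! ### The lattice index of a trivalent type -/

section LatticeIndex

/-- The index of the lattice of integral vectors whose coordinates are divisible by given
integers. -/
theorem index_range_mul {E : Type} [Fintype E] (w : E → ℕ) :
    (AddMonoidHom.range (AddMonoidHom.mk' (fun x : E → ℤ => fun e => (w e : ℤ) * x e)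
      (fun x y => by funext e; simp [mul_add]))).index = ∏ e, w e := by
  have h : AddMonoidHom.range (AddMonoidHom.mk' (fun x : E → ℤ => fun e => (w e : ℤ) * x e)
      (fun x y => by funext e; simp [mul_add]))
      = AddSubgroup.pi Set.univ (fun e => AddSubgroup.zmultiples (w e : ℤ)) := by
    ext x
    simp only [AddMonoidHom.mem_range, AddMonoidHom.mk'_apply, AddSubgroup.mem_pi, Set.mem_univ,
      true_imp_iff, Int.mem_zmultiples_iff]
    constructor
    · rintro ⟨y, rfl⟩ e
      exact dvd_mul_right _ _
    · intro h
      choose y hy using h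
      exact ⟨y, funext fun e => (hy e).symm⟩
  rw [h, AddSubgroup.index_pi]
  simp [Int.index_zmultiples]

variable {g r : ℕ} {n : Fin 3 → ℕ} {Δ : ∀ k, Fin (n k) → ℕ} (α : CoverType g r Δ)

theorem boundary_apply (z : α.E → ℤ) (v : Option α.V) :
    α.boundary z v = ∑ e, z e * ((if α.mergedVertex (α.tgt e) = v then 1 else 0)
      - (if α.mergedVertex (α.src e) = v then 1 else 0)) := by
  simp [CoverType.boundary, Pi.single_apply, eq_comm]

/-- Summation by parts on the graph `Γ'`. -/
theorem sum_boundary {R : Type} [CommRing R] (z : α.E → ℤ) (y : Option α.V → R) :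
    ∑ v, (α.boundary z v : R) * y v
      = ∑ e, (z e : R) * (y (α.mergedVertex (α.tgt e)) - y (α.mergedVertex (α.src e))) := by
  simp only [boundary_apply, Int.cast_sum, Int.cast_mul, Int.cast_sub, Finset.sum_mul]
  rw [Finset.sum_comm]
  refine Finset.sum_congr rfl fun e _ => ?_
  simp only [mul_assoc, ← Finset.mul_sum, sub_mul, Finset.sum_sub_distrib, Int.cast_ite,
    Int.cast_one, Int.cast_zero, ite_mul, one_mul, zero_mul, Finset.sum_ite_eq, Finset.mem_univ,
    if_true]

theorem mem_cycles_iff (z : α.E → ℤ) : z ∈ α.cycles ↔ α.boundary z = 0 := Iff.rfl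

/-- The difference of two vertices is the boundary of a `1`-chain. -/
theorem exists_path (v : α.V) (w : α.V) : ∃ z : α.E → ℤ,
    α.boundary z = Pi.single (α.mergedVertex w) 1 - Pi.single (α.mergedVertex v) 1 := by
  have h := α.connected v w
  unfold CoverGraph.Joined at h
  induction h with
  | rel a b h =>
    obtain ⟨e, -, rfl, rfl⟩ := h
    refine ⟨Pi.single e 1, ?_⟩
    simp only [CoverType.boundary, LinearMap.sum_apply, LinearMap.smulRight_apply,
      LinearMap.proj_apply]
    rw [Finset.sum_eq_single e]
    · simp
    · intro b _ hb
      rw [Pi.single_eq_of_ne hb, zero_smul]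
    · simp
  | refl a => exact ⟨0, by simp⟩
  | symm a b _ ih =>
    obtain ⟨z, hz⟩ := ih
    exact ⟨-z, by rw [map_neg, hz, neg_sub]⟩
  | trans a b c _ _ ih1 ih2 =>
    obtain ⟨z, hz⟩ := ih1
    obtain ⟨z', hz'⟩ := ih2
    exact ⟨z + z', by rw [map_add, hz, hz']; abel⟩

/-- The pairing of edge vectors with the cycles of `Γ'`. -/
def pairing : (α.E → ℤ) →+ Module.Dual ℤ α.cycles where
  toFun x :=
    { toFun := fun z => ∑ e, z.1 e * x e
      map_add' := by intro a b; simp [add_mul, Finset.sum_add_distrib]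
      map_smul' := by intro a b; simp [Finset.mul_sum, mul_assoc] }
  map_zero' := by ext z; simp
  map_add' x y := by ext z; simp [mul_add, Finset.sum_add_distrib]

theorem pairing_apply (x : α.E → ℤ) (z : α.cycles) : pairing α x z = ∑ e, z.1 e * x e := rfl

theorem equations_apply (ℓ : α.E → ℤ) (z : α.cycles) :
    α.equations ℓ z = ∑ e, z.1 e * ((α.weight e : ℤ) * ℓ e) := by
  simp only [CoverType.equations, LinearMap.sum_apply, LinearMap.smulRight_apply,
    LinearMap.proj_apply, LinearMap.smul_apply, LinearMap.comp_apply, Submodule.subtype_apply,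
    smul_eq_mul]
  exact Finset.sum_congr rfl fun e _ => by ring

/-- The lattice of cycles is a direct summand of `ℤ^E`, since the quotient embeds into a free
module; so every functional on it extends. -/
theorem pairing_surjective : Function.Surjective (pairing α) := by
  have hfree : Module.Free ℤ ((α.E → ℤ) ⧸ α.cycles) := by
    have : Module.Free ℤ (LinearMap.range α.boundary) := inferInstance
    exact Module.Free.of_equiv α.boundary.quotKerEquivRange.symm
  -- a section of the quotient by the cycles gives a projection onto them
  obtain ⟨s, hs⟩ := Module.projective_lifting_property α.cycles.mkQ LinearMap.id
    α.cycles.mkQ_surjective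
  have hmem : ∀ x, x - s (α.cycles.mkQ x) ∈ α.cycles := by
    intro x
    have h : x - s (α.cycles.mkQ x) ∈ LinearMap.ker α.cycles.mkQ := by
      rw [LinearMap.mem_ker, map_sub, sub_eq_zero]
      exact (LinearMap.congr_fun hs (α.cycles.mkQ x)).symm
    rwa [Submodule.ker_mkQ] at h
  let pr : (α.E → ℤ) →ₗ[ℤ] α.cycles :=
    LinearMap.codRestrict α.cycles (LinearMap.id - s ∘ₗ α.cycles.mkQ) hmem
  have hpr : ∀ z : α.cycles, pr z.1 = z := by
    intro z
    apply Subtype.ext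
    show z.1 - s (α.cycles.mkQ z.1) = z.1
    have : α.cycles.mkQ z.1 = 0 := by
      rw [← LinearMap.mem_ker, Submodule.ker_mkQ]
      exact z.2
    rw [this, map_zero, sub_zero]
  intro f
  refine ⟨fun e => f (pr (Pi.single e 1)), ?_⟩
  ext z
  rw [pairing_apply]
  conv_rhs => rw [← hpr z, ← LinearMap.comp_apply, LinearMap.pi_apply_eq_sum_univ (f ∘ₗ pr) z.1]
  refine Finset.sum_congr rfl fun e _ => ?_
  rw [smul_eq_mul, LinearMap.comp_apply]
  congr 3
  funext j
  rw [Pi.single_apply]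
  exact if_congr eq_comm rfl rfl

/-- The coboundary of a height function on the vertices. -/
def coboundary (y : α.V → ℤ) : α.E → ℤ := fun e => y (α.tgt e) - y (α.src e)

theorem pairing_coboundary {y : α.V → ℤ} (hy : ∀ v, α.cell v = none → y v = 0) :
    pairing α (coboundary α y) = 0 := by
  ext z
  rw [pairing_apply, LinearMap.zero_apply]
  have h := sum_boundary α z.1 (fun v => v.elim 0 y)
  rw [(mem_cycles_iff α z.1).1 z.2] at h
  simp only [Pi.zero_apply, Int.cast_zero, zero_mul, Finset.sum_const_zero] at h
  rw [h]
  refine Finset.sum_congr rfl fun e _ => ?_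
  have hm : ∀ v, (α.mergedVertex v).elim 0 y = y v := by
    intro v
    unfold CoverType.mergedVertex
    split_ifs with hv
    · exact (hy v hv).symm
    · rfl
  simp only [hm, coboundary, Int.cast_id]

/-- Edge vectors that vanish on all cycles are coboundaries, because `Γ'` is connected. -/
theorem exists_coboundary {x : α.E → ℤ} (hx : pairing α x = 0) :
    ∃ y : α.V → ℤ, (∀ v, α.cell v = none → y v = 0) ∧ coboundary α y = x := by
  obtain ⟨v₁⟩ := α.nonempty
  -- a base point over the center, if there is one
  obtain ⟨v₀, hv₀⟩ : ∃ v₀, ∀ v, α.cell v = none → α.cell v₀ = none := by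
    by_cases h : ∃ v, α.cell v = none
    · exact ⟨h.choose, fun _ _ => h.choose_spec⟩
    · exact ⟨v₁, fun v hv => absurd ⟨v, hv⟩ h⟩
  choose p hp using exists_path α v₀
  have hzero : ∀ z : α.E → ℤ, α.boundary z = 0 → ∑ e, z e * x e = 0 := by
    intro z hz
    have := LinearMap.congr_fun hx ⟨z, hz⟩
    rwa [pairing_apply] at this
  refine ⟨fun v => ∑ e, p v e * x e, ?_, ?_⟩
  · intro v hv
    refine hzero _ ?_
    rw [hp]
    simp [CoverType.mergedVertex, hv, hv₀ v hv]
  · funext e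
    -- the paths to the two ends of `e` and the edge `e` form a cycle
    have := hzero (p (α.tgt e) - p (α.src e) - Pi.single e 1) ?_
    · simp only [Pi.sub_apply, sub_mul, Finset.sum_sub_distrib] at this
      have h1 : ∑ e', (Pi.single e 1 : α.E → ℤ) e' * x e' = x e := by
        rw [Finset.sum_eq_single e]
        · simp
        · intro b _ hb
          rw [Pi.single_eq_of_ne hb, zero_mul]
        · simp
      rw [h1] at this
      unfold coboundary
      linarith
    · rw [map_sub, map_sub, hp, hp]
      have : α.boundary (Pi.single e 1) = Pi.single (α.mergedVertex (α.tgt e)) 1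
          - Pi.single (α.mergedVertex (α.src e)) 1 := by
        simp only [CoverType.boundary, LinearMap.sum_apply, LinearMap.smulRight_apply,
          LinearMap.proj_apply]
        rw [Finset.sum_eq_single e]
        · simp
        · intro b _ hb
          rw [Pi.single_eq_of_ne hb, zero_smul]
        · simp
      rw [this]
      abel

variable {α}

/-- The height function with given values at the labelled vertices and zero elsewhere. The sum has
at most one term if the labels are injective. -/
def extendHeight (α : CoverType g r Δ) (p : Fin r → ℤ) : α.V → ℤ :=
  fun v => ∑ i, if α.label i = v then p i else 0

theorem extendHeight_label (hinj : Function.Injective α.label) (p : Fin r → ℤ) (i : Fin r) :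
    extendHeight α p (α.label i) = p i := by
  unfold extendHeight
  rw [Finset.sum_eq_single i]
  · simp
  · intro j _ hj
    rw [if_neg fun h => hj (hinj h)]
  · simp

/-- If the labels are in bijection with the vertices outside the center, then the product of the
index `I_α` and of the multiplicity of the branch map is the product of the weights of the bounded
edges: both are indices in the chain `ℤ^E ⊇ K + wℤ^E ⊇ wℤ^E`, where `K` is the lattice of
coboundaries, the kernel of the surjection from `ℤ^E` to the dual of the lattice of cycles. -/
theorem latticeIndex_mul_branchMult (hinj : Function.Injective α.label)
    (hlab : ∀ i, α.cell (α.label i) ≠ none)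
    (hsurj : ∀ v, α.cell v ≠ none → ∃ i, α.label i = v) :
    α.latticeIndex * α.branchMult = ∏ e, α.weight e := by
  rw [← index_range_mul]
  set D : AddSubgroup (α.E → ℤ) := AddMonoidHom.range (AddMonoidHom.mk'
    (fun x : α.E → ℤ => fun e => (α.weight e : ℤ) * x e)
      (fun x y => by funext e; simp [mul_add])) with hD
  have hmemD : ∀ x, x ∈ D ↔ ∃ ℓ : α.E → ℤ, ∀ e, x e = (α.weight e : ℤ) * ℓ e := by
    intro x
    constructor
    · rintro ⟨ℓ, rfl⟩
      exact ⟨ℓ, fun e => rfl⟩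
    · rintro ⟨ℓ, h⟩
      exact ⟨ℓ, funext fun e => (h e).symm⟩
  let c : (Fin r → ℤ) →+ (α.E → ℤ) := AddMonoidHom.mk'
    (fun p => coboundary α (extendHeight α p)) (by
      intro p q
      funext e
      have h : ∀ v, extendHeight α (p + q) v = extendHeight α p v + extendHeight α q v := by
        intro v
        unfold extendHeight
        rw [← Finset.sum_add_distrib]
        refine Finset.sum_congr rfl fun i _ => ?_
        split_ifs <;> simp
      show _ = coboundary α _ e + coboundary α _ e
      simp only [coboundary, h]
      ring)
  have hc : ∀ p, c p = coboundary α (extendHeight α p) := fun p => rfl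
  have hext0 : ∀ p v, α.cell v = none → extendHeight α p v = 0 := by
    intro p v hv
    unfold extendHeight
    exact Finset.sum_eq_zero fun i _ => if_neg fun h => hlab i (by rw [h]; exact hv)
  have hexteq : ∀ y : α.V → ℤ, (∀ v, α.cell v = none → y v = 0) →
      extendHeight α (fun i => y (α.label i)) = y := by
    intro y hy
    funext v
    by_cases hv : α.cell v = none
    · rw [hext0 _ v hv, hy v hv]
    · obtain ⟨i, rfl⟩ := hsurj v hv
      rw [extendHeight_label hinj]
  have hrange : c.range = (pairing α).ker := by
    ext x
    rw [AddMonoidHom.mem_ker]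
    constructor
    · rintro ⟨p, rfl⟩
      exact pairing_coboundary α (hext0 p)
    · intro hx
      obtain ⟨y, hy, rfl⟩ := exists_coboundary α hx
      exact ⟨fun i => y (α.label i), by rw [hc, hexteq y hy]⟩
  -- a vector of integral heights is in the branch lattice if its lengths are integral
  have hbranch : α.branchLattice = D.comap c := by
    ext p
    rw [AddSubgroup.mem_comap, hmemD]
    constructor
    · rintro ⟨ℓ, -, y, h1, h2, h3⟩
      refine ⟨ℓ, fun e => ?_⟩
      have : p = fun i => y (α.label i) := funext h3
      rw [hc, this, hexteq y h1, coboundary, h2 e]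
      ring
    · rintro ⟨ℓ, hℓ⟩
      refine ⟨ℓ, ?_, extendHeight α p, hext0 p, ?_, fun i => (extendHeight_label hinj p i).symm⟩
      · rw [LinearMap.mem_ker]
        ext z
        rw [equations_apply, LinearMap.zero_apply]
        have := LinearMap.congr_fun (pairing_coboundary α (hext0 p)) z
        rw [pairing_apply, LinearMap.zero_apply] at this
        rw [← this]
        exact Finset.sum_congr rfl fun e _ => by rw [← hℓ e, hc]
      · intro e
        have := hℓ e
        rw [hc, coboundary] at this
        linarith
  -- the equations are the multiplication by the weights, followed by the pairing
  have hlattice : (LinearMap.range α.equations).toAddSubgroup = D.map (pairing α) := by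
    ext f
    rw [AddSubgroup.mem_map]
    constructor
    · rintro ⟨ℓ, rfl⟩
      refine ⟨fun e => (α.weight e : ℤ) * ℓ e, (hmemD _).2 ⟨ℓ, fun e => rfl⟩, ?_⟩
      ext z
      rw [equations_apply, pairing_apply]
    · rintro ⟨x, hx, rfl⟩
      obtain ⟨ℓ, hℓ⟩ := (hmemD x).1 hx
      refine ⟨ℓ, ?_⟩
      ext z
      rw [equations_apply, pairing_apply]
      exact Finset.sum_congr rfl fun e _ => by rw [hℓ e]
  rw [CoverType.latticeIndex, CoverType.branchMult, hlattice, hbranch, AddSubgroup.index_map,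
    AddSubgroup.index_comap, AddMonoidHom.range_eq_top.2 (pairing_surjective α),
    AddSubgroup.index_top, mul_one, hrange, mul_comm]
  rw [← AddSubgroup.relIndex_sup_right, sup_comm, AddSubgroup.relIndex_mul_index le_sup_left]

end LatticeIndex

/-! ### Counting chains -/

/-- If every element with the invariant `I j` has `c j` continuations in the `j`-th step, and these
have the invariant `I (j + 1)`, then the number of chains is the number of starting points times the
product of the `c j`. -/
theorem card_chains {S : Type} [Finite S] (A : S → Prop) (I : ℕ → S → Prop)
    (hA : ∀ a, A a → I 0 a) : ∀ (r : ℕ) (R : Fin r → S → S → Prop) (c : Fin r → ℕ),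
    (∀ (j : Fin r) a b, I j a → R j a b → I (j + 1) b) →
    (∀ (j : Fin r) a, I j a → Nat.card {b // R j a b} = c j) →
    Nat.card {a : Fin (r + 1) → S // A (a 0) ∧ ∀ j : Fin r, R j (a j.castSucc) (a j.succ)}
      = Nat.card {a // A a} * ∏ j, c j := by
  intro r
  induction r with
  | zero =>
    intro R c _ _
    rw [Finset.univ_eq_empty, Finset.prod_empty, mul_one]
    refine Nat.card_congr ((Equiv.funUnique (Fin 1) S).subtypeEquiv fun a => ?_)
    exact ⟨fun h => h.1, fun h => ⟨h, fun j => j.elim0⟩⟩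
  | succ r ih =>
    intro R c hI hc
    set C := {a : Fin (r + 1) → S // A (a 0) ∧
      ∀ j : Fin r, R j.castSucc (a j.castSucc) (a j.succ)} with hC
    have hIa : ∀ a : C, ∀ j : Fin (r + 1), I j (a.1 j) := by
      intro a j
      induction j using Fin.induction with
      | zero => exact hA _ a.2.1
      | succ j ihj => exact hI j.castSucc _ _ ihj (a.2.2 j)
    let e : {a : Fin (r + 2) → S // A (a 0) ∧ ∀ j : Fin (r + 1), R j (a j.castSucc) (a j.succ)}
        ≃ Σ a : C, {b // R (Fin.last r) (a.1 (Fin.last r)) b} :=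
      { toFun := fun a => ⟨⟨fun j => a.1 j.castSucc, a.2.1, fun j => a.2.2 j.castSucc⟩,
          ⟨a.1 (Fin.last (r + 1)), a.2.2 (Fin.last r)⟩⟩
        invFun := fun a => ⟨Fin.snoc (α := fun _ => S) a.1.1 a.2.1, by
          refine ⟨?_, fun j => ?_⟩
          · have : (0 : Fin (r + 2)) = Fin.castSucc 0 := rfl
            rw [this, Fin.snoc_castSucc]
            exact a.1.2.1
          · rw [Fin.snoc_castSucc]
            induction j using Fin.lastCases with
            | last =>
              rw [Fin.succ_last, Fin.snoc_last]
              exact a.2.2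
            | cast j =>
              rw [← Fin.castSucc_succ, Fin.snoc_castSucc]
              exact a.1.2.2 j⟩
        left_inv := by
          rintro ⟨a, ha⟩
          apply Subtype.ext
          funext j
          induction j using Fin.lastCases with
          | last => simp
          | cast j => simp
        right_inv := by
          rintro ⟨⟨a, ha⟩, b, hb⟩
          refine Sigma.subtype_ext (Subtype.ext (funext fun j => ?_)) ?_
          · exact Fin.snoc_castSucc (α := fun _ => S) b a j
          · exact Fin.snoc_last (α := fun _ => S) b a }
    have hfin : Finite C := Subtype.finite
    have := Fintype.ofFinite C
    rw [Nat.card_congr e, Nat.card_sigma, Finset.sum_congr rfl fun a _ =>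
      hc (Fin.last r) _ (hIa a (Fin.last r)), Finset.sum_const, smul_eq_mul, Finset.card_univ,
      ← Nat.card_eq_fintype_card, Fin.prod_univ_castSucc, ← mul_assoc]
    congr 1
    exact ih (fun j => R j.castSucc) (fun j => c j.castSucc) (fun j => hI j.castSucc)
      (fun j => hc j.castSucc)

/-! ### Strands and fronts -/

section Strand

variable {r : ℕ} {n : Fin 3 → ℕ} (G : CoverGraph r n) (Δ : ∀ k, Fin (n k) → ℕ)

/-- The strands of a cover: its bounded edges and its ends. -/
abbrev Strand : Type := G.E ⊕ (Σ k, Fin (n k))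

variable {G}

/-- The vertex at which a strand starts. -/
def start : Strand G → G.V := Sum.elim G.src (fun i => G.ends i.1 i.2)

/-- The vertex at which a strand finishes, if it is a bounded edge. -/
def finish : Strand G → Option G.V := Sum.elim (fun e => some (G.tgt e)) (fun _ => none)

/-- The ray over which a strand lies. -/
def dir : Strand G → Option (Fin 3) := Sum.elim (fun e => G.cell (G.tgt e)) (fun i => some i.1)

/-- The weight of a strand. -/
def wt : Strand G → ℕ := Sum.elim G.weight (fun i => Δ i.1 i.2)

variable (G)

theorem outflow_eq_sum (v : G.V) (k : Fin 3) :
    G.outflow Δ v k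
      = ∑ e ∈ Finset.univ.filter (fun e : Strand G => start e = v ∧ dir e = some k), wt Δ e := by
  rw [CoverGraph.outflow, Fintype.sum_sum_type, Finset.sum_filter, Fintype.sum_sum_type]
  congr 1
  · rw [← Finset.sum_filter]
    exact (Finset.sum_subtype (p := fun e => G.src e = v ∧ G.cell (G.tgt e) = some k) _
      (fun e => Finset.mem_filter.trans ⟨fun h => h.2, fun h => ⟨Finset.mem_univ _, h⟩⟩)
      (fun e => G.weight e)).symm
  · rw [Fintype.sum_sigma, Finset.sum_eq_single k]
    · rw [← Finset.sum_filter]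
      exact (Finset.sum_subtype _ (by simp [start, dir]) (fun i => Δ k i)).symm
    · intro l _ hl
      refine Finset.sum_eq_zero fun i _ => if_neg ?_
      simp [dir, hl]
    · simp

theorem inflow_eq_sum (v : G.V) :
    G.inflow v = ∑ e ∈ Finset.univ.filter (fun e : Strand G => finish e = some v), wt Δ e := by
  rw [CoverGraph.inflow, Finset.sum_filter, Fintype.sum_sum_type]
  have h : ∑ i : (Σ k, Fin (n k)), (if finish (G := G) (Sum.inr i) = some v
      then wt Δ (G := G) (Sum.inr i) else 0) = 0 :=
    Finset.sum_eq_zero fun i _ => if_neg (by simp [finish])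
  rw [h, add_zero, ← Finset.sum_filter]
  exact (Finset.sum_subtype _ (by simp [finish]) (fun e => G.weight e)).symm

theorem val_eq_card (v : G.V) :
    G.val v = (Finset.univ.filter (fun e : Strand G => finish e = some v)).card
      + (Finset.univ.filter (fun e : Strand G => start e = v)).card := by
  rw [CoverGraph.val, Finset.card_filter, Finset.card_filter, Fintype.sum_sum_type,
    Fintype.sum_sum_type]
  have h : ∑ i : (Σ k, Fin (n k)), (if finish (G := G) (Sum.inr i) = some v then 1 else 0) = 0 :=
    Finset.sum_eq_zero fun i _ => if_neg (by simp [finish])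
  rw [h, add_zero, Fintype.sum_sigma (fun i => if start (G := G) (Sum.inr i) = v then 1 else 0)]
  have h1 : ∑ e : G.E, (if finish (G := G) (Sum.inl e) = some v then 1 else 0)
      = Fintype.card {e // G.tgt e = v} := by
    rw [Fintype.card_subtype, Finset.card_filter]
    exact Finset.sum_congr rfl fun e _ => if_congr (by simp [finish]) rfl rfl
  have h2 : ∑ e : G.E, (if start (G := G) (Sum.inl e) = v then 1 else 0)
      = Fintype.card {e // G.src e = v} := by
    rw [Fintype.card_subtype, Finset.card_filter]
    exact Finset.sum_congr rfl fun e _ => if_congr Iff.rfl rfl rfl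
  have h3 : ∀ k, ∑ i, (if start (G := G) (Sum.inr ⟨k, i⟩) = v then 1 else 0)
      = Fintype.card {i // G.ends k i = v} := by
    intro k
    rw [Fintype.card_subtype, Finset.card_filter]
    exact Finset.sum_congr rfl fun e _ => if_congr Iff.rfl rfl rfl
  rw [h1, h2, Finset.sum_congr rfl fun k _ => h3 k]
  ring

variable {G}

/-- The labelled vertices in their order of processing: `vert j` is the `j`-th of them, it lies over
the ray `κ j`, and edges between vertices outside the center respect the order. -/
structure IsOrder (vert : Fin r → G.V) (κ : Fin r → Fin 3) : Prop where
  cell_vert : ∀ j, G.cell (vert j) = some (κ j)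
  inj : Function.Injective vert
  surj : ∀ v, G.cell v ≠ none → ∃ j, vert j = v
  lt : ∀ e i j, G.src e = vert i → G.tgt e = vert j → i < j

/-- The strands over the ray `k` that are present after the first `j` labelled vertices have been
passed. -/
structure Front (vert : Fin r → G.V) (j : ℕ) (k : Fin 3) (e : Strand G) : Prop where
  dir_eq : dir e = some k
  born : ∀ i, start e = vert i → (i : ℕ) < j
  alive : ∀ i, finish e = some (vert i) → j ≤ (i : ℕ)

variable {X : Type}

/-- A triple of permutations marked by the strands of the `j`-th front: over each ray, the strands
of the front correspond to the cycles, and their weights are the lengths of the cycles. -/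
structure IsMarked (vert : Fin r → G.V) (j : ℕ) (p : Fin 3 → Perm X) (m : Fin 3 → X → Strand G) :
    Prop where
  mem : ∀ k x, Front vert j k (m k x)
  fibre : ∀ k x y, m k x = m k y ↔ (p k).SameCycle x y
  size : ∀ k e, Front vert j k e → Nat.card {x // m k x = e} = wt Δ e

variable {Δ}

/-- The number of points of `X` on a set of strands of a front is the sum of their weights. -/
theorem IsMarked.card_eq_sum [Finite X] {vert : Fin r → G.V} {j : ℕ} {p : Fin 3 → Perm X}
    {m : Fin 3 → X → Strand G} (hm : IsMarked Δ vert j p m) (k : Fin 3) (Q : Strand G → Prop)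
    [DecidablePred Q]
    (hQ : ∀ e, Q e → Front vert j k e) :
    Nat.card {x // Q (m k x)} = ∑ e ∈ Finset.univ.filter Q, wt Δ e := by
  have := Fintype.ofFinite X
  rw [Nat.card_eq_fintype_card, Fintype.card_subtype, Finset.card_eq_sum_card_fiberwise
    (t := Finset.univ.filter Q) (f := m k) (by intro x; simp)]
  refine Finset.sum_congr rfl fun e he => ?_
  rw [Finset.mem_filter] at he
  rw [← hm.size k e (hQ e he.2), Nat.card_eq_fintype_card, Fintype.card_subtype]
  congr 1
  ext x
  simp only [Finset.mem_filter, Finset.mem_univ, true_and]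
  exact ⟨fun h => h.2, fun h => ⟨h ▸ he.2, h⟩⟩

end Strand

/-! ### Chains of marked permutations -/

section Chain

variable {g r : ℕ} {n : Fin 3 → ℕ} {Δ : ∀ k, Fin (n k) → ℕ} {X : Type}

/-- A triple of permutations of `X`, one for each ray, with a marking of points by strands. -/
abbrev State (G : CoverGraph r n) (X : Type) : Type := (Fin 3 → Perm X) × (Fin 3 → X → Strand G)

/-- The bounded edges that lead to a vertex. -/
def inStrands {G : CoverGraph r n} (v : G.V) : Finset (Strand G) :=
  Finset.univ.filter fun e => finish e = some v

/-- The strands that start at a vertex. -/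
def outStrands {G : CoverGraph r n} (v : G.V) : Finset (Strand G) :=
  Finset.univ.filter fun e => start e = v

/-- The passage across the `j`-th labelled vertex: only the permutation over the ray `κ j` and its
marking change. -/
structure StepRel {G : CoverGraph r n} (Δ : ∀ k, Fin (n k) → ℕ) (vert : Fin r → G.V)
    (κ : Fin r → Fin 3) (j : Fin r) (a b : State G X) : Prop where
  marked : IsMarked Δ vert (j + 1) b.1 b.2
  perm : ∀ k, k ≠ κ j → b.1 k = a.1 k
  mark : ∀ k, k ≠ κ j → b.2 k = a.2 k
  step : IsStep (inStrands (vert j)) (outStrands (vert j)) (wt Δ) (a.1 (κ j)) (a.2 (κ j))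
    (b.1 (κ j)) (b.2 (κ j))

/-- The possible states at the front next to the center. The points of `X` are distributed over the
vertices over the center; there the permutations are transitive with product one. -/
structure IsStart {G : CoverGraph r n} (Δ : ∀ k, Fin (n k) → ℕ) (vert : Fin r → G.V)
    (a : State G X) : Prop where
  marked : IsMarked Δ vert 0 a.1 a.2
  prod : a.1 0 * a.1 1 * a.1 2 = 1
  base : ∀ k x, start (a.2 k x) = start (a.2 0 x)
  trans : ∀ S : X → Prop, (∀ k z, S z → S (a.1 k z)) →
    ∀ x y, start (a.2 0 x) = start (a.2 0 y) → S x → S y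

/-- A chain of states: the monodromy of a cover of `𝓛`, read off along the fronts. The set `X` plays
the role of the fibre. -/
structure IsChain {G : CoverGraph r n} (Δ : ∀ k, Fin (n k) → ℕ) (vert : Fin r → G.V)
    (κ : Fin r → Fin 3) (a : Fin (r + 1) → State G X) : Prop where
  first : IsStart Δ vert (a 0)
  step : ∀ j : Fin r, StepRel Δ vert κ j (a j.castSucc) (a j.succ)

section Graph

variable {G : CoverGraph r n} {vert : Fin r → G.V} {κ : Fin r → Fin 3} {a : Fin (r + 1) → State G X}

theorem IsChain.marked (ha : IsChain Δ vert κ a) (j : Fin (r + 1)) :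
    IsMarked Δ vert j (a j).1 (a j).2 := by
  induction j using Fin.cases with
  | zero => exact ha.first.marked
  | succ j => exact (ha.step j).marked

end Graph

variable {α : CoverType g r Δ} {vert : Fin r → α.V} {κ : Fin r → Fin 3}

theorem dir_of_start {e : Strand α.toCoverGraph} {k : Fin 3} (h : α.cell (start e) = some k) :
    dir e = some k := by
  rcases e with e | ⟨l, i⟩
  · obtain ⟨l, h1, h2⟩ := α.edge_cell e
    have h : α.cell (α.src e) = some k := h
    rcases h2 with h2 | h2
    · rw [h2] at h; cases h
    · rw [h2] at h
      exact h1.trans h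
  · have h : α.cell (α.ends l i) = some k := h
    rcases α.ends_cell l i with h2 | h2
    · rw [h2] at h; cases h
    · rw [h2] at h
      exact h

theorem dir_of_finish {e : Strand α.toCoverGraph} {v : α.V} (h : finish e = some v) :
    dir e = α.cell v := by
  rcases e with e | i
  · have h : some (α.tgt e) = some v := h
    rw [← Option.some.inj h]
    rfl
  · cases h

theorem exists_dir (e : Strand α.toCoverGraph) : ∃ k, dir e = some k := by
  rcases e with e | i
  · obtain ⟨k, hk, -⟩ := α.edge_cell e
    exact ⟨k, hk⟩
  · exact ⟨i.1, rfl⟩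

theorem wt_pos (hΔ : ∀ k i, 0 < Δ k i) (e : Strand α.toCoverGraph) : 0 < wt Δ e := by
  rcases e with e | i
  · exact α.weight_pos e
  · exact hΔ _ _

theorem finish_lt (ho : IsOrder vert κ) {e : Strand α.toCoverGraph} {i j : Fin r}
    (hi : start e = vert i) (hj : finish e = some (vert j)) : i < j := by
  rcases e with e | e
  · exact ho.lt e i j hi (Option.some.inj hj)
  · cases hj

theorem front_of_start (ho : IsOrder vert κ) {e : Strand α.toCoverGraph} {j : Fin r}
    (h : start e = vert j) : Front vert (j + 1) (κ j) e where
  dir_eq := dir_of_start (by rw [h, ho.cell_vert])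
  born i hi := by rw [ho.inj (h.symm.trans hi)]; exact Nat.lt_succ_self _
  alive i hi := finish_lt ho h hi

theorem front_of_finish (ho : IsOrder vert κ) {e : Strand α.toCoverGraph} {j : Fin r}
    (h : finish e = some (vert j)) : Front vert j (κ j) e where
  dir_eq := by rw [dir_of_finish h, ho.cell_vert]
  born i hi := finish_lt ho hi h
  alive i hi := by rw [ho.inj (Option.some.inj (h.symm.trans hi))]

theorem front_of_center {e : Strand α.toCoverGraph} {k : Fin 3} (ho : IsOrder vert κ)
    (h : α.cell (start e) = none) (hk : dir e = some k) : Front vert 0 k e where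
  dir_eq := hk
  born i hi := by rw [hi, ho.cell_vert] at h; cases h
  alive i hi := Nat.zero_le _

theorem front_zero {e : Strand α.toCoverGraph} {k : Fin 3} (ho : IsOrder vert κ)
    (h : Front vert 0 k e) : α.cell (start e) = none := by
  by_contra hne
  obtain ⟨j, hj⟩ := ho.surj _ hne
  exact absurd (h.born j hj.symm) (Nat.not_lt_zero _)

theorem front_succ_iff_of_ne (ho : IsOrder vert κ) {e : Strand α.toCoverGraph} {j : Fin r}
    {k : Fin 3} (hk : k ≠ κ j) : Front vert (j + 1) k e ↔ Front vert j k e := by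
  constructor
  · intro h
    refine ⟨h.dir_eq, fun i hi => ?_, fun i hi => (Nat.le_succ _).trans (h.alive i hi)⟩
    refine lt_of_le_of_ne (Nat.le_of_lt_succ (h.born i hi)) fun hij => hk ?_
    rw [Fin.ext hij] at hi
    have := h.dir_eq.symm.trans (front_of_start ho hi).dir_eq
    exact Option.some.inj this
  · intro h
    refine ⟨h.dir_eq, fun i hi => Nat.lt_succ_of_lt (h.born i hi), fun i hi => ?_⟩
    refine lt_of_le_of_ne (h.alive i hi) fun hij => hk ?_
    rw [← Fin.ext hij] at hi
    have := h.dir_eq.symm.trans (front_of_finish ho hi).dir_eq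
    exact Option.some.inj this

theorem front_succ_of_not_finish {e : Strand α.toCoverGraph} {j : Fin r}
    {k : Fin 3} (h : Front vert j k e) (hf : finish e ≠ some (vert j)) :
    Front vert (j + 1) k e := by
  refine ⟨h.dir_eq, fun i hi => Nat.lt_succ_of_lt (h.born i hi), fun i hi => ?_⟩
  refine lt_of_le_of_ne (h.alive i hi) fun hij => hf ?_
  rw [Fin.ext hij]
  exact hi

theorem front_of_succ_of_not_start {e : Strand α.toCoverGraph} {j : Fin r}
    {k : Fin 3} (h : Front vert (j + 1) k e) (hs : start e ≠ vert j) : Front vert j k e := by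
  refine ⟨h.dir_eq, fun i hi => ?_, fun i hi => (Nat.le_succ _).trans (h.alive i hi)⟩
  refine lt_of_le_of_ne (Nat.le_of_lt_succ (h.born i hi)) fun hij => hs ?_
  rw [← Fin.ext hij]
  exact hi

theorem mem_inStrands {G : CoverGraph r n} {v : G.V} {e : Strand G} :
    e ∈ inStrands v ↔ finish e = some v := by
  simp [inStrands]

theorem mem_outStrands {G : CoverGraph r n} {v : G.V} {e : Strand G} :
    e ∈ outStrands v ↔ start e = v := by
  simp [outStrands]

/-- Passing a vertex turns a marking by the strands of a front into one by those of the next front.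
-/
theorem isMarked_succ (ho : IsOrder vert κ) {j : Fin r} {a b : State α.toCoverGraph X}
    (ha : IsMarked Δ vert j a.1 a.2) (hp : ∀ k, k ≠ κ j → b.1 k = a.1 k)
    (hm : ∀ k, k ≠ κ j → b.2 k = a.2 k)
    (hs : IsStep (inStrands (vert j)) (outStrands (vert j)) (wt Δ) (a.1 (κ j)) (a.2 (κ j))
      (b.1 (κ j)) (b.2 (κ j))) : IsMarked Δ vert (j + 1) b.1 b.2 where
  mem k x := by
    by_cases hk : k = κ j
    · subst hk
      by_cases hx : a.2 (κ j) x ∈ inStrands (vert j)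
      · exact front_of_start ho (mem_outStrands.1 (hs.out x hx))
      · rw [hs.keep x hx]
        exact front_succ_of_not_finish (ha.mem _ x) fun h => hx (mem_inStrands.2 h)
    · rw [hm k hk, front_succ_iff_of_ne ho hk]
      exact ha.mem k x
  fibre k x y := by
    by_cases hk : k = κ j
    · subst hk
      exact hs.fibre x y
    · rw [hm k hk, hp k hk]
      exact ha.fibre k x y
  size k e he := by
    by_cases hk : k = κ j
    · subst hk
      by_cases hst : start e = vert j
      · exact hs.size e (mem_outStrands.2 hst)
      · rw [← ha.size _ e (front_of_succ_of_not_start he hst)]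
        refine Nat.card_congr (Equiv.subtypeEquivRight fun x => ?_)
        constructor
        · intro h
          have hx : a.2 (κ j) x ∉ inStrands (vert j) := fun hx =>
            hst (mem_outStrands.1 (h ▸ hs.out x hx))
          rw [← hs.keep x hx, h]
        · intro h
          rw [hs.keep x, h]
          intro hx
          rw [h, mem_inStrands] at hx
          exact absurd (he.alive j hx) (Nat.not_succ_le_self _)
    · rw [hm k hk]
      exact ha.size k e ((front_succ_iff_of_ne ho hk).1 he)

theorem inflow_eq (v : α.V) : α.inflow v = ∑ e ∈ inStrands (G := α.toCoverGraph) v, wt Δ e :=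
  inflow_eq_sum _ Δ v

theorem outflow_eq_of_ray {v : α.V} {k : Fin 3} (hv : α.cell v = some k) :
    α.outflow Δ v k = ∑ e ∈ outStrands (G := α.toCoverGraph) v, wt Δ e := by
  rw [outflow_eq_sum]
  congr 1
  ext e
  simp only [outStrands, Finset.mem_filter, Finset.mem_univ, true_and, and_iff_left_iff_imp]
  intro h
  exact dir_of_start (h ▸ hv)

/-- The number of ways to continue a chain across a labelled vertex of a trivalent type. -/
theorem card_stepRel [Finite X] (hα : α.IsTrivalent) (hΔ : ∀ k i, 0 < Δ k i) (ho : IsOrder vert κ)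
    {j : Fin r} {a : State α.toCoverGraph X} (ha : IsMarked Δ vert j a.1 a.2) :
    Nat.card {b : State α.toCoverGraph X // StepRel Δ vert κ j a b}
      = ∏ e ∈ inStrands (G := α.toCoverGraph) (vert j), wt Δ e := by
  have hcell := ho.cell_vert j
  have hval : (inStrands (G := α.toCoverGraph) (vert j)).card
      + (outStrands (G := α.toCoverGraph) (vert j)).card = 3 := by
    rw [← ((hα (vert j)).2 (by rw [hcell]; simp)).1]
    exact (val_eq_card _ _).symm
  have hsum := α.balanced_ray _ _ hcell
  rw [inflow_eq, outflow_eq_of_ray hcell] at hsum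
  rw [← card_isStep (X := X) (σ := a.1 (κ j)) (m := a.2 (κ j)) hval (fun e _ => wt_pos hΔ e)
    (fun e _ => wt_pos hΔ e) hsum (ha.fibre (κ j))
    (fun e he => ha.size _ e (front_of_finish ho (mem_inStrands.1 he)))
    (fun x hx => absurd ((ha.mem _ x).born j (mem_outStrands.1 hx)) (lt_irrefl _))]
  symm
  refine Nat.card_eq_of_bijective (fun p =>
    ⟨(Function.update a.1 (κ j) p.1.1, Function.update a.2 (κ j) p.1.2), ?_⟩) ⟨?_, ?_⟩
  · have hs : IsStep (inStrands (vert j)) (outStrands (vert j)) (wt Δ) (a.1 (κ j)) (a.2 (κ j))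
        (Function.update a.1 (κ j) p.1.1 (κ j)) (Function.update a.2 (κ j) p.1.2 (κ j)) := by
      simpa only [Function.update_self] using p.2
    have hp : ∀ k, k ≠ κ j → Function.update a.1 (κ j) p.1.1 k = a.1 k :=
      fun k hk => Function.update_of_ne hk _ _
    have hm : ∀ k, k ≠ κ j → Function.update a.2 (κ j) p.1.2 k = a.2 k :=
      fun k hk => Function.update_of_ne hk _ _
    exact ⟨isMarked_succ (b := (_, _)) ho ha hp hm hs, hp, hm, hs⟩
  · rintro ⟨⟨p, m⟩, h⟩ ⟨⟨p', m'⟩, h'⟩ heq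
    have heq := Prod.ext_iff.1 (congrArg Subtype.val heq)
    have h1 := congrFun heq.1 (κ j)
    have h2 := congrFun heq.2 (κ j)
    simp only [Function.update_self] at h1 h2
    subst h1 h2
    rfl
  · rintro ⟨⟨p, m⟩, hb⟩
    refine ⟨⟨(p (κ j), m (κ j)), hb.step⟩, Subtype.ext (Prod.ext ?_ ?_)⟩
    · funext k
      by_cases hk : k = κ j
      · subst hk; exact Function.update_self _ _ _
      · exact (Function.update_of_ne hk _ _).trans (hb.perm k hk).symm
    · funext k
      by_cases hk : k = κ j
      · subst hk; exact Function.update_self _ _ _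
      · exact (Function.update_of_ne hk _ _).trans (hb.mark k hk).symm

/-- Every bounded edge leads to exactly one labelled vertex. -/
theorem prod_inStrands (ho : IsOrder vert κ) :
    ∏ j, ∏ e ∈ inStrands (G := α.toCoverGraph) (vert j), wt Δ e = ∏ e, α.weight e := by
  have h : ∀ v : α.V, ∏ e ∈ inStrands (G := α.toCoverGraph) v, wt Δ e
      = ∏ e ∈ Finset.univ.filter (fun e => α.tgt e = v), α.weight e := by
    intro v
    rw [inStrands, Finset.prod_filter, Fintype.prod_sum_type, Finset.prod_filter]
    have : ∏ i : (Σ k, Fin (n k)), (if finish (G := α.toCoverGraph) (Sum.inr i) = some v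
        then wt Δ (G := α.toCoverGraph) (Sum.inr i) else 1) = 1 :=
      Finset.prod_eq_one fun i _ => if_neg (by simp [finish])
    rw [this, mul_one]
    exact Finset.prod_congr rfl fun e _ => if_congr (by simp [finish]) rfl rfl
  simp only [h]
  rw [← Finset.prod_fiberwise Finset.univ (fun e => α.tgt e) (fun e => α.weight e)]
  have hz : ∀ v, v ∉ Set.range vert →
      ∏ e ∈ Finset.univ.filter (fun e => α.tgt e = v), α.weight e = 1 := by
    intro v hv
    refine Finset.prod_eq_one fun e he => absurd ?_ hv
    rw [Finset.mem_filter] at he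
    obtain ⟨k, hk, -⟩ := α.edge_cell e
    rw [he.2] at hk
    exact ho.surj v (by rw [hk]; simp)
  exact Fintype.prod_of_injective vert ho.inj _ _ hz fun _ => rfl

/-- The number of chains of a trivalent type: a labelled vertex contributes the weights of the edges
that lead to it. -/
theorem card_isChain [Finite X] (hα : α.IsTrivalent) (hΔ : ∀ k i, 0 < Δ k i)
    (ho : IsOrder vert κ) :
    Nat.card {a : Fin (r + 1) → State α.toCoverGraph X // IsChain Δ vert κ a}
      = Nat.card {a : State α.toCoverGraph X // IsStart Δ vert a} * ∏ e, α.weight e := by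
  rw [← prod_inStrands ho, ← card_chains (S := State α.toCoverGraph X) (IsStart Δ vert)
    (fun j a => IsMarked Δ vert j a.1 a.2) (fun a ha => ha.marked) r
    (fun j a b => StepRel Δ vert κ j a b)
    (fun j => ∏ e ∈ inStrands (G := α.toCoverGraph) (vert j), wt Δ e)
    (fun j a b _ hb => hb.marked) (fun j a ha => card_stepRel hα hΔ ho ha)]
  exact Nat.card_congr (Equiv.subtypeEquivRight fun a =>
    ⟨fun h => ⟨h.first, h.step⟩, fun h => ⟨h.1, h.2⟩⟩)

end Chain

/-! ### The states next to the center -/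

/-- The number of maps with fibres of given cardinalities. -/
theorem card_maps_with_fibres {X C : Type} [Fintype X] [Fintype C] (m : C → ℕ)
    (hm : ∑ v, m v = Fintype.card X) :
    Nat.card {ν : X → C // ∀ v, Nat.card {x // ν x = v} = m v} * ∏ v, (m v)!
      = (Fintype.card X)! := by
  set N := {ν : X → C // ∀ v, Nat.card {x // ν x = v} = m v} with hN
  have e₀ : X ≃ Σ v, Fin (m v) := Fintype.equivOfCardEq (by simp [hm])
  set ν₀ : X → C := fun x => (e₀ x).1 with hν₀
  have hcard₀ : ∀ v, Nat.card {x // ν₀ x = v} = m v := by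
    intro v
    have h1 : {x // ν₀ x = v} ≃ {y : Σ v, Fin (m v) // y.1 = v} :=
      e₀.subtypeEquiv fun x => Iff.rfl
    rw [Nat.card_congr (h1.trans (Equiv.sigmaSubtype v)), Nat.card_fin]
  let f : Perm X → N := fun h => ⟨ν₀ ∘ h, fun v => by
    rw [← hcard₀ v]
    exact Nat.card_congr (h.subtypeEquiv fun x => Iff.rfl)⟩
  have hfib : ∀ ν : N, Nat.card {h // f h = ν} = ∏ v, (m v)! := by
    intro ν
    have hexists : ∃ h₁, f h₁ = ν := by
      have h : ∀ v, Nonempty ({x // ν.1 x = v} ≃ {x // ν₀ x = v}) := fun v =>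
        ⟨Fintype.equivOfCardEq (by
          rw [← Nat.card_eq_fintype_card, ← Nat.card_eq_fintype_card, ν.2 v, hcard₀ v])⟩
      let h₁ : Perm X := (Equiv.sigmaFiberEquiv ν.1).symm.trans
        ((Equiv.sigmaCongrRight fun v => (h v).some).trans (Equiv.sigmaFiberEquiv ν₀))
      refine ⟨h₁, Subtype.ext (funext fun x => ?_)⟩
      exact ((h (ν.1 x)).some ⟨x, rfl⟩).2
    obtain ⟨h₁, rfl⟩ := hexists
    have h2 : {h // f h = f h₁} ≃ {h : Perm X // ν₀ ∘ h = ν₀} :=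
      (Equiv.mulRight h₁⁻¹).subtypeEquiv fun h => by
        constructor
        · intro e
          funext x
          have := congrFun (congrArg Subtype.val e) (h₁⁻¹ x)
          change ν₀ (h (h₁.symm x)) = ν₀ (h₁ (h₁.symm x)) at this
          rwa [Equiv.apply_symm_apply] at this
        · intro e
          refine Subtype.ext (funext fun x => ?_)
          have : ν₀ (h (h₁.symm (h₁ x))) = ν₀ (h₁ x) := congrFun e (h₁ x)
          rwa [Equiv.symm_apply_apply] at this
    rw [Nat.card_congr h2, Nat.card_eq_fintype_card, DomMulAct.stabilizer_card]
    refine Finset.prod_congr rfl fun v _ => ?_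
    rw [← hcard₀ v, Nat.card_eq_fintype_card]
  have htot : Nat.card (Perm X) = Nat.card N * ∏ v, (m v)! := by
    have := Fintype.ofFinite N
    rw [Nat.card_congr (Equiv.sigmaFiberEquiv f).symm, Nat.card_sigma,
      Finset.sum_congr rfl fun ν _ => hfib ν, Finset.sum_const, smul_eq_mul, Finset.card_univ,
      Nat.card_eq_fintype_card]
  rw [← htot, Nat.card_eq_fintype_card, Fintype.card_perm]

section Flow

variable {g r : ℕ} {n : Fin 3 → ℕ} {Δ : ∀ k, Fin (n k) → ℕ} {α : CoverType g r Δ}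

/-- Conservation of the flow across a set of vertices over one ray. -/
theorem sum_finish_eq_sum_start {k : Fin 3} (T : Finset α.V) (hT : ∀ v ∈ T, α.cell v = some k) :
    ∑ e ∈ Finset.univ.filter (fun e : Strand α.toCoverGraph => ∃ v ∈ T, finish e = some v), wt Δ e
      = ∑ e ∈ Finset.univ.filter (fun e : Strand α.toCoverGraph => start e ∈ T), wt Δ e := by
  have h1 : ∑ v ∈ T, α.inflow v = ∑ e ∈ Finset.univ.filter
      (fun e : Strand α.toCoverGraph => ∃ v ∈ T, finish e = some v), wt Δ e := by
    rw [Finset.sum_congr rfl fun v _ => inflow_eq v, ← Finset.sum_biUnion]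
    · refine Finset.sum_congr ?_ fun _ _ => rfl
      ext e
      simp [inStrands]
    · intro v _ w _ hvw
      refine Finset.disjoint_left.2 fun e he he' => hvw ?_
      exact Option.some.inj ((mem_inStrands.1 he).symm.trans (mem_inStrands.1 he'))
  have h2 : ∑ v ∈ T, α.outflow Δ v k = ∑ e ∈ Finset.univ.filter
      (fun e : Strand α.toCoverGraph => start e ∈ T), wt Δ e := by
    rw [Finset.sum_congr rfl fun v hv => outflow_eq_of_ray (hT v hv), ← Finset.sum_biUnion]
    · refine Finset.sum_congr ?_ fun _ _ => rfl
      ext e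
      simp [outStrands]
    · intro v _ w _ hvw
      refine Finset.disjoint_left.2 fun e he he' => hvw ?_
      exact (mem_outStrands.1 he).symm.trans (mem_outStrands.1 he')
  rw [← h1, ← h2]
  exact Finset.sum_congr rfl fun v hv => α.balanced_ray v k (hT v hv)

/-- The degree over the center is the sum of the weights of the ends over any ray. -/
theorem sum_outflow_center (k : Fin 3) :
    ∑ v : {v // α.cell v = none}, α.outflow Δ v.1 k = ∑ i, Δ k i := by
  have hT := sum_finish_eq_sum_start (α := α) (k := k)
    (Finset.univ.filter fun v => α.cell v = some k) (by simp)
  have h1 : ∑ v : {v // α.cell v = none}, α.outflow Δ v.1 k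
      = ∑ e ∈ Finset.univ.filter (fun e : Strand α.toCoverGraph =>
        dir e = some k ∧ α.cell (start e) = none), wt Δ e := by
    rw [Finset.sum_congr rfl fun v _ => outflow_eq_sum α.toCoverGraph Δ v.1 k,
      ← Finset.sum_biUnion]
    · refine Finset.sum_congr ?_ fun _ _ => rfl
      ext e
      simp only [Finset.mem_biUnion, Finset.mem_univ, Finset.mem_filter, true_and]
      exact ⟨fun ⟨v, h1, h2⟩ => ⟨h2, h1 ▸ v.2⟩, fun ⟨h1, h2⟩ => ⟨⟨_, h2⟩, rfl, h1⟩⟩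
    · intro v _ w _ hvw
      refine Finset.disjoint_left.2 fun e he he' => hvw (Subtype.ext ?_)
      exact (Finset.mem_filter.1 he).2.1.symm.trans (Finset.mem_filter.1 he').2.1
  have h2 : ∑ i, Δ k i = ∑ e ∈ Finset.univ.filter (fun e : Strand α.toCoverGraph =>
      dir e = some k ∧ finish e = none), wt Δ e := by
    have h0 : ∑ e, (if dir (G := α.toCoverGraph) (Sum.inl e) = some k ∧
        finish (G := α.toCoverGraph) (Sum.inl e) = none then
        wt Δ (G := α.toCoverGraph) (Sum.inl e) else 0) = 0 :=
      Finset.sum_eq_zero fun e _ => if_neg fun h => by cases h.2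
    rw [Finset.sum_filter, Fintype.sum_sum_type, h0, zero_add, Fintype.sum_sigma,
      Finset.sum_eq_single k]
    · exact Finset.sum_congr rfl fun i _ => (if_pos ⟨rfl, rfl⟩).symm
    · intro l _ hl
      exact Finset.sum_eq_zero fun i _ => if_neg fun h => hl (Option.some.inj h.1)
    · simp
  have h3 := Finset.sum_filter_add_sum_filter_not
    (Finset.univ.filter fun e : Strand α.toCoverGraph => dir e = some k)
    (fun e => α.cell (start e) = none) (wt Δ)
  have h4 := Finset.sum_filter_add_sum_filter_not
    (Finset.univ.filter fun e : Strand α.toCoverGraph => dir e = some k)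
    (fun e => finish e = none) (wt Δ)
  rw [Finset.filter_filter, Finset.filter_filter] at h3 h4
  have h5 : Finset.univ.filter (fun e : Strand α.toCoverGraph =>
      dir e = some k ∧ ¬ α.cell (start e) = none) = Finset.univ.filter
      (fun e : Strand α.toCoverGraph =>
        start e ∈ Finset.univ.filter fun v => α.cell v = some k) := by
    ext e
    simp only [Finset.mem_filter, Finset.mem_univ, true_and]
    constructor
    · rintro ⟨h1, h2⟩
      obtain ⟨l, hl⟩ := Option.ne_none_iff_exists'.1 h2
      rw [hl, ← h1, dir_of_start hl]
    · intro h
      exact ⟨dir_of_start h, by rw [h]; simp⟩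
  have h6 : Finset.univ.filter (fun e : Strand α.toCoverGraph =>
      dir e = some k ∧ ¬ finish e = none) = Finset.univ.filter
      (fun e : Strand α.toCoverGraph =>
        ∃ v ∈ Finset.univ.filter (fun v => α.cell v = some k), finish e = some v) := by
    ext e
    simp only [Finset.mem_filter, Finset.mem_univ, true_and]
    constructor
    · rintro ⟨h1, h2⟩
      obtain ⟨v, hv⟩ := Option.ne_none_iff_exists'.1 h2
      exact ⟨v, by rw [← dir_of_finish hv, h1], hv⟩
    · rintro ⟨v, h1, h2⟩
      exact ⟨by rw [dir_of_finish h2, h1], by rw [h2]; simp⟩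
  have h7 : ∑ e ∈ Finset.univ.filter (fun e : Strand α.toCoverGraph =>
      dir e = some k ∧ ¬ finish e = none), wt Δ e = ∑ e ∈ Finset.univ.filter
      (fun e : Strand α.toCoverGraph => dir e = some k ∧ ¬ α.cell (start e) = none), wt Δ e := by
    rw [h5, h6]
    convert hT
  omega

end Flow

section Start

variable {g r : ℕ} {n : Fin 3 → ℕ} {Δ : ∀ k, Fin (n k) → ℕ} {α : CoverType g r Δ}
  {vert : Fin r → α.V} {κ : Fin r → Fin 3} {X : Type}

/-- The edges and ends leaving `v` in the direction `k`, as strands. -/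
def outEquiv (v : α.V) (k : Fin 3) :
    α.Out v k ≃ {e : Strand α.toCoverGraph // start e = v ∧ dir e = some k} where
  toFun := Sum.elim (fun e => ⟨Sum.inl e.1, e.2⟩) (fun i => ⟨Sum.inr ⟨k, i.1⟩, i.2, rfl⟩)
  invFun e := match e with
    | ⟨Sum.inl e, h⟩ => Sum.inl ⟨e, h⟩
    | ⟨Sum.inr ⟨l, i⟩, h⟩ => Sum.inr ⟨Fin.cast (congrArg n (Option.some.inj h.2)) i, by
        obtain ⟨h1, h2⟩ := h
        have : l = k := Option.some.inj h2
        subst this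
        exact h1⟩
  left_inv := by rintro (e | i) <;> rfl
  right_inv := by
    rintro ⟨e | ⟨l, i⟩, h⟩
    · rfl
    · have : l = k := Option.some.inj h.2
      subst this
      rfl

theorem wt_outEquiv (v : α.V) (k : Fin 3) (o : α.Out v k) :
    wt Δ (outEquiv v k o).1 = α.outWeight Δ v k o := by
  rcases o with e | i <;> rfl

theorem localDegree_center {v : α.V} (hv : α.cell v = none) (k : Fin 3) :
    α.localDegree Δ v = α.outflow Δ v k := by
  rw [CoverGraph.localDegree, if_pos hv, α.balanced_center v hv 0 k]

theorem val_center {v : α.V} (hv : α.cell v = none) :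
    α.val v = ∑ k, Fintype.card (α.Out v k) := by
  rw [val_eq_card, Finset.card_eq_zero.2, zero_add]
  · have h : ∀ k, Fintype.card (α.Out v k) = (Finset.univ.filter
        (fun e : Strand α.toCoverGraph => start e = v ∧ dir e = some k)).card := by
      intro k
      rw [Fintype.card_congr (outEquiv v k), Fintype.card_subtype]
    rw [Finset.sum_congr rfl fun k _ => h k, ← Finset.card_biUnion]
    · congr 1
      ext e
      simp only [Finset.mem_biUnion, Finset.mem_univ, Finset.mem_filter, true_and]
      obtain ⟨k, hk⟩ := exists_dir e
      exact ⟨fun h => ⟨k, h, hk⟩, fun ⟨_, h, _⟩ => h⟩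
    · intro k _ l _ hkl
      refine Finset.disjoint_left.2 fun e he he' => hkl ?_
      exact Option.some.inj
        ((Finset.mem_filter.1 he).2.2.symm.trans (Finset.mem_filter.1 he').2.2)
  · refine Finset.filter_eq_empty_iff.2 fun e _ he => ?_
    obtain ⟨k, hk⟩ := exists_dir e
    rw [dir_of_finish he, hv] at hk
    cases hk

theorem riemannHurwitz_center (hα : α.IsTrivalent) {v : α.V} (hv : α.cell v = none) :
    (∑ k, Fintype.card (α.Out v k)) + 2 * α.genus v = α.localDegree Δ v + 2 := by
  have h := (hα v).1 hv
  rw [CoverGraph.rhNumber, CoverGraph.targetVal, if_pos hv, val_center hv] at h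
  push_cast at h
  zify
  linarith

/-- The local monodromy data at a vertex over the center. The number of simple branch points is
written as in `CoverType.vertexHurwitz`; it is zero for a trivalent type. -/
abbrev LocalDatum (α : CoverType g r Δ) (v : α.V) : Type :=
  MonodromyDatum (α.genus v) (α.localDegree Δ v)
    ((∑ k, Fintype.card (α.Out v k)) + 2 * α.genus v - (α.localDegree Δ v + 2))
    (fun k => α.outWeight Δ v k)

variable (ε : X ≃ Σ v : {v // α.cell v = none}, Fin (α.localDegree Δ v.1))

/-- The state composed of local monodromy data. -/
def glue (D : ∀ v : {v // α.cell v = none}, LocalDatum α v.1) : State α.toCoverGraph X :=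
  (fun k => ε.symm.permCongr (Perm.sigmaCongrRight fun v => (D v).σ k),
    fun k x => (outEquiv _ k ((D (ε x).1).mark k (ε x).2)).1)

variable {ε}

theorem glue_perm (D : ∀ v : {v // α.cell v = none}, LocalDatum α v.1) (k v i) :
    (glue ε D).1 k (ε.symm ⟨v, i⟩) = ε.symm ⟨v, (D v).σ k i⟩ := by
  simp [glue, Equiv.permCongr_apply]

theorem glue_mark (D : ∀ v : {v // α.cell v = none}, LocalDatum α v.1) (k v i) :
    (glue ε D).2 k (ε.symm ⟨v, i⟩) = (outEquiv _ k ((D v).mark k i)).1 := by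
  simp only [glue]
  rw [ε.apply_symm_apply]

theorem glue_perm_zpow (D : ∀ v : {v // α.cell v = none}, LocalDatum α v.1) (k v i) (j : ℕ) :
    ((glue ε D).1 k ^ j) (ε.symm ⟨v, i⟩) = ε.symm ⟨v, ((D v).σ k ^ j) i⟩ := by
  induction j with
  | zero => rfl
  | succ j ih => rw [pow_succ', Perm.mul_apply, ih, glue_perm, pow_succ', Perm.mul_apply]

theorem glue_sameCycle [Finite X] (D : ∀ v : {v // α.cell v = none}, LocalDatum α v.1)
    (k v i w i') :
    ((glue ε D).1 k).SameCycle (ε.symm ⟨v, i⟩) (ε.symm ⟨w, i'⟩)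
      ↔ (glue ε D).2 k (ε.symm ⟨v, i⟩) = (glue ε D).2 k (ε.symm ⟨w, i'⟩) := by
  rw [glue_mark, glue_mark]
  constructor
  · intro h
    obtain ⟨j, hj⟩ := h.exists_nat_pow_eq
    rw [glue_perm_zpow, ε.symm.injective.eq_iff, Sigma.mk.injEq] at hj
    obtain ⟨rfl, hj⟩ := hj
    rw [((D v).mark_eq_iff k i i').2 ⟨j, by simpa using hj⟩]
  · intro h
    have hvw : v = w := Subtype.ext
      ((outEquiv _ k ((D v).mark k i)).2.1.symm.trans
        ((congrArg start h).trans (outEquiv _ k ((D w).mark k i')).2.1))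
    subst hvw
    have h := (outEquiv v.1 k).injective (Subtype.ext h)
    obtain ⟨j, hj⟩ := (((D v).mark_eq_iff k i i').1 h).exists_nat_pow_eq
    exact ⟨j, by rw [zpow_natCast, glue_perm_zpow, hj]⟩

end Start

section StartCount

variable {g r : ℕ} {n : Fin 3 → ℕ} {Δ : ∀ k, Fin (n k) → ℕ} {α : CoverType g r Δ}
  {vert : Fin r → α.V} {κ : Fin r → Fin 3} {X : Type}
  {ε : X ≃ Σ v : {v // α.cell v = none}, Fin (α.localDegree Δ v.1)}

theorem simpleBranch_eq_zero (hα : α.IsTrivalent) {v : α.V} (hv : α.cell v = none) :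
    (∑ k, Fintype.card (α.Out v k)) + 2 * α.genus v - (α.localDegree Δ v + 2) = 0 := by
  rw [riemannHurwitz_center hα hv, Nat.sub_self]

theorem isEmpty_simpleBranch (hα : α.IsTrivalent) {v : α.V} (hv : α.cell v = none)
    (j : Fin ((∑ k, Fintype.card (α.Out v k)) + 2 * α.genus v - (α.localDegree Δ v + 2))) : False :=
  Nat.not_lt_zero _ (lt_of_lt_of_eq j.2 (simpleBranch_eq_zero hα hv))

theorem LocalDatum.prod_eq (hα : α.IsTrivalent) {v : α.V} (hv : α.cell v = none)
    (D : LocalDatum α v) : D.σ 0 * D.σ 1 * D.σ 2 = 1 := by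
  have h := D.prod_eq_one
  have hnil : List.ofFn D.τ = [] := by
    rw [List.ofFn_eq_nil_iff]
    exact simpleBranch_eq_zero hα hv
  rwa [hnil, List.prod_nil, one_mul] at h

theorem LocalDatum.ext_of (hα : α.IsTrivalent) {v : α.V} (hv : α.cell v = none)
    {D D' : LocalDatum α v} (h1 : D.σ = D'.σ) (h2 : D.mark = D'.mark) : D = D' := by
  have hτ : D.τ = D'.τ := by
    funext j
    exact (isEmpty_simpleBranch hα hv j).elim
  cases D
  cases D'
  simp only at h1 h2 hτ
  subst h1 h2 hτ
  rfl

theorem start_glue (D : ∀ v : {v // α.cell v = none}, LocalDatum α v.1) (k : Fin 3) (x : X) :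
    start ((glue ε D).2 k x) = (ε x).1.1 :=
  (outEquiv _ k ((D (ε x).1).mark k (ε x).2)).2.1

theorem dir_glue (D : ∀ v : {v // α.cell v = none}, LocalDatum α v.1) (k : Fin 3) (x : X) :
    dir ((glue ε D).2 k x) = some k :=
  (outEquiv _ k ((D (ε x).1).mark k (ε x).2)).2.2

theorem iff_of_invariant [Finite X] {p : Fin 3 → Perm X} {S : X → Prop}
    (hS : ∀ k z, S z → S (p k z)) (k : Fin 3) (z : X) : S (p k z) ↔ S z :=
  ⟨fun h => mem_of_sameCycle (S := {z | S z}) (hS k) h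
    (sameCycle_apply_left.2 (SameCycle.refl _ _)), hS k z⟩

/-- Local monodromy data at the vertices over the center form a state next to the center. -/
theorem isStart_glue [Finite X] (hα : α.IsTrivalent) (ho : IsOrder vert κ)
    (D : ∀ v : {v // α.cell v = none}, LocalDatum α v.1) : IsStart Δ vert (glue ε D) where
  marked :=
    { mem := fun k x => front_of_center ho (by rw [start_glue]; exact (ε x).1.2) (dir_glue D k x)
      fibre := fun k x y => by
        obtain ⟨⟨v, i⟩, rfl⟩ := ε.symm.surjective x
        obtain ⟨⟨w, i'⟩, rfl⟩ := ε.symm.surjective y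
        exact (glue_sameCycle D k v i w i').symm
      size := fun k e he => by
        obtain ⟨v, hv⟩ : ∃ v : {v // α.cell v = none}, start e = v.1 := ⟨⟨_, front_zero ho he⟩, rfl⟩
        obtain ⟨o, ho'⟩ := (outEquiv v.1 k).surjective ⟨e, hv, he.dir_eq⟩
        have hoe : (outEquiv v.1 k o).1 = e := congrArg Subtype.val ho'
        rw [← hoe, wt_outEquiv, ← (D v).mark_card k o]
        symm
        refine Nat.card_eq_of_bijective (fun i => ⟨ε.symm ⟨v, i.1⟩, ?_⟩) ⟨?_, ?_⟩
        · rw [glue_mark, i.2]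
        · rintro ⟨i, hi⟩ ⟨i', hi'⟩ h
          have h := ε.symm.injective (congrArg Subtype.val h)
          simpa using h
        · rintro ⟨x, hx⟩
          obtain ⟨⟨w, i⟩, rfl⟩ := ε.symm.surjective x
          rw [glue_mark] at hx
          have hvw : w = v := Subtype.ext ((outEquiv _ k ((D w).mark k i)).2.1.symm.trans
            ((congrArg start hx).trans (outEquiv _ k o).2.1))
          subst hvw
          exact ⟨⟨i, (outEquiv w.1 k).injective (Subtype.ext hx)⟩, rfl⟩ }
  prod := by
    ext x
    obtain ⟨⟨v, i⟩, rfl⟩ := ε.symm.surjective x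
    rw [Perm.mul_apply, Perm.mul_apply, glue_perm, glue_perm, glue_perm, ← Perm.mul_apply,
      ← Perm.mul_apply, LocalDatum.prod_eq hα v.2]
    rfl
  base k x := by rw [start_glue, start_glue]
  trans S hS x y hxy hx := by
    obtain ⟨⟨v, i⟩, rfl⟩ := ε.symm.surjective x
    obtain ⟨⟨w, i'⟩, rfl⟩ := ε.symm.surjective y
    rw [start_glue, start_glue, ε.apply_symm_apply, ε.apply_symm_apply] at hxy
    have hvw : v = w := Subtype.ext hxy
    subst hvw
    obtain ⟨ρ, hρ, rfl⟩ := (D v).transitive i i'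
    have key : ∀ i, S (ε.symm ⟨v, ρ i⟩) ↔ S (ε.symm ⟨v, i⟩) := by
      refine Subgroup.closure_induction (p := fun ρ _ =>
        ∀ i, S (ε.symm ⟨v, ρ i⟩) ↔ S (ε.symm ⟨v, i⟩)) ?_ ?_ ?_ ?_ hρ
      · rintro ρ (⟨k, rfl⟩ | ⟨j, rfl⟩) i
        · rw [← glue_perm]
          exact iff_of_invariant hS k _
        · exact (isEmpty_simpleBranch hα v.2 j).elim
      · intro i; rfl
      · intro a b _ _ ha hb i
        rw [Perm.mul_apply, ha, hb]
      · intro a _ ha i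
        rw [← ha, ← Perm.mul_apply, mul_inv_cancel, Perm.one_apply]
    exact (key i).2 hx

theorem glue_injective (hα : α.IsTrivalent) :
    Function.Injective (glue ε : (∀ v : {v // α.cell v = none}, LocalDatum α v.1) →
      State α.toCoverGraph X) := by
  intro D D' h
  funext v
  refine LocalDatum.ext_of hα v.2 ?_ ?_
  · funext k
    ext1 i
    have := congrArg (fun a => a.1 k (ε.symm ⟨v, i⟩)) h
    simp only [glue_perm, ε.symm.injective.eq_iff] at this
    simpa using this
  · funext k i
    have := congrArg (fun a => a.2 k (ε.symm ⟨v, i⟩)) h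
    simp only [glue_mark] at this
    exact (outEquiv v.1 k).injective (Subtype.ext this)

/-- Every state next to the center restricts to local monodromy data at the vertices over the
center. -/
theorem exists_glue [Finite X] (hα : α.IsTrivalent) (ho : IsOrder vert κ)
    {a : State α.toCoverGraph X}
    (ha : IsStart Δ vert a) (hε : ∀ x, start (a.2 0 x) = (ε x).1.1) :
    ∃ D, glue ε D = a := by
  have hbase : ∀ k x, start (a.2 k x) = (ε x).1.1 := fun k x => (ha.base k x).trans (hε x)
  have hinv : ∀ k x, (ε (a.1 k x)).1 = (ε x).1 := by
    intro k x
    apply Subtype.ext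
    rw [← hbase k, ← hbase k, (ha.marked.fibre k (a.1 k x) x).2
      (sameCycle_apply_left.2 (SameCycle.refl _ _))]
  have hex : ∀ k (v : {v // α.cell v = none}) i, ∃ i', ε.symm ⟨v, i'⟩ = a.1 k (ε.symm ⟨v, i⟩) := by
    intro k v i
    have h := hinv k (ε.symm ⟨v, i⟩)
    obtain ⟨⟨w, i'⟩, hy⟩ := ε.symm.surjective (a.1 k (ε.symm ⟨v, i⟩))
    rw [← hy, ε.apply_symm_apply, ε.apply_symm_apply] at h
    simp only at h
    subst h
    exact ⟨i', hy⟩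
  choose f hf using hex
  have hfinj : ∀ k (v : {v // α.cell v = none}), Function.Injective (f k v) := by
    intro k v i i' h
    have := (hf k v i).symm.trans ((congrArg (fun i => ε.symm ⟨v, i⟩) h).trans (hf k v i'))
    simpa using this
  let σ : ∀ (v : {v // α.cell v = none}) (k : Fin 3), Perm (Fin (α.localDegree Δ v.1)) := fun v k =>
    Equiv.ofBijective (f k v) (Finite.injective_iff_bijective.1 (hfinj k v))
  have hσ : ∀ v k i, ε.symm ⟨v, σ v k i⟩ = a.1 k (ε.symm ⟨v, i⟩) := fun v k i => hf k v i
  have hpow : ∀ v k i (j : ℕ), (a.1 k ^ j) (ε.symm ⟨v, i⟩) = ε.symm ⟨v, (σ v k ^ j) i⟩ := by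
    intro v k i j
    induction j with
    | zero => rfl
    | succ j ih => rw [pow_succ', Perm.mul_apply, ih, ← hσ, pow_succ', Perm.mul_apply]
  have hmem : ∀ (v : {v // α.cell v = none}) k i, start (a.2 k (ε.symm ⟨v, i⟩)) = v.1 ∧
      dir (a.2 k (ε.symm ⟨v, i⟩)) = some k :=
    fun v k i => ⟨by rw [hbase, ε.apply_symm_apply], (ha.marked.mem k _).dir_eq⟩
  let mk : ∀ (v : {v // α.cell v = none}) k, Fin (α.localDegree Δ v.1) → α.Out v.1 k := fun v k i =>
    (outEquiv v.1 k).symm ⟨_, hmem v k i⟩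
  have hmk : ∀ v k i, (outEquiv v.1 k (mk v k i)).1 = a.2 k (ε.symm ⟨v, i⟩) := fun v k i => by
    simp only [mk, Equiv.apply_symm_apply]
  have hmk_iff : ∀ (v : {v // α.cell v = none}) k i (o : α.Out v.1 k),
      mk v k i = o ↔ a.2 k (ε.symm ⟨v, i⟩) = (outEquiv v.1 k o).1 := by
    intro v k i o
    rw [← hmk, ← Subtype.ext_iff, (outEquiv v.1 k).injective.eq_iff]
  have hsame : ∀ v k i i', (a.1 k).SameCycle (ε.symm ⟨v, i⟩) (ε.symm ⟨v, i'⟩)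
      ↔ (σ v k).SameCycle i i' := by
    intro v k i i'
    constructor
    · intro h
      obtain ⟨j, hj⟩ := h.exists_nat_pow_eq
      rw [hpow] at hj
      exact ⟨j, by simpa using hj⟩
    · intro h
      obtain ⟨j, hj⟩ := h.exists_nat_pow_eq
      exact ⟨j, by rw [zpow_natCast, hpow, hj]⟩
  refine ⟨fun v =>
    { σ := σ v
      τ := fun j => (isEmpty_simpleBranch hα v.2 j).elim
      mark := mk v
      mark_eq_iff := ?_
      mark_card := ?_
      isSwap := fun j => (isEmpty_simpleBranch hα v.2 j).elim
      prod_eq_one := ?_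
      transitive := ?_
      riemannHurwitz := ?_ }, ?_⟩
  · intro k i i'
    rw [hmk_iff, hmk, ha.marked.fibre, hsame]
  · intro k o
    have hfront : Front vert 0 k (outEquiv v.1 k o).1 :=
      front_of_center ho (by rw [(outEquiv v.1 k o).2.1]; exact v.2) (outEquiv v.1 k o).2.2
    rw [← wt_outEquiv, ← ha.marked.size k _ hfront]
    refine Nat.card_eq_of_bijective (fun i => ⟨ε.symm ⟨v, i.1⟩, (hmk_iff v k _ o).1 i.2⟩) ⟨?_, ?_⟩
    · rintro ⟨i, hi⟩ ⟨i', hi'⟩ h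
      have h := ε.symm.injective (congrArg Subtype.val h)
      simpa using h
    · rintro ⟨x, hx⟩
      obtain ⟨⟨w, i⟩, rfl⟩ := ε.symm.surjective x
      have hvw : w = v := Subtype.ext ((hmem w k i).1.symm.trans
        ((congrArg start hx).trans (outEquiv _ k o).2.1))
      subst hvw
      exact ⟨⟨i, (hmk_iff w k i o).2 hx⟩, rfl⟩
  · have hnil : ∀ τ : Fin ((∑ k, Fintype.card (α.Out v.1 k)) + 2 * α.genus v.1
        - (α.localDegree Δ v.1 + 2)) → Perm (Fin (α.localDegree Δ v.1)), List.ofFn τ = [] := by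
      intro τ
      rw [List.ofFn_eq_nil_iff]
      exact simpleBranch_eq_zero hα v.2
    rw [hnil, List.prod_nil, one_mul]
    ext1 i
    have h := congrArg (fun p => p (ε.symm ⟨v, i⟩)) ha.prod
    simp only [Perm.mul_apply, ← hσ, Perm.one_apply] at h
    simpa using h
  · intro i i'
    have h := ha.trans (fun z => ∃ ρ ∈ Subgroup.closure (Set.range (σ v) ∪ Set.range fun j =>
      (isEmpty_simpleBranch hα v.2 j).elim),
      ε.symm ⟨v, ρ i⟩ = z) ?_ (ε.symm ⟨v, i⟩) (ε.symm ⟨v, i'⟩)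
      ((hmem v 0 i).1.trans (hmem v 0 i').1.symm) ⟨1, Subgroup.one_mem _, rfl⟩
    · obtain ⟨ρ, hρ, h⟩ := h
      exact ⟨ρ, hρ, by simpa using h⟩
    · rintro k _ ⟨ρ, hρ, rfl⟩
      exact ⟨σ v k * ρ, Subgroup.mul_mem _ (Subgroup.subset_closure (Or.inl ⟨k, rfl⟩)) hρ, hσ _ _ _⟩
  · have := riemannHurwitz_center hα v.2
    omega
  · refine Prod.ext ?_ ?_
    · funext k
      ext1 x
      obtain ⟨⟨v, i⟩, rfl⟩ := ε.symm.surjective x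
      rw [glue_perm]
      exact hσ v k i
    · funext k x
      obtain ⟨⟨v, i⟩, rfl⟩ := ε.symm.surjective x
      rw [glue_mark]
      exact hmk v k i

/-- The number of states next to the center is `d!` times the product of the Hurwitz numbers of the
vertices over the center: the factorials of the local degrees in their denominators cancel against
the number of ways to distribute the `d` points over the vertices. -/
theorem card_isStart [Fintype X] (hα : α.IsTrivalent) (ho : IsOrder vert κ)
    (hX : ∑ i, Δ 0 i = Fintype.card X) :
    (Nat.card {a : State α.toCoverGraph X // IsStart Δ vert a} : ℚ)
      = ((Fintype.card X)! : ℚ) * ∏ v : {v // α.cell v = none}, α.vertexHurwitz v.1 := by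
  set C := {v // α.cell v = none} with hC
  have hdeg : ∑ v : C, α.localDegree Δ v.1 = Fintype.card X := by
    rw [← hX, ← sum_outflow_center (α := α) 0]
    exact Finset.sum_congr rfl fun v _ => localDegree_center v.2 0
  set N := {ν : X → C // ∀ v, Nat.card {x // ν x = v} = α.localDegree Δ v.1} with hN
  -- the distribution of the points over the vertices; its fibres are families of local data
  let F : {a : State α.toCoverGraph X // IsStart Δ vert a} → N := fun a =>
    ⟨fun x => ⟨start (a.1.2 0 x), front_zero ho (a.2.marked.mem 0 x)⟩, fun v => by
      rw [localDegree_center v.2 0, outflow_eq_sum, ← a.2.marked.card_eq_sum 0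
        (fun e => start e = v.1 ∧ dir e = some 0)]
      · refine Nat.card_congr (Equiv.subtypeEquivRight fun x => ?_)
        rw [Subtype.ext_iff]
        exact ⟨fun h => ⟨h, (a.2.marked.mem 0 x).dir_eq⟩, fun h => h.1⟩
      · exact fun e he => front_of_center ho (by rw [he.1]; exact v.2) he.2⟩
  have hfib : ∀ ν : N, Nat.card {a // F a = ν} = ∏ v : C, Nat.card (LocalDatum α v.1) := by
    intro ν
    have hε : ∀ v, Nonempty ({x // ν.1 x = v} ≃ Fin (α.localDegree Δ v.1)) := fun v =>
      ⟨Fintype.equivOfCardEq (by rw [← Nat.card_eq_fintype_card, ν.2 v, Fintype.card_fin])⟩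
    let ε : X ≃ Σ v : C, Fin (α.localDegree Δ v.1) := (Equiv.sigmaFiberEquiv ν.1).symm.trans
      (Equiv.sigmaCongrRight fun v => (hε v).some)
    have hεν : ∀ x, (ε x).1 = ν.1 x := fun x => rfl
    rw [← Nat.card_pi]
    symm
    refine Nat.card_eq_of_bijective (fun D => ⟨⟨glue ε D, isStart_glue hα ho D⟩, ?_⟩) ⟨?_, ?_⟩
    · refine Subtype.ext (funext fun x => Subtype.ext ?_)
      show start ((glue ε D).2 0 x) = _
      rw [start_glue, hεν]
    · intro D D' h
      exact glue_injective hα (congrArg (fun a => a.1.1) h)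
    · rintro ⟨⟨a, ha⟩, rfl⟩
      obtain ⟨D, hD⟩ := exists_glue (ε := ε) hα ho ha fun x => rfl
      exact ⟨D, Subtype.ext (Subtype.ext hD)⟩
  have h1 : Nat.card {a : State α.toCoverGraph X // IsStart Δ vert a}
      = Nat.card N * ∏ v : C, Nat.card (LocalDatum α v.1) := by
    have := Fintype.ofFinite N
    have : Finite (State α.toCoverGraph X) := inferInstance
    rw [Nat.card_congr (Equiv.sigmaFiberEquiv F).symm, Nat.card_sigma,
      Finset.sum_congr rfl fun ν _ => hfib ν, Finset.sum_const, smul_eq_mul, Finset.card_univ,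
      Nat.card_eq_fintype_card]
  have h2 := card_maps_with_fibres (fun v : C => α.localDegree Δ v.1) hdeg
  change Nat.card N * _ = _ at h2
  rw [h1, ← h2]
  have h3 : ∀ v : C, α.vertexHurwitz v.1
      = (Nat.card (LocalDatum α v.1) : ℚ) / ((α.localDegree Δ v.1)! : ℚ) := fun v => rfl
  simp only [h3]
  rw [Finset.prod_div_distrib]
  push_cast
  have h4 : (∏ v : C, ((α.localDegree Δ v.1)! : ℚ)) ≠ 0 :=
    Finset.prod_ne_zero_iff.2 fun v _ => Nat.cast_ne_zero.2 (Nat.factorial_ne_zero _)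
  field_simp
  ring

end StartCount

/-! ### Paths of permutation triples -/

section Path

variable {X : Type}

/-- Two permutations differ by a transposition. -/
def SwapRel (b c : Perm X) : Prop := ∃ x y, x ≠ y ∧ c = b * swap x y

theorem SwapRel.mul {b c : Perm X} (h : SwapRel b c) (u v : Perm X) :
    SwapRel (u * b * v) (u * c * v) := by
  obtain ⟨x, y, hxy, rfl⟩ := h
  refine ⟨v⁻¹ x, v⁻¹ y, fun e => hxy (v⁻¹.injective e), ?_⟩
  rw [mul_assoc (u * b), ← swap_mul_eq_mul_swap]
  group

/-- The factors before the `k`-th one in the product of a triple. -/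
def before (t : Fin 3 → Perm X) : Fin 3 → Perm X := ![1, t 0, t 0 * t 1]

/-- The factors after the `k`-th one in the product of a triple. -/
def after (t : Fin 3 → Perm X) : Fin 3 → Perm X := ![t 1 * t 2, t 2, 1]

/-- The product of a triple. -/
def tripleProd (t : Fin 3 → Perm X) : Perm X := t 0 * t 1 * t 2

theorem before_mul_mul_after (t : Fin 3 → Perm X) (k : Fin 3) :
    before t k * t k * after t k = tripleProd t := by
  fin_cases k <;> simp [before, after, tripleProd, mul_assoc]

theorem before_congr {t t' : Fin 3 → Perm X} {k : Fin 3} (h : ∀ l, l ≠ k → t l = t' l) :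
    before t k = before t' k := by
  fin_cases k
  · rfl
  · exact h 0 (by decide)
  · exact congrArg₂ (· * ·) (h 0 (by decide)) (h 1 (by decide))

theorem after_congr {t t' : Fin 3 → Perm X} {k : Fin 3} (h : ∀ l, l ≠ k → t l = t' l) :
    after t k = after t' k := by
  fin_cases k
  · exact congrArg₂ (· * ·) (h 1 (by decide)) (h 2 (by decide))
  · exact h 2 (by decide)
  · rfl

variable {r : ℕ} {n : Fin 3 → ℕ}

/-- A path of triples of permutations: it starts at a triple with product one, and in the `j`-th
step the permutation over the ray `κ j` is multiplied by a transposition. The cycles of the last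
triple are marked by the ends, and the group generated by all the permutations is transitive. -/
structure IsPath (Δ : ∀ k, Fin (n k) → ℕ) (κ : Fin r → Fin 3) (s : Fin (r + 1) → Fin 3 → Perm X)
    (mark : ∀ k, X → Fin (n k)) : Prop where
  prod : tripleProd (s 0) = 1
  step : ∀ j, SwapRel (s j.castSucc (κ j)) (s j.succ (κ j))
  keep : ∀ j k, k ≠ κ j → s j.succ k = s j.castSucc k
  fibre : ∀ k x y, mark k x = mark k y ↔ (s (Fin.last r) k).SameCycle x y
  size : ∀ k i, Nat.card {x // mark k x = i} = Δ k i
  trans : ∀ S : X → Prop, (∀ j k z, S z → S (s j k z)) → ∀ x y, S x → S y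

/-- The last triple of a path together with the path of its products. Unlike `IsPath`, this notion
does not refer to the rays over which the steps are made. -/
structure IsProductPath (Δ : ∀ k, Fin (n k) → ℕ) (σ : Fin 3 → Perm X) (Y : Fin (r + 1) → Perm X)
    (mark : ∀ k, X → Fin (n k)) : Prop where
  first : Y 0 = 1
  last : Y (Fin.last r) = tripleProd σ
  step : ∀ j : Fin r, SwapRel (Y j.castSucc) (Y j.succ)
  fibre : ∀ k x y, mark k x = mark k y ↔ (σ k).SameCycle x y
  size : ∀ k i, Nat.card {x // mark k x = i} = Δ k i
  trans : ∀ S : X → Prop, (∀ k z, S z → S (σ k z)) → (∀ j z, S z → S (Y j z)) → ∀ x y, S x → S y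

variable {Δ : ∀ k, Fin (n k) → ℕ} {κ : Fin r → Fin 3}

/-- The group generated by all the permutations of a path is generated by the last triple and the
products. -/
theorem IsPath.isProductPath {s : Fin (r + 1) → Fin 3 → Perm X} {mark : ∀ k, X → Fin (n k)}
    [Finite X] (h : IsPath Δ κ s mark) :
    IsProductPath Δ (s (Fin.last r)) (fun j => tripleProd (s j)) mark where
  first := h.prod
  last := rfl
  step j := by
    rw [← before_mul_mul_after _ (κ j), ← before_mul_mul_after (s j.succ) (κ j),
      before_congr (h.keep j), after_congr (h.keep j)]
    exact (h.step j).mul _ _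
  fibre := h.fibre
  size := h.size
  trans S hσ hY := by
    refine h.trans S fun j => ?_
    induction j using Fin.reverseInduction with
    | last => exact hσ
    | cast j ih =>
      intro k z hz
      by_cases hk : k = κ j
      · -- the permutation over the ray `κ j` is expressed by the product and the other permutations
        have hpow : ∀ l, l ≠ k → ∀ z, S (s j.castSucc l z) ↔ S z := by
          intro l hl
          have := ih l
          rw [h.keep j l (hk ▸ hl)] at this
          exact fun z => iff_of_invariant (p := fun _ => s j.castSucc l) (fun _ => this) 0 z
        have hb : ∀ z, S (before (s j.castSucc) k z) ↔ S z := by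
          clear hk hz
          fin_cases k
          · intro z; rfl
          · exact hpow 0 (by decide)
          · intro z
            exact (hpow 0 (by decide) _).trans (hpow 1 (by decide) _)
        have ha : ∀ z, S (after (s j.castSucc) k z) ↔ S z := by
          clear hk hz
          fin_cases k
          · intro z
            exact (hpow 1 (by decide) _).trans (hpow 2 (by decide) _)
          · exact hpow 2 (by decide)
          · intro z; rfl
        have hY' := hY j.castSucc
        simp only [← before_mul_mul_after _ k] at hY'
        obtain ⟨w, rfl⟩ := (after (s j.castSucc) k).surjective z
        have := hY' w ((ha w).1 hz)
        rw [Perm.mul_apply, Perm.mul_apply] at this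
        exact (hb _).1 this
      · rw [← h.keep j k hk]
        exact ih k z hz

/-- A path is determined by its last triple and its products. -/
theorem path_injective {s s' : Fin (r + 1) → Fin 3 → Perm X} (hk : ∀ j k, k ≠ κ j →
    s j.succ k = s j.castSucc k) (hk' : ∀ j k, k ≠ κ j → s' j.succ k = s' j.castSucc k)
    (hlast : s (Fin.last r) = s' (Fin.last r)) (hY : ∀ j, tripleProd (s j) = tripleProd (s' j)) :
    s = s' := by
  funext j
  induction j using Fin.reverseInduction with
  | last => exact hlast
  | cast j ih =>
    have hne : ∀ k, k ≠ κ j → s j.castSucc k = s' j.castSucc k := fun k h => by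
      rw [← hk j k h, ← hk' j k h, ih]
    funext k
    by_cases h : k = κ j
    · subst h
      have := hY j.castSucc
      rw [← before_mul_mul_after _ (κ j), ← before_mul_mul_after (s' j.castSucc) (κ j),
        before_congr hne, after_congr hne] at this
      exact mul_left_cancel (mul_right_cancel this)
    · exact hne k h

/-- The path with given last triple and given products. Going backwards, the product determines the
only permutation that is allowed to change. -/
def pathOf (κ : Fin r → Fin 3) (σ : Fin 3 → Perm X) (Y : Fin (r + 1) → Perm X) :
    Fin (r + 1) → Fin 3 → Perm X :=
  Fin.reverseInduction (motive := fun _ => Fin 3 → Perm X) σ fun j t =>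
    Function.update t (κ j) ((before t (κ j))⁻¹ * Y j.castSucc * (after t (κ j))⁻¹)

theorem pathOf_last (σ : Fin 3 → Perm X) (Y : Fin (r + 1) → Perm X) :
    pathOf κ σ Y (Fin.last r) = σ := by
  simp [pathOf]

theorem pathOf_castSucc (σ : Fin 3 → Perm X) (Y : Fin (r + 1) → Perm X) (j : Fin r) :
    pathOf κ σ Y j.castSucc = Function.update (pathOf κ σ Y j.succ) (κ j)
      ((before (pathOf κ σ Y j.succ) (κ j))⁻¹ * Y j.castSucc
        * (after (pathOf κ σ Y j.succ) (κ j))⁻¹) := by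
  simp [pathOf]

theorem pathOf_keep (σ : Fin 3 → Perm X) (Y : Fin (r + 1) → Perm X) (j : Fin r) (k : Fin 3)
    (hk : k ≠ κ j) : pathOf κ σ Y j.succ k = pathOf κ σ Y j.castSucc k := by
  rw [pathOf_castSucc, Function.update_of_ne hk]

theorem tripleProd_pathOf {σ : Fin 3 → Perm X} {Y : Fin (r + 1) → Perm X}
    (hlast : Y (Fin.last r) = tripleProd σ) (j : Fin (r + 1)) :
    tripleProd (pathOf κ σ Y j) = Y j := by
  induction j using Fin.lastCases with
  | last => rw [pathOf_last, hlast]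
  | cast j =>
    rw [← before_mul_mul_after _ (κ j), ← before_congr (pathOf_keep σ Y j),
      ← after_congr (pathOf_keep σ Y j)]
    rw [pathOf_castSucc, Function.update_self]
    group

theorem IsProductPath.isPath {σ : Fin 3 → Perm X} {Y : Fin (r + 1) → Perm X}
    {mark : ∀ k, X → Fin (n k)} (h : IsProductPath Δ σ Y mark) :
    IsPath Δ κ (pathOf κ σ Y) mark where
  prod := by rw [tripleProd_pathOf h.last, h.first]
  step j := by
    have h1 := (h.step j).mul (before (pathOf κ σ Y j.succ) (κ j))⁻¹
      (after (pathOf κ σ Y j.succ) (κ j))⁻¹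
    have h2 := before_mul_mul_after (pathOf κ σ Y j.succ) (κ j)
    rw [tripleProd_pathOf h.last] at h2
    have h3 : (before (pathOf κ σ Y j.succ) (κ j))⁻¹ * Y j.succ
        * (after (pathOf κ σ Y j.succ) (κ j))⁻¹ = pathOf κ σ Y j.succ (κ j) := by
      rw [← h2]
      group
    rw [h3] at h1
    rw [pathOf_castSucc, Function.update_self]
    exact h1
  keep := pathOf_keep σ Y
  fibre := by rw [pathOf_last]; exact h.fibre
  size := h.size
  trans S hS := by
    refine h.trans S ?_ ?_
    · intro k
      have := hS (Fin.last r) k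
      rwa [pathOf_last] at this
    · intro j z hz
      rw [← tripleProd_pathOf (κ := κ) h.last j]
      exact hS j 0 _ (hS j 1 _ (hS j 2 _ hz))

/-- The number of paths does not depend on the rays over which the transpositions lie. -/
theorem card_isPath_eq [Finite X] (κ κ' : Fin r → Fin 3) :
    Nat.card {q : (Fin (r + 1) → Fin 3 → Perm X) × (∀ k, X → Fin (n k)) // IsPath Δ κ q.1 q.2}
      = Nat.card {q : (Fin (r + 1) → Fin 3 → Perm X) × (∀ k, X → Fin (n k)) //
        IsPath Δ κ' q.1 q.2} := by
  have key : ∀ κ : Fin r → Fin 3, Nat.card {q : (Fin (r + 1) → Fin 3 → Perm X) ×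
      (∀ k, X → Fin (n k)) // IsPath Δ κ q.1 q.2} = Nat.card {q : (Fin 3 → Perm X) ×
        (Fin (r + 1) → Perm X) × (∀ k, X → Fin (n k)) // IsProductPath Δ q.1 q.2.1 q.2.2} := by
    intro κ
    refine Nat.card_eq_of_bijective (fun q =>
      ⟨(q.1.1 (Fin.last r), fun j => tripleProd (q.1.1 j), q.1.2), q.2.isProductPath⟩) ⟨?_, ?_⟩
    · rintro ⟨⟨s, m⟩, h⟩ ⟨⟨s', m'⟩, h'⟩ heq
      have heq := congrArg Subtype.val heq
      simp only [Prod.mk.injEq] at heq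
      obtain ⟨h1, h2, h3⟩ := heq
      exact Subtype.ext (Prod.ext (path_injective h.keep h'.keep h1 (congrFun h2)) h3)
    · rintro ⟨⟨σ, Y, m⟩, h⟩
      refine ⟨⟨(pathOf κ σ Y, m), h.isPath⟩, Subtype.ext (Prod.ext ?_ (Prod.ext ?_ rfl))⟩
      · exact pathOf_last σ Y
      · exact funext fun j => tripleProd_pathOf h.last j
  rw [key, key]

end Path

/-! ### The path of a chain -/

section ChainPath

variable {g r : ℕ} {n : Fin 3 → ℕ} {Δ : ∀ k, Fin (n k) → ℕ} {X : Type}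

/-- A chain on a type lies over a path if it has the same permutations, and its last marking is the
marking of the path. -/
structure IsChainOver {G : CoverGraph r n} (Δ : ∀ k, Fin (n k) → ℕ) (vert : Fin r → G.V)
    (κ : Fin r → Fin 3) (a : Fin (r + 1) → State G X)
    (q : (Fin (r + 1) → Fin 3 → Perm X) × (∀ k, X → Fin (n k))) : Prop where
  chain : IsChain Δ vert κ a
  perm : ∀ j, (a j).1 = q.1 j
  mark : ∀ k x, (a (Fin.last r)).2 k x = Sum.inr ⟨k, q.2 k x⟩

variable {α : CoverType g r Δ} {vert : Fin r → α.V} {κ : Fin r → Fin 3}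
  {a : Fin (r + 1) → State α.toCoverGraph X}

theorem exists_vert_of_edge (ho : IsOrder vert κ) (e : α.E) : ∃ j, α.tgt e = vert j := by
  obtain ⟨k, hk, -⟩ := α.edge_cell e
  obtain ⟨j, hj⟩ := ho.surj (α.tgt e) (by rw [hk]; simp)
  exact ⟨j, hj.symm⟩

theorem exists_end_of_front_last (ho : IsOrder vert κ) {k : Fin 3} {e : Strand α.toCoverGraph}
    (h : Front vert r k e) : ∃ i, e = Sum.inr ⟨k, i⟩ := by
  rcases e with e | ⟨l, i⟩
  · obtain ⟨j, hj⟩ := exists_vert_of_edge ho e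
    exact absurd (h.alive j (congrArg some hj)) (not_le.2 j.2)
  · have : l = k := Option.some.inj h.dir_eq
    subst this
    exact ⟨i, rfl⟩

theorem IsChain.exists_over (ha : IsChain Δ vert κ a) (ho : IsOrder vert κ) :
    ∃ q, IsChainOver Δ vert κ a q := by
  have h : ∀ k x, ∃ i, (a (Fin.last r)).2 k x = Sum.inr ⟨k, i⟩ := fun k x =>
    exists_end_of_front_last ho (by simpa using (ha.marked (Fin.last r)).mem k x)
  choose m hm using h
  exact ⟨(fun j => (a j).1, m), ha, fun _ => rfl, hm⟩

theorem IsChainOver.eq_of {q q'} (h : IsChainOver Δ vert κ a q) (h' : IsChainOver Δ vert κ a q') :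
    q = q' := by
  refine Prod.ext (funext fun j => (h.perm j).symm.trans (h'.perm j)) ?_
  funext k x
  have := (h.mark k x).symm.trans (h'.mark k x)
  simpa using this

theorem IsChain.touched_iff (ha : IsChain Δ vert κ a) (j : Fin r) (x : X) :
    finish ((a j.castSucc).2 (κ j) x) = some (vert j)
      ↔ Touched ((a j.castSucc).1 (κ j)) ((a j.succ).1 (κ j)) x := by
  rw [← (ha.step j).step.touched, mem_inStrands]

theorem IsChain.mark_succ_of_not (ha : IsChain Δ vert κ a) {j : Fin r} {k : Fin 3} {x : X}
    (h : ¬ (k = κ j ∧ Touched ((a j.castSucc).1 (κ j)) ((a j.succ).1 (κ j)) x)) :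
    (a j.succ).2 k x = (a j.castSucc).2 k x := by
  by_cases hk : k = κ j
  · subst hk
    exact (ha.step j).step.keep x fun hx =>
      h ⟨rfl, (ha.touched_iff j x).1 (mem_inStrands.1 hx)⟩
  · rw [(ha.step j).mark k hk]

theorem IsChain.start_succ (ha : IsChain Δ vert κ a) {j : Fin r} {x : X}
    (h : Touched ((a j.castSucc).1 (κ j)) ((a j.succ).1 (κ j)) x) :
    start ((a j.succ).2 (κ j) x) = vert j :=
  mem_outStrands.1 ((ha.step j).step.out x (mem_inStrands.2 ((ha.touched_iff j x).2 h)))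

theorem IsMarked.exists_mark {j : ℕ} {p : Fin 3 → Perm X} {m : Fin 3 → X → Strand α.toCoverGraph}
    (hm : IsMarked Δ vert j p m) (hΔ : ∀ k i, 0 < Δ k i) {k : Fin 3} {e : Strand α.toCoverGraph}
    (he : Front vert j k e) : ∃ x, m k x = e := by
  by_contra h
  push Not at h
  have := hm.size k e he
  have h0 : Nat.card {x // m k x = e} = 0 := by
    have : IsEmpty {x // m k x = e} := ⟨fun x => h x.1 x.2⟩
    exact Nat.card_of_isEmpty
  rw [h0] at this
  exact absurd (wt_pos hΔ e) (by omega)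

/-- The points of `X` on the sheets of a cover near a vertex: those distributed to it if it lies
over the center, and those touched when it is passed otherwise. -/
def At (vert : Fin r → α.V) (κ : Fin r → Fin 3) (a : Fin (r + 1) → State α.toCoverGraph X) (v : α.V)
    (x : X) : Prop :=
  start ((a 0).2 0 x) = v ∨
    ∃ j, v = vert j ∧ Touched ((a j.castSucc).1 (κ j)) ((a j.succ).1 (κ j)) x

theorem IsChain.at_start (ha : IsChain Δ vert κ a) (j : Fin (r + 1)) (k : Fin 3) (x : X) :
    At vert κ a (start ((a j).2 k x)) x := by
  induction j using Fin.induction generalizing k with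
  | zero => exact Or.inl (ha.first.base k x).symm
  | succ j ih =>
    by_cases h : k = κ j ∧ Touched ((a j.castSucc).1 (κ j)) ((a j.succ).1 (κ j)) x
    · obtain ⟨rfl, h⟩ := h
      rw [ha.start_succ h]
      exact Or.inr ⟨j, rfl, h⟩
    · rw [ha.mark_succ_of_not h]
      exact ih k

theorem IsChain.at_finish (ha : IsChain Δ vert κ a) {j : Fin r} {x : X}
    (h : finish ((a j.castSucc).2 (κ j) x) = some (vert j)) : At vert κ a (vert j) x :=
  Or.inr ⟨j, rfl, (ha.touched_iff j x).1 h⟩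

/-- The permutations of a chain form a path. Transitivity holds because the cover is connected: a
set that is invariant under the permutations contains with a point all points at the same vertex,
and neighbouring vertices have a point in common. -/
theorem IsChain.isPath [Finite X] (hΔ : ∀ k i, 0 < Δ k i) (ho : IsOrder vert κ)
    {q} (ha : IsChainOver Δ vert κ a q) : IsPath Δ κ q.1 q.2 where
  prod := by rw [← ha.perm]; exact ha.chain.first.prod
  step j := by
    rw [← ha.perm, ← ha.perm]
    exact (ha.chain.step j).step.swap
  keep j k hk := by
    rw [← ha.perm, ← ha.perm]
    exact (ha.chain.step j).perm k hk
  fibre k x y := by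
    rw [← ha.perm, ← (ha.chain.marked (Fin.last r)).fibre k x y, ha.mark, ha.mark]
    simp
  size k i := by
    have h : Front vert (Fin.last r : Fin (r + 1)) k (Sum.inr ⟨k, i⟩ : Strand α.toCoverGraph) :=
      ⟨rfl, fun i _ => i.2, fun _ h => by cases h⟩
    have := (ha.chain.marked (Fin.last r)).size k _ h
    refine Eq.trans (Nat.card_congr (Equiv.subtypeEquivRight fun x => ?_)) this
    rw [ha.mark]
    simp
  trans S hS x y hx := by
    have hS : ∀ j k z, S ((a j).1 k z) ↔ S z := by
      intro j k
      exact iff_of_invariant (fun k z => by rw [ha.perm]; exact hS j k z) k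
    have hcyc : ∀ j k z w, ((a j).1 k).SameCycle z w → (S z ↔ S w) := by
      intro j k z w h
      exact ⟨fun hz => mem_of_sameCycle (S := {z | S z}) (fun z hz => (hS j k z).2 hz) hz h,
        fun hw => mem_of_sameCycle (S := {z | S z}) (fun z hz => (hS j k z).2 hz) hw h.symm⟩
    -- points at the same vertex
    have h1 : ∀ v x y, At vert κ a v x → At vert κ a v y → S x → S y := by
      intro v x y hvx hvy hx
      have hne : ∀ x j, start ((a 0).2 0 x) ≠ vert j := by
        intro x j h
        have := front_zero ho (ha.chain.first.marked.mem 0 x)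
        rw [h, ho.cell_vert] at this
        cases this
      rcases hvx with hvx | ⟨j, hj, hvx⟩
      · rcases hvy with hvy | ⟨j, hj, hvy⟩
        · exact ha.chain.first.trans S (fun k z => (hS 0 k z).2) x y (hvx.trans hvy.symm) hx
        · exact absurd (hvx.trans hj) (hne x j)
      · rcases hvy with hvy | ⟨j', hj', hvy⟩
        · exact absurd (hvy.trans hj) (hne y j)
        · obtain rfl := ho.inj (hj.symm.trans hj')
          obtain ⟨u, w, huw, hs⟩ := (ha.chain.step j).step.swap
          have key : S u ↔ S w := by
            by_cases h : ((a j.castSucc).1 (κ j)).SameCycle u w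
            · exact hcyc _ _ _ _ h
            · have := sameCycle_mul_swap_of_not h
              rw [← hs] at this
              exact hcyc _ _ _ _ this
          rw [hs, touched_mul_swap huw] at hvx hvy
          have hx' : S u := by
            rcases hvx with h | h
            · exact (hcyc _ _ _ _ h).1 hx
            · exact key.2 ((hcyc _ _ _ _ h).1 hx)
          rcases hvy with h | h
          · exact (hcyc _ _ _ _ h).2 hx'
          · exact (hcyc _ _ _ _ h).2 (key.1 hx')
    -- neighbouring vertices share a point
    have h2 : ∀ e : α.E, ∃ x, At vert κ a (α.src e) x ∧ At vert κ a (α.tgt e) x := by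
      intro e
      obtain ⟨j, hj⟩ := exists_vert_of_edge ho e
      have hf : finish (Sum.inl e : Strand α.toCoverGraph) = some (vert j) := congrArg some hj
      obtain ⟨x, hx⟩ := (ha.chain.marked j.castSucc).exists_mark hΔ (front_of_finish ho hf)
      refine ⟨x, ?_, ?_⟩
      · have := ha.chain.at_start j.castSucc (κ j) x
        rwa [hx] at this
      · rw [hj]
        exact ha.chain.at_finish (by rw [hx]; exact hf)
    have h3 : ∀ v w, α.Joined Set.univ v w →
        ((∀ x, At vert κ a v x → S x) ↔ ∀ x, At vert κ a w x → S x) := by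
      intro v w h
      unfold CoverGraph.Joined at h
      induction h with
      | rel v w h =>
        obtain ⟨e, -, rfl, rfl⟩ := h
        obtain ⟨x, hx1, hx2⟩ := h2 e
        exact ⟨fun h y hy => h1 _ x y hx2 hy (h x hx1), fun h y hy => h1 _ x y hx1 hy (h x hx2)⟩
      | refl v => rfl
      | symm v w _ ih => exact ih.symm
      | trans u v w _ _ ih ih' => exact ih.trans ih'
    exact (h3 _ _ (α.connected (start ((a 0).2 0 x)) (start ((a 0).2 0 y)))).1
      (fun z hz => h1 _ x z (Or.inl rfl) hz hx) y (Or.inl rfl)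

/-- Every vertex over the center carries points of `X`. -/
theorem IsChain.exists_base [Finite X] [Nonempty X] (hΔ : ∀ k i, 0 < Δ k i)
    (ha : IsChain Δ vert κ a) (ho : IsOrder vert κ)
    {v : α.V} (hv : α.cell v = none) : ∃ x, start ((a 0).2 0 x) = v := by
  by_contra hne
  push Not at hne
  have hout : ∀ e : Strand α.toCoverGraph, start e ≠ v := by
    intro e he
    obtain ⟨k, hk⟩ := exists_dir e
    obtain ⟨x, hx⟩ := ha.first.marked.exists_mark hΔ (front_of_center ho (he ▸ hv) hk)
    have := ha.first.base k x
    rw [hx, he] at this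
    exact hne x this.symm
  have hall : ∀ u w, α.Joined Set.univ u w → (u = v ↔ w = v) := by
    intro u w h
    unfold CoverGraph.Joined at h
    induction h with
    | rel u w h =>
      obtain ⟨e, -, rfl, rfl⟩ := h
      constructor
      · intro h; exact absurd h (hout (Sum.inl e))
      · intro h
        obtain ⟨k, hk, -⟩ := α.edge_cell e
        rw [h, hv] at hk
        cases hk
    | refl v => rfl
    | symm v w _ ih => exact ih.symm
    | trans u v w _ _ ih ih' => exact ih.trans ih'
  obtain ⟨x⟩ := ‹Nonempty X›
  exact hne x ((hall v _ (α.connected v (start ((a 0).2 0 x)))).1 rfl)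

end ChainPath

/-! ### Covers with chains over the same path are isomorphic -/

section Unique

variable {g r : ℕ} {n : Fin 3 → ℕ} {Δ : ∀ k, Fin (n k) → ℕ} {X : Type}

/-- The map on strands given by a map on bounded edges. -/
abbrev strandMap {G G' : CoverGraph r n} (f : G.E → G'.E) : Strand G → Strand G' := Sum.map f id

/-- Two surjections with the same fibres have isomorphic targets. -/
theorem exists_equiv_of_ker {T A B : Type} {f : T → A} {h : T → B} (hf : Function.Surjective f)
    (hh : Function.Surjective h) (hker : ∀ x y, f x = f y ↔ h x = h y) :
    ∃ e : A ≃ B, ∀ x, e (f x) = h x := by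
  choose s hs using hf
  have hinj : Function.Injective fun y => h (s y) := by
    intro y z hyz
    rw [← hs y, ← hs z]
    exact (hker _ _).2 hyz
  have hval : ∀ x, h (s (f x)) = h x := fun x => (hker _ _).1 (hs _)
  refine ⟨Equiv.ofBijective (fun y => h (s y)) ⟨hinj, fun z => ?_⟩, fun x => ?_⟩
  · obtain ⟨x, rfl⟩ := hh z
    exact ⟨f x, hval x⟩
  · exact hval x

section Center

variable {α : CoverType g r Δ} {vert : Fin r → α.V} {κ : Fin r → Fin 3}
  {a : Fin (r + 1) → State α.toCoverGraph X}

/-- Two points lie over the same vertex over the center if and only if they lie in the same orbit of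
the first triple of permutations. -/
theorem IsChain.start_eq_iff (ha : IsChain Δ vert κ a) (x y : X) :
    start ((a 0).2 0 x) = start ((a 0).2 0 y) ↔
      ∀ S : X → Prop, (∀ k z, S z → S ((a 0).1 k z)) → S x → S y := by
  constructor
  · exact fun h S hS hx => ha.first.trans S hS x y h hx
  · intro h
    refine h (fun z => start ((a 0).2 0 x) = start ((a 0).2 0 z)) (fun k z hz => ?_) rfl
    refine hz.trans ?_
    rw [← ha.first.base k, ← ha.first.base k, (ha.first.marked.fibre k z ((a 0).1 k z)).2
      (sameCycle_apply_right.2 (SameCycle.refl _ _))]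

theorem IsChain.exists_edge (ha : IsChain Δ vert κ a) {j : Fin r} {x : X}
    (h : Touched ((a j.castSucc).1 (κ j)) ((a j.succ).1 (κ j)) x) :
    ∃ e : α.E, (a j.castSucc).2 (κ j) x = Sum.inl e ∧ α.tgt e = vert j := by
  have h := (ha.touched_iff j x).2 h
  rcases he : (a j.castSucc).2 (κ j) x with e | i
  · rw [he] at h
    exact ⟨e, rfl, Option.some.inj h⟩
  · rw [he] at h
    cases h

theorem IsChain.exists_touched (ha : IsChain Δ vert κ a) (hΔ : ∀ k i, 0 < Δ k i)
    (ho : IsOrder vert κ) (e : α.E) : ∃ j x, α.tgt e = vert j ∧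
      Touched ((a j.castSucc).1 (κ j)) ((a j.succ).1 (κ j)) x ∧
      (a j.castSucc).2 (κ j) x = Sum.inl e := by
  obtain ⟨j, hj⟩ := exists_vert_of_edge ho e
  have hf : finish (Sum.inl e : Strand α.toCoverGraph) = some (vert j) := congrArg some hj
  obtain ⟨x, hx⟩ := (ha.marked j.castSucc).exists_mark hΔ (front_of_finish ho hf)
  refine ⟨j, x, hj, ?_, hx⟩
  rw [← ha.touched_iff, hx]
  exact hf

end Center

variable {α β : CoverType g r Δ} {vert : Fin r → α.V} {vert' : Fin r → β.V} {κ : Fin r → Fin 3}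
  {a : Fin (r + 1) → State α.toCoverGraph X} {b : Fin (r + 1) → State β.toCoverGraph X}

theorem card_out_eq (onV : α.V ≃ β.V) (onE : α.E ≃ β.E)
    (hsrc : ∀ e, β.src (onE e) = onV (α.src e)) (htgt : ∀ e, β.tgt (onE e) = onV (α.tgt e))
    (hcell : ∀ v, β.cell (onV v) = α.cell v) (hends : ∀ k i, β.ends k i = onV (α.ends k i))
    (v : α.V) (k : Fin 3) : Fintype.card (α.Out v k) = Fintype.card (β.Out (onV v) k) := by
  refine Fintype.card_congr (Equiv.sumCongr (onE.subtypeEquiv fun e => ?_)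
    (Equiv.subtypeEquivRight fun i => ?_))
  · rw [hsrc, htgt, hcell, onV.injective.eq_iff]
  · rw [hends, onV.injective.eq_iff]

theorem IsChain.localDegree_eq [Finite X] (ha : IsChain Δ vert κ a) (ho : IsOrder vert κ) {v : α.V}
    (hv : α.cell v = none) : α.localDegree Δ v = Nat.card {x // start ((a 0).2 0 x) = v} := by
  rw [localDegree_center hv 0, outflow_eq_sum, ← ha.first.marked.card_eq_sum 0
    (fun e => start e = v ∧ dir e = some 0)]
  · exact Nat.card_congr (Equiv.subtypeEquivRight fun x =>
      ⟨fun h => h.1, fun h => ⟨h, (ha.first.marked.mem 0 x).dir_eq⟩⟩)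
  · exact fun e he => front_of_center ho (by rw [he.1]; exact hv) he.2

/-- A trivalent type with a chain is determined up to isomorphism by the path under the chain. The
vertices over the center are the orbits of the first triple, the other vertices are the steps, and
the bounded edges are the cycles touched in some step. The isomorphism takes one chain to the
other. -/
theorem exists_iso_of_chains [Finite X] [Nonempty X] (hΔ : ∀ k i, 0 < Δ k i)
    (hα : α.IsTrivalent) (hβ : β.IsTrivalent) (ho : IsOrder vert κ) (ho' : IsOrder vert' κ)
    {q} (ha : IsChainOver Δ vert κ a q) (hb : IsChainOver Δ vert' κ b q) :
    ∃ (onV : α.V ≃ β.V) (onE : α.E ≃ β.E),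
      (∀ e, β.src (onE e) = onV (α.src e)) ∧ (∀ e, β.tgt (onE e) = onV (α.tgt e)) ∧
      (∀ e, β.weight (onE e) = α.weight e) ∧ (∀ v, β.genus (onV v) = α.genus v) ∧
      (∀ j, vert' j = onV (vert j)) ∧ (∀ k i, β.ends k i = onV (α.ends k i)) ∧
      (∀ v, β.cell (onV v) = α.cell v) ∧
      ∀ j k x, (b j).2 k x = strandMap onE ((a j).2 k x) := by
  have hperm : ∀ j, (b j).1 = (a j).1 := fun j => (hb.perm j).trans (ha.perm j).symm
  have hac : ∀ x, α.cell (start ((a 0).2 0 x)) = none := fun x =>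
    front_zero ho (ha.chain.first.marked.mem 0 x)
  have hbc : ∀ x, β.cell (start ((b 0).2 0 x)) = none := fun x =>
    front_zero ho' (hb.chain.first.marked.mem 0 x)
  -- the vertices are orbits of the first triple and steps
  obtain ⟨onV, honV⟩ := exists_equiv_of_ker
    (f := (Sum.elim (fun x => start ((a 0).2 0 x)) vert : X ⊕ Fin r → α.V))
    (h := (Sum.elim (fun x => start ((b 0).2 0 x)) vert' : X ⊕ Fin r → β.V)) (by
      intro v
      by_cases hv : α.cell v = none
      · obtain ⟨x, hx⟩ := ha.chain.exists_base hΔ ho hv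
        exact ⟨Sum.inl x, hx⟩
      · obtain ⟨j, hj⟩ := ho.surj v hv
        exact ⟨Sum.inr j, hj⟩) (by
      intro v
      by_cases hv : β.cell v = none
      · obtain ⟨x, hx⟩ := hb.chain.exists_base hΔ ho' hv
        exact ⟨Sum.inl x, hx⟩
      · obtain ⟨j, hj⟩ := ho'.surj v hv
        exact ⟨Sum.inr j, hj⟩) (by
      rintro (x | i) (y | j)
      · show start ((a 0).2 0 x) = start ((a 0).2 0 y) ↔ start ((b 0).2 0 x) = start ((b 0).2 0 y)
        rw [ha.chain.start_eq_iff, hb.chain.start_eq_iff, hperm]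
      · constructor
        · intro h
          have := hac x
          rw [show start ((a 0).2 0 x) = vert j from h, ho.cell_vert] at this
          cases this
        · intro h
          have := hbc x
          rw [show start ((b 0).2 0 x) = vert' j from h, ho'.cell_vert] at this
          cases this
      · constructor
        · intro h
          have := hac y
          rw [show start ((a 0).2 0 y) = vert i from h.symm, ho.cell_vert] at this
          cases this
        · intro h
          have := hbc y
          rw [show start ((b 0).2 0 y) = vert' i from h.symm, ho'.cell_vert] at this
          cases this
      · exact ⟨fun h => congrArg vert' (ho.inj h), fun h => congrArg vert (ho'.inj h)⟩)
  have honc : ∀ x, onV (start ((a 0).2 0 x)) = start ((b 0).2 0 x) := fun x => honV (Sum.inl x)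
  have honv : ∀ j, onV (vert j) = vert' j := fun j => honV (Sum.inr j)
  have hcell : ∀ v, β.cell (onV v) = α.cell v := by
    intro v
    by_cases hv : α.cell v = none
    · obtain ⟨x, rfl⟩ := ha.chain.exists_base hΔ ho hv
      rw [honc, hbc, hv]
    · obtain ⟨j, rfl⟩ := ho.surj v hv
      rw [honv, ho'.cell_vert, ho.cell_vert]
  -- the bounded edges are classes of touched points
  set T := {t : Fin r × X // Touched ((a t.1.castSucc).1 (κ t.1)) ((a t.1.succ).1 (κ t.1)) t.2}
  choose eA heA heA' using fun t : T => ha.chain.exists_edge t.2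
  choose eB heB heB' using fun t : T => hb.chain.exists_edge (x := t.1.2) (by
    rw [hperm, hperm]; exact t.2)
  obtain ⟨onE, honE⟩ := exists_equiv_of_ker (f := eA) (h := eB) (by
      intro e
      obtain ⟨j, x, -, h1, h2⟩ := ha.chain.exists_touched hΔ ho e
      exact ⟨⟨(j, x), h1⟩, Sum.inl.inj ((heA ⟨(j, x), h1⟩).symm.trans h2)⟩) (by
      intro e
      obtain ⟨j, x, -, h1, h2⟩ := hb.chain.exists_touched hΔ ho' e
      rw [hperm, hperm] at h1
      exact ⟨⟨(j, x), h1⟩, Sum.inl.inj ((heB ⟨(j, x), h1⟩).symm.trans h2)⟩) (by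
      rintro ⟨⟨j, x⟩, h⟩ ⟨⟨j', x'⟩, h'⟩
      constructor
      · intro e
        have hj : j = j' := ho.inj ((heA' ⟨(j, x), h⟩).symm.trans
          ((congrArg α.tgt e).trans (heA' ⟨(j', x'), h'⟩)))
        subst hj
        have h1 : (a j.castSucc).2 (κ j) x = (a j.castSucc).2 (κ j) x' :=
          (heA ⟨(j, x), h⟩).trans ((congrArg Sum.inl e).trans (heA ⟨(j, x'), h'⟩).symm)
        rw [(ha.chain.marked j.castSucc).fibre, ← hperm, ← (hb.chain.marked j.castSucc).fibre] at h1
        exact Sum.inl.inj ((heB ⟨(j, x), h⟩).symm.trans (h1.trans (heB ⟨(j, x'), h'⟩)))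
      · intro e
        have hj : j = j' := ho'.inj ((heB' ⟨(j, x), h⟩).symm.trans
          ((congrArg β.tgt e).trans (heB' ⟨(j', x'), h'⟩)))
        subst hj
        have h1 : (b j.castSucc).2 (κ j) x = (b j.castSucc).2 (κ j) x' :=
          (heB ⟨(j, x), h⟩).trans ((congrArg Sum.inl e).trans (heB ⟨(j, x'), h'⟩).symm)
        rw [(hb.chain.marked j.castSucc).fibre, hperm, ← (ha.chain.marked j.castSucc).fibre] at h1
        exact Sum.inl.inj ((heA ⟨(j, x), h⟩).symm.trans (h1.trans (heA ⟨(j, x'), h'⟩))))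
  have hsurj : ∀ e, ∃ t, eA t = e := by
    intro e
    obtain ⟨j, x, -, h1, h2⟩ := ha.chain.exists_touched hΔ ho e
    exact ⟨⟨(j, x), h1⟩, Sum.inl.inj ((heA ⟨(j, x), h1⟩).symm.trans h2)⟩
  -- the markings agree at the ends, and hence at all fronts, going inwards
  have hmark : ∀ j k x, (b j).2 k x = strandMap onE ((a j).2 k x) := by
    intro j
    induction j using Fin.reverseInduction with
    | last => intro k x; rw [ha.mark, hb.mark]; rfl
    | cast j ih =>
      intro k x
      by_cases h : k = κ j ∧ Touched ((a j.castSucc).1 (κ j)) ((a j.succ).1 (κ j)) x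
      · obtain ⟨rfl, h⟩ := h
        rw [heA ⟨(j, x), h⟩, heB ⟨(j, x), h⟩, ← honE]
        rfl
      · rw [← ha.chain.mark_succ_of_not h, ← hb.chain.mark_succ_of_not (j := j) (by
          rw [hperm, hperm]; exact h)]
        exact ih k x
  -- the initial vertices agree next to the center, and hence at all fronts, going outwards
  have hstart : ∀ j k x, start ((b j).2 k x) = onV (start ((a j).2 k x)) := by
    intro j
    induction j using Fin.induction with
    | zero =>
      intro k x
      rw [hb.chain.first.base, ha.chain.first.base, honc]
    | succ j ih =>
      intro k x
      by_cases h : k = κ j ∧ Touched ((a j.castSucc).1 (κ j)) ((a j.succ).1 (κ j)) x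
      · obtain ⟨rfl, h⟩ := h
        rw [ha.chain.start_succ h, hb.chain.start_succ (by rw [hperm, hperm]; exact h), honv]
      · rw [ha.chain.mark_succ_of_not h, hb.chain.mark_succ_of_not (j := j) (by
          rw [hperm, hperm]; exact h)]
        exact ih k x
  have hsrc : ∀ e, β.src (onE e) = onV (α.src e) := by
    intro e
    obtain ⟨t, rfl⟩ := hsurj e
    have := hstart t.1.1.castSucc (κ t.1.1) t.1.2
    rw [heA, heB] at this
    rw [honE]
    exact this
  have htgt : ∀ e, β.tgt (onE e) = onV (α.tgt e) := by
    intro e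
    obtain ⟨t, rfl⟩ := hsurj e
    rw [honE, heA', heB', honv]
  have hends : ∀ k i, β.ends k i = onV (α.ends k i) := by
    intro k i
    have h : Front vert (Fin.last r : Fin (r + 1)) k (Sum.inr ⟨k, i⟩ : Strand α.toCoverGraph) :=
      ⟨rfl, fun i _ => i.2, fun _ h => by cases h⟩
    obtain ⟨x, hx⟩ := (ha.chain.marked (Fin.last r)).exists_mark hΔ h
    have h1 := hstart (Fin.last r) k x
    have h2 := hmark (Fin.last r) k x
    rw [hx] at h1 h2
    rw [h2] at h1
    exact h1
  refine ⟨onV, onE, hsrc, htgt, ?_, ?_, fun j => (honv j).symm, hends, hcell, hmark⟩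
  · intro e
    obtain ⟨⟨⟨j, x⟩, ht⟩, rfl⟩ := hsurj e
    have h1 := (ha.chain.marked j.castSucc).size (κ j) _
      ((ha.chain.marked j.castSucc).mem (κ j) x)
    have h2 := (hb.chain.marked j.castSucc).size (κ j) _
      ((hb.chain.marked j.castSucc).mem (κ j) x)
    have h3 : Nat.card {y // (a j.castSucc).2 (κ j) y = (a j.castSucc).2 (κ j) x}
        = Nat.card {y // (b j.castSucc).2 (κ j) y = (b j.castSucc).2 (κ j) x} :=
      Nat.card_congr (Equiv.subtypeEquivRight fun y => by
        rw [(ha.chain.marked j.castSucc).fibre, (hb.chain.marked j.castSucc).fibre, hperm])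
    rw [h1, h2, heA ⟨(j, x), ht⟩, heB ⟨(j, x), ht⟩] at h3
    rw [honE]
    exact h3.symm
  · intro v
    by_cases hv : α.cell v = none
    · have h1 := riemannHurwitz_center hα hv
      have h2 := riemannHurwitz_center hβ ((hcell v).trans hv)
      rw [← Finset.sum_congr rfl fun k _ => card_out_eq onV onE hsrc htgt hcell hends v k,
        hb.chain.localDegree_eq ho' ((hcell v).trans hv)] at h2
      rw [ha.chain.localDegree_eq ho hv] at h1
      have h3 : Nat.card {x // start ((b 0).2 0 x) = onV v}
          = Nat.card {x // start ((a 0).2 0 x) = v} :=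
        Nat.card_congr (Equiv.subtypeEquivRight fun x => by
          rw [← honc, onV.injective.eq_iff])
      omega
    · rw [((hα v).2 hv).2, ((hβ _).2 (by rw [hcell]; exact hv)).2]

end Unique

/-! ### Chains and isomorphisms of covers -/

section Labels

variable {g r : ℕ} {n : Fin 3 → ℕ} {Δ : ∀ k, Fin (n k) → ℕ} {α : CoverType g r Δ}

/-- A trivalent vertex outside the center carries exactly one label. -/
theorem card_label_ray (hα : α.IsTrivalent) {v : α.V} (hv : α.cell v ≠ none) :
    Fintype.card {i // α.label i = v} = 1 := by
  have h := α.card_label v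
  rw [CoverGraph.rhNumber, CoverGraph.targetVal, if_neg hv, ((hα v).2 hv).1, ((hα v).2 hv).2] at h
  push_cast at h
  omega

theorem cell_label (hα : α.IsTrivalent) (i : Fin r) : α.cell (α.label i) ≠ none := by
  intro hv
  have h := α.card_label (α.label i)
  rw [(hα _).1 hv] at h
  have : 0 < Fintype.card {i' // α.label i' = α.label i} := Fintype.card_pos_iff.2 ⟨⟨i, rfl⟩⟩
  omega

theorem label_injective (hα : α.IsTrivalent) : Function.Injective α.label := by
  intro i j h
  obtain ⟨l, hl⟩ := Fintype.card_eq_one_iff.1 (card_label_ray hα (cell_label hα j))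
  exact (congrArg Subtype.val (hl ⟨i, h⟩)).trans (congrArg Subtype.val (hl ⟨j, rfl⟩)).symm

theorem exists_label (hα : α.IsTrivalent) {v : α.V} (hv : α.cell v ≠ none) :
    ∃ i, α.label i = v := by
  obtain ⟨⟨l, hl⟩, -⟩ := Fintype.card_eq_one_iff.1 (card_label_ray hα hv)
  exact ⟨l, hl⟩

end Labels

section Transport

variable {g r : ℕ} {n : Fin 3 → ℕ} {Δ : ∀ k, Fin (n k) → ℕ} {X : Type}
  {C D : TropCover g r Δ}

theorem Iso.cell_eq (f : TropCover.Iso C D) (v : C.V) : D.cell (f.onV v) = C.cell v := by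
  rw [← D.pos_cell, f.pos_eq, C.pos_cell]

theorem start_strandMap (f : TropCover.Iso C D) (e : Strand C.toCoverGraph) :
    start (strandMap f.onE e : Strand D.toCoverGraph) = f.onV (start e) := by
  rcases e with e | e
  · exact f.src_eq e
  · exact f.ends_eq _ _

theorem finish_strandMap (f : TropCover.Iso C D) (e : Strand C.toCoverGraph) (v : C.V) :
    finish (strandMap f.onE e : Strand D.toCoverGraph) = some (f.onV v) ↔ finish e = some v := by
  rcases e with e | e
  · show some (D.tgt (f.onE e)) = some (f.onV v) ↔ some (C.tgt e) = some v
    rw [f.tgt_eq, Option.some_inj, Option.some_inj, f.onV.injective.eq_iff]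
  · show none = some _ ↔ none = some _
    simp

theorem dir_strandMap (f : TropCover.Iso C D) (e : Strand C.toCoverGraph) :
    dir (strandMap f.onE e : Strand D.toCoverGraph) = dir e := by
  rcases e with e | e
  · show D.cell (D.tgt (f.onE e)) = C.cell (C.tgt e)
    rw [f.tgt_eq, Iso.cell_eq]
  · rfl

theorem wt_strandMap (f : TropCover.Iso C D) (e : Strand C.toCoverGraph) :
    wt Δ (strandMap f.onE e : Strand D.toCoverGraph) = wt Δ e := by
  rcases e with e | e
  · exact f.weight_eq e
  · rfl

theorem strandMap_injective (f : TropCover.Iso C D) :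
    Function.Injective (strandMap f.onE : Strand C.toCoverGraph → Strand D.toCoverGraph) :=
  Function.Injective.sumMap f.onE.injective Function.injective_id

theorem strandMap_surjective (f : TropCover.Iso C D) :
    Function.Surjective (strandMap f.onE : Strand C.toCoverGraph → Strand D.toCoverGraph) :=
  Function.Surjective.sumMap f.onE.surjective Function.surjective_id

variable {vert : Fin r → C.V} {κ : Fin r → Fin 3}

theorem front_strandMap (f : TropCover.Iso C D) {j : ℕ} {k : Fin 3} {e : Strand C.toCoverGraph} :
    Front (f.onV ∘ vert) j k (strandMap f.onE e : Strand D.toCoverGraph) ↔ Front vert j k e := by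
  constructor
  · intro h
    refine ⟨(dir_strandMap f e).symm.trans h.dir_eq, fun i hi => h.born i ?_,
      fun i hi => h.alive i ((finish_strandMap f e _).2 hi)⟩
    rw [start_strandMap, hi]
    rfl
  · intro h
    refine ⟨(dir_strandMap f e).trans h.dir_eq, fun i hi => h.born i ?_,
      fun i hi => h.alive i ((finish_strandMap f e _).1 hi)⟩
    rw [start_strandMap] at hi
    exact f.onV.injective hi

/-- The image of a chain under an isomorphism of covers. -/
def mapChain (f : TropCover.Iso C D) (a : Fin (r + 1) → State C.toCoverGraph X) :
    Fin (r + 1) → State D.toCoverGraph X :=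
  fun j => ((a j).1, fun k x => strandMap f.onE ((a j).2 k x))

theorem card_strandMap (f : TropCover.Iso C D) (m : X → Strand C.toCoverGraph)
    (e : Strand C.toCoverGraph) : Nat.card {x // strandMap f.onE (m x) = strandMap f.onE e}
      = Nat.card {x // m x = e} :=
  Nat.card_congr (Equiv.subtypeEquivRight fun _ => (strandMap_injective f).eq_iff)

theorem IsMarked.map (f : TropCover.Iso C D) {j : ℕ} {p : Fin 3 → Perm X}
    {m : Fin 3 → X → Strand C.toCoverGraph} (hm : IsMarked Δ vert j p m) :
    IsMarked Δ (f.onV ∘ vert) j p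
      (fun k x => (strandMap f.onE (m k x) : Strand D.toCoverGraph)) where
  mem k x := (front_strandMap f).2 (hm.mem k x)
  fibre k x y := (strandMap_injective f).eq_iff.trans (hm.fibre k x y)
  size k e he := by
    obtain ⟨e, rfl⟩ := strandMap_surjective f e
    rw [card_strandMap, wt_strandMap]
    exact hm.size k e ((front_strandMap f).1 he)

/-- Chains are transported along isomorphisms of covers. -/
theorem IsChain.map (f : TropCover.Iso C D) {a : Fin (r + 1) → State C.toCoverGraph X}
    (ha : IsChain Δ vert κ a) : IsChain Δ (f.onV ∘ vert) κ (mapChain f a) where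
  first :=
    { marked := ha.first.marked.map f
      prod := ha.first.prod
      base := fun k x =>
        (start_strandMap f _).trans ((congrArg f.onV (ha.first.base k x)).trans
          (start_strandMap f _).symm)
      trans := fun S hS x y h => ha.first.trans S hS x y (by
        have h : start (strandMap f.onE ((a 0).2 0 x) : Strand D.toCoverGraph)
          = start (strandMap f.onE ((a 0).2 0 y) : Strand D.toCoverGraph) := h
        rw [start_strandMap, start_strandMap] at h
        exact f.onV.injective h) }
  step j := by
    have h := ha.step j
    have hin : ∀ e : Strand C.toCoverGraph, (strandMap f.onE e : Strand D.toCoverGraph) ∈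
        inStrands (f.onV (vert j)) ↔ e ∈ inStrands (vert j) := fun e => by
      rw [mem_inStrands, mem_inStrands, finish_strandMap]
    have hout : ∀ e : Strand C.toCoverGraph, (strandMap f.onE e : Strand D.toCoverGraph) ∈
        outStrands (f.onV (vert j)) ↔ e ∈ outStrands (vert j) := fun e => by
      rw [mem_outStrands, mem_outStrands, start_strandMap, f.onV.injective.eq_iff]
    exact
      { marked := h.marked.map f
        perm := h.perm
        mark := fun k hk => funext fun x => congrArg (strandMap f.onE) (congrFun (h.mark k hk) x)
        step :=
          { swap := h.step.swap
            touched := fun x => (hin _).trans (h.step.touched x)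
            keep := fun x hx => congrArg (strandMap f.onE)
              (h.step.keep x fun hx' => hx ((hin _).2 hx'))
            out := fun x hx => (hout _).2 (h.step.out x ((hin _).1 hx))
            fibre := fun x y => (strandMap_injective f).eq_iff.trans (h.step.fibre x y)
            size := fun e he => by
              obtain ⟨e, rfl⟩ := strandMap_surjective f e
              rw [wt_strandMap, ← h.step.size e ((hout _).1 he)]
              exact card_strandMap f _ e } }

theorem IsChainOver.map (f : TropCover.Iso C D) {a : Fin (r + 1) → State C.toCoverGraph X} {q}
    (ha : IsChainOver Δ vert κ a q) : IsChainOver Δ (f.onV ∘ vert) κ (mapChain f a) q where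
  chain := ha.chain.map f
  perm := ha.perm
  mark k x := congrArg (strandMap f.onE) (ha.mark k x)

/-- An isomorphism is determined by its effect on a chain. -/
theorem Iso.ext_of_mapChain [Finite X] [Nonempty X] (hΔ : ∀ k i, 0 < Δ k i) (ho : IsOrder vert κ)
    {a : Fin (r + 1) → State C.toCoverGraph X} (ha : IsChain Δ vert κ a) {f h : TropCover.Iso C D}
    (hfv : ∀ j, f.onV (vert j) = h.onV (vert j)) (hfh : mapChain f a = mapChain h a) : f = h := by
  have hm : ∀ j k x, (strandMap f.onE ((a j).2 k x) : Strand D.toCoverGraph)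
      = strandMap h.onE ((a j).2 k x) := fun j k x =>
    congrFun (congrFun (congrArg Prod.snd (congrFun hfh j)) k) x
  have hE : f.onE = h.onE := by
    ext e
    obtain ⟨j, x, -, -, hx⟩ := ha.exists_touched hΔ ho e
    have := hm j.castSucc (κ j) x
    rw [hx] at this
    exact Sum.inl.inj this
  have hV : f.onV = h.onV := by
    ext v
    by_cases hv : C.cell v = none
    · obtain ⟨x, rfl⟩ := ha.exists_base hΔ ho hv
      rw [← start_strandMap, ← start_strandMap, hm]
    · obtain ⟨j, rfl⟩ := ho.surj v hv
      exact hfv j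
  cases f
  cases h
  cases hE
  cases hV
  rfl

end Transport

section Cover

variable {g r : ℕ} {n : Fin 3 → ℕ} {Δ : ∀ k, Fin (n k) → ℕ} {X : Type}
  {C D : TropCover g r Δ} {P : Fin r → TropLine} {π : Perm (Fin r)} {κ : Fin r → Fin 3}

/-- The permutation `π` lists the components of a point of `𝓛^r` by their distance from the center,
and `κ` is the list of their rays. -/
structure IsSorted (P : Fin r → TropLine) (π : Perm (Fin r)) (κ : Fin r → Fin 3) : Prop where
  cell : ∀ j, (P (π j)).cell = some (κ j)
  mono : Monotone fun j => (P (π j)).height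

theorem exists_isSorted (hP : ∀ i, P i ≠ TropLine.center) : ∃ π κ, IsSorted P π κ := by
  have h : ∀ i, ∃ k, (P i).cell = some k := by
    intro i
    rcases hi : P i with _ | ⟨k, t, ht⟩
    · exact absurd hi (hP i)
    · exact ⟨k, rfl⟩
  choose c hc using h
  exact ⟨Tuple.sort fun i => (P i).height, fun j => c (Tuple.sort (fun i => (P i).height) j),
    fun j => hc _, Tuple.monotone_sort fun i => (P i).height⟩

/-- The labelled vertices of a cover in a given order. -/
abbrev labelled (α : CoverGraph r n) (π : Perm (Fin r)) : Fin r → α.V := fun j => α.label (π j)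

/-- The vertices of a trivalent cover are ordered by their distance from the center. -/
theorem isOrder_labelled (hC : C.IsTrivalent) (hP : ∀ i, C.pos (C.label i) = P i)
    (hs : IsSorted P π κ) : IsOrder (labelled C.toCoverGraph π) κ where
  cell_vert j := by rw [← hs.cell, ← hP, C.pos_cell]
  inj := (label_injective hC).comp π.injective
  surj v hv := by
    obtain ⟨i, hi⟩ := exists_label hC hv
    exact ⟨π.symm i, by rw [labelled, Equiv.apply_symm_apply, hi]⟩
  lt e i j hi hj := by
    by_contra h
    have h1 := hs.mono (not_lt.1 h)
    have h2 := C.pos_edge e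
    rw [hi, hj, hP, hP] at h2
    have h3 : 0 < (C.weight e : ℝ) * C.len e :=
      mul_pos (Nat.cast_pos.2 (C.weight_pos e)) (C.len_pos e)
    dsimp only at h1
    linarith

theorem eq_center_of_cell {p : TropLine} (h : p.cell = none) : p = TropLine.center := by
  cases p
  · rfl
  · cases h

/-- The positions of the vertices and the lengths of the edges of a trivalent cover are determined
by its type and by the positions of the labelled vertices. -/
theorem Iso.exists_of_graph (hC : C.IsTrivalent) (hCP : ∀ i, C.pos (C.label i) = P i)
    (hDP : ∀ i, D.pos (D.label i) = P i) (onV : C.V ≃ D.V) (onE : C.E ≃ D.E)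
    (hsrc : ∀ e, D.src (onE e) = onV (C.src e)) (htgt : ∀ e, D.tgt (onE e) = onV (C.tgt e))
    (hw : ∀ e, D.weight (onE e) = C.weight e) (hg : ∀ v, D.genus (onV v) = C.genus v)
    (hlabel : ∀ i, D.label i = onV (C.label i)) (hends : ∀ k i, D.ends k i = onV (C.ends k i))
    (hcell : ∀ v, D.cell (onV v) = C.cell v) : ∃ f : TropCover.Iso C D, f.onE = onE := by
  have hpos : ∀ v, D.pos (onV v) = C.pos v := by
    intro v
    by_cases h : C.cell v = none
    · rw [eq_center_of_cell ((D.pos_cell _).trans ((hcell v).trans h)),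
        eq_center_of_cell ((C.pos_cell v).trans h)]
    · obtain ⟨i, rfl⟩ := exists_label hC h
      rw [← hlabel, hDP, hCP]
  refine ⟨⟨onV, onE, hsrc, htgt, fun e => ?_, hw, hg, hlabel, hends, hpos⟩, rfl⟩
  have h1 := C.pos_edge e
  have h2 := D.pos_edge (onE e)
  rw [htgt, hsrc, hpos, hpos, hw, h1] at h2
  have h3 : (C.weight e : ℝ) ≠ 0 := Nat.cast_ne_zero.2 (C.weight_pos e).ne'
  exact (mul_left_cancel₀ h3 (add_left_cancel h2)).symm

/-- Covers over the same point with chains over the same path are isomorphic. -/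
theorem Iso.exists_of_chains [Finite X] [Nonempty X] (hΔ : ∀ k i, 0 < Δ k i)
    (hC : C.IsTrivalent) (hD : D.IsTrivalent) (hCP : ∀ i, C.pos (C.label i) = P i)
    (hDP : ∀ i, D.pos (D.label i) = P i) (hs : IsSorted P π κ)
    {a : Fin (r + 1) → State C.toCoverGraph X} {b : Fin (r + 1) → State D.toCoverGraph X} {q}
    (ha : IsChainOver Δ (labelled C.toCoverGraph π) κ a q)
    (hb : IsChainOver Δ (labelled D.toCoverGraph π) κ b q) :
    ∃ f : TropCover.Iso C D, mapChain f a = b := by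
  obtain ⟨onV, onE, hsrc, htgt, hw, hg, hv, hends, hcell, hmark⟩ :=
    exists_iso_of_chains hΔ hC hD (isOrder_labelled hC hCP hs) (isOrder_labelled hD hDP hs) ha hb
  obtain ⟨f, rfl⟩ := Iso.exists_of_graph hC hCP hDP onV onE hsrc htgt hw hg (fun i => by
    have := hv (π.symm i)
    simpa [labelled] using this) hends hcell
  refine ⟨f, funext fun j => Prod.ext ((ha.perm j).trans (hb.perm j).symm) ?_⟩
  funext k x
  exact (hmark j k x).symm

/-- The chains over a path form a torsor under the automorphisms of the cover. -/
theorem card_chains_over [Finite X] [Nonempty X] (hΔ : ∀ k i, 0 < Δ k i)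
    (hC : C.IsTrivalent) (hCP : ∀ i, C.pos (C.label i) = P i) (hs : IsSorted P π κ)
    {a : Fin (r + 1) → State C.toCoverGraph X} {q}
    (ha : IsChainOver Δ (labelled C.toCoverGraph π) κ a q) :
    Nat.card {b : Fin (r + 1) → State C.toCoverGraph X //
      IsChainOver Δ (labelled C.toCoverGraph π) κ b q} = Nat.card (TropCover.Iso C C) := by
  have hv : ∀ f : TropCover.Iso C C,
      f.onV ∘ labelled C.toCoverGraph π = labelled C.toCoverGraph π :=
    fun f => funext fun j => (f.label_eq (π j)).symm
  refine (Nat.card_eq_of_bijective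
    (fun f : TropCover.Iso C C => (⟨mapChain f a, by have := ha.map f; rwa [hv f] at this⟩ :
      {b : Fin (r + 1) → State C.toCoverGraph X //
        IsChainOver Δ (labelled C.toCoverGraph π) κ b q})) ⟨?_, ?_⟩).symm
  · intro f h hfh
    exact Iso.ext_of_mapChain hΔ (isOrder_labelled hC hCP hs) ha.chain
      (fun j => (congrFun (hv f) j).trans (congrFun (hv h) j).symm) (congrArg Subtype.val hfh)
  · rintro ⟨b, hb⟩
    obtain ⟨f, hf⟩ := Iso.exists_of_chains hΔ hC hC hCP hCP hs ha hb
    exact ⟨f, Subtype.ext hf⟩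

/-- The number of chains of a cover is the number of paths that carry one, times the number of
automorphisms. -/
theorem card_isChain_eq [Finite X] [Nonempty X] (hΔ : ∀ k i, 0 < Δ k i)
    (hC : C.IsTrivalent) (hCP : ∀ i, C.pos (C.label i) = P i) (hs : IsSorted P π κ) :
    Nat.card {a : Fin (r + 1) → State C.toCoverGraph X //
        IsChain Δ (labelled C.toCoverGraph π) κ a}
      = Nat.card {q : (Fin (r + 1) → Fin 3 → Perm X) × (∀ k, X → Fin (n k)) //
        ∃ a, IsChainOver Δ (labelled C.toCoverGraph π) κ a q} * Nat.card (TropCover.Iso C C) := by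
  have ho := isOrder_labelled hC hCP hs
  set Im := {q : (Fin (r + 1) → Fin 3 → Perm X) × (∀ k, X → Fin (n k)) //
    ∃ a, IsChainOver Δ (labelled C.toCoverGraph π) κ a q}
  choose F hF using fun a : {a : Fin (r + 1) → State C.toCoverGraph X //
    IsChain Δ (labelled C.toCoverGraph π) κ a} => a.2.exists_over ho
  let F' : {a : Fin (r + 1) → State C.toCoverGraph X //
    IsChain Δ (labelled C.toCoverGraph π) κ a} → Im := fun a => ⟨F a, a.1, hF a⟩
  have hfin : Finite Im := Subtype.finite
  have hfin' : Finite {a : Fin (r + 1) → State C.toCoverGraph X //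
    IsChain Δ (labelled C.toCoverGraph π) κ a} := Subtype.finite
  have := Fintype.ofFinite Im
  rw [Nat.card_congr (Equiv.sigmaFiberEquiv F').symm, Nat.card_sigma,
    Finset.sum_congr rfl (g := fun _ => Nat.card (TropCover.Iso C C)), Finset.sum_const,
    smul_eq_mul, Finset.card_univ, ← Nat.card_eq_fintype_card (α := Im)]
  rintro ⟨q, a, ha⟩ -
  rw [← card_chains_over hΔ hC hCP hs ha]
  refine Nat.card_congr ⟨fun b => ⟨b.1.1, ?_⟩, fun b => ⟨⟨b.1, b.2.chain⟩, ?_⟩, ?_, ?_⟩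
  · have h1 : F b.1 = q := congrArg Subtype.val b.2
    have h2 := hF b.1
    rwa [h1] at h2
  · exact Subtype.ext ((hF _).eq_of b.2)
  · rintro ⟨⟨b, hb⟩, hb'⟩; rfl
  · rintro ⟨b, hb⟩; rfl

end Cover

/-! ### The graph of a path of permutations -/

section PathGraph

variable {r : ℕ} {n : Fin 3 → ℕ} {Δ : ∀ k, Fin (n k) → ℕ} {X : Type}
  {κ : Fin r → Fin 3} {s : Fin (r + 1) → Fin 3 → Perm X} {mark : ∀ k, X → Fin (n k)}

/-- The point `x` is touched in the `j`-th step of the path `s`. -/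
abbrev TouchedAt (κ : Fin r → Fin 3) (s : Fin (r + 1) → Fin 3 → Perm X) (j : Fin r) (x : X) :
    Prop :=
  Touched (s j.castSucc (κ j)) (s j.succ (κ j)) x

/-- The relation of lying in the same orbit of a triple of permutations. -/
def orbitSetoid (p : Fin 3 → Perm X) : Setoid X where
  r x y := ∀ S : X → Prop, (∀ k z, S (p k z) ↔ S z) → (S x ↔ S y)
  iseqv :=
    ⟨fun _ _ _ => Iff.rfl, fun h S hS => (h S hS).symm,
      fun h h' S hS => (h S hS).trans (h' S hS)⟩

/-- The orbits of a triple of permutations. -/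
abbrev Orbit (p : Fin 3 → Perm X) : Type := Quotient (orbitSetoid p)

/-- The orbit of a point. -/
abbrev orbitMk (p : Fin 3 → Perm X) (x : X) : Orbit p := Quotient.mk (orbitSetoid p) x

theorem orbitMk_apply (p : Fin 3 → Perm X) (k : Fin 3) (x : X) : orbitMk p (p k x) = orbitMk p x :=
  Quotient.sound (s := orbitSetoid p) fun _ hS => hS k x

theorem orbitMk_eq_of_sameCycle [Finite X] {p : Fin 3 → Perm X} {k : Fin 3} {x y : X}
    (h : (p k).SameCycle x y) : orbitMk p x = orbitMk p y :=
  (mem_of_sameCycle (S := {z | orbitMk p z = orbitMk p x})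
    (fun z (hz : orbitMk p z = orbitMk p x) => (orbitMk_apply p k z).trans hz) rfl h).symm

/-- Pairs of a step of the path and a cycle touched in that step. -/
def touchedSetoid (κ : Fin r → Fin 3) (s : Fin (r + 1) → Fin 3 → Perm X) :
    Setoid {t : Fin r × X // TouchedAt κ s t.1 t.2} where
  r t u := t.1.1 = u.1.1 ∧ (s t.1.1.castSucc (κ t.1.1)).SameCycle t.1.2 u.1.2
  iseqv := ⟨fun _ => ⟨rfl, SameCycle.refl _ _⟩, by
    rintro ⟨⟨i, x⟩, hx⟩ ⟨⟨j, y⟩, hy⟩ ⟨rfl, h⟩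
    exact ⟨rfl, h.symm⟩, by
    rintro ⟨⟨i, x⟩, hx⟩ ⟨⟨j, y⟩, hy⟩ ⟨⟨l, z⟩, hz⟩ ⟨rfl, h⟩ ⟨rfl, h'⟩
    exact ⟨rfl, h.trans h'⟩⟩

/-- The vertices of the graph of a path: the orbits of the first triple, and the steps. -/
abbrev PathV (s : Fin (r + 1) → Fin 3 → Perm X) : Type := Orbit (s 0) ⊕ Fin r

/-- The bounded edges of the graph of a path: the cycles that are touched in some step. -/
abbrev PathE (κ : Fin r → Fin 3) (s : Fin (r + 1) → Fin 3 → Perm X) : Type :=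
  Quotient (touchedSetoid κ s)

/-- The edge of a touched point. -/
abbrev edgeMk {j : Fin r} {x : X} (h : TouchedAt κ s j x) : PathE κ s :=
  Quotient.mk (touchedSetoid κ s) ⟨(j, x), h⟩

theorem edgeMk_eq {i j : Fin r} {x y : X} {h : TouchedAt κ s i x} {h' : TouchedAt κ s j y} :
    edgeMk h = edgeMk h' ↔ i = j ∧ (s i.castSucc (κ i)).SameCycle x y :=
  Quotient.eq (r := touchedSetoid κ s)

theorem exists_edgeMk (e : PathE κ s) : ∃ (j : Fin r) (x : X) (h : TouchedAt κ s j x),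
    e = edgeMk h := by
  induction e using Quotient.inductionOn with
  | h t => exact ⟨t.1.1, t.1.2, t.2, rfl⟩

/-- The vertex at which the cycle of `x` under the `k`-th permutation of the `j`-th triple was
created. -/
def owner (κ : Fin r → Fin 3) (s : Fin (r + 1) → Fin 3 → Perm X) (j : Fin (r + 1)) :
    Fin 3 → X → PathV s :=
  Fin.induction (motive := fun _ => Fin 3 → X → PathV s) (fun _ x => Sum.inl (orbitMk (s 0) x))
    (fun j o k x => if k = κ j ∧ TouchedAt κ s j x then Sum.inr j else o k x) j

theorem owner_zero (k : Fin 3) (x : X) : owner κ s 0 k x = Sum.inl (orbitMk (s 0) x) := rfl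

theorem owner_succ (j : Fin r) (k : Fin 3) (x : X) : owner κ s j.succ k x
    = if k = κ j ∧ TouchedAt κ s j x then Sum.inr j else owner κ s j.castSucc k x := by
  rw [owner, Fin.induction_succ]
  rfl

theorem IsPath.owner_eq [Finite X] (hq : IsPath Δ κ s mark) (j : Fin (r + 1)) :
    ∀ {k : Fin 3} {x y : X}, (s j k).SameCycle x y → owner κ s j k x = owner κ s j k y := by
  induction j using Fin.induction with
  | zero =>
    intro k x y h
    rw [owner_zero, owner_zero, orbitMk_eq_of_sameCycle h]
  | succ j ih =>
    intro k x y h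
    rw [owner_succ, owner_succ]
    by_cases hk : k = κ j
    · subst hk
      by_cases hx : TouchedAt κ s j x
      · rw [if_pos ⟨rfl, hx⟩, if_pos ⟨rfl, (touched_congr_right h).1 hx⟩]
      · rw [if_neg fun h => hx h.2, if_neg fun h' => hx ((touched_congr_right h).2 h'.2)]
        exact ih ((sameCycle_iff_of_not_touched hx).2 h)
    · rw [if_neg fun h => hk h.1, if_neg fun h => hk h.1]
      exact ih (by rwa [hq.keep j k hk] at h)

theorem owner_lt (j : Fin (r + 1)) : ∀ {k : Fin 3} {x : X} {i : Fin r},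
    owner κ s j k x = Sum.inr i → (i : ℕ) < j := by
  induction j using Fin.induction with
  | zero => intro k x i h; cases h
  | succ j ih =>
    intro k x i h
    rw [owner_succ] at h
    split_ifs at h
    · rw [← Sum.inr.inj h]
      exact Nat.lt_succ_self _
    · exact Nat.lt_succ_of_lt (ih h)

/-- The cell of `𝓛` over which a vertex of the graph of a path lies. -/
def pathCell (κ : Fin r → Fin 3) (s : Fin (r + 1) → Fin 3 → Perm X) :
    PathV s → Option (Fin 3) :=
  Sum.elim (fun _ => none) (fun j => some (κ j))

theorem pathCell_owner (j : Fin (r + 1)) (k : Fin 3) (x : X) :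
    pathCell κ s (owner κ s j k x) = none ∨ pathCell κ s (owner κ s j k x) = some k := by
  induction j using Fin.induction with
  | zero => exact Or.inl rfl
  | succ j ih =>
    rw [owner_succ]
    split_ifs with h
    · exact Or.inr (congrArg some h.1.symm)
    · exact ih

theorem IsPath.mark_surjective (hq : IsPath Δ κ s mark) (hΔ : ∀ k i, 0 < Δ k i) (k : Fin 3) :
    Function.Surjective (mark k) := by
  intro i
  by_contra h
  push Not at h
  have h1 := hq.size k i
  have : IsEmpty {x // mark k x = i} := ⟨fun x => h x.1 x.2⟩
  rw [Nat.card_of_isEmpty] at h1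
  exact absurd (hΔ k i) (by omega)

/-- The genus of a vertex over the center: the Riemann-Hurwitz formula for an orbit of the first
triple. -/
theorem IsPath.exists_genus [Finite X] (hq : IsPath Δ κ s mark) (o : Orbit (s 0)) :
    ∃ g, ∑ k, cycleCount ((s 0 k).subtypePerm (p := fun x => orbitMk (s 0) x = o)
      fun x => by rw [orbitMk_apply]) + 2 * g = Nat.card {x // orbitMk (s 0) x = o} + 2 := by
  have := Fintype.ofFinite {x // orbitMk (s 0) x = o}
  have hne : Nonempty {x // orbitMk (s 0) x = o} := by
    induction o using Quotient.inductionOn with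
    | h x => exact ⟨x, rfl⟩
  have h := TropHurwitz.exists_genus (X := {x // orbitMk (s 0) x = o})
    (fun k => (s 0 k).subtypePerm fun x => by rw [orbitMk_apply]) ?_ ?_
  · rwa [← Nat.card_eq_fintype_card] at h
  · ext x
    exact congrFun (congrArg DFunLike.coe hq.prod) x.1
  · rintro S hS ⟨x, hx⟩ hSx ⟨y, hy⟩
    have hS' := fun k => iff_of_invariant hS k
    have hxy : orbitMk (s 0) x = orbitMk (s 0) y := hx.trans hy.symm
    have := (Quotient.exact hxy : ∀ S : X → Prop, (∀ k z, S (s 0 k z) ↔ S z) → (S x ↔ S y))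
      (fun z => ∃ hz : orbitMk (s 0) z = o, S ⟨z, hz⟩) (fun k z => by
        constructor
        · rintro ⟨h1, h2⟩
          exact ⟨(orbitMk_apply _ _ _).symm.trans h1,
            (hS' k ⟨z, (orbitMk_apply _ _ _).symm.trans h1⟩).1 h2⟩
        · rintro ⟨h1, h2⟩
          exact ⟨(orbitMk_apply _ _ _).trans h1, (hS' k ⟨z, h1⟩).2 h2⟩)
    exact (this.1 ⟨hx, hSx⟩).2

/-- The graph of a path of permutations. Its vertices over the center are the orbits of the first
triple; the `j`-th step gives the vertex with the label `π j`. The strands at a front are the cycles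
of the permutations. -/
def pathGraph [Finite X] (hq : IsPath Δ κ s mark) (hΔ : ∀ k i, 0 < Δ k i) (π : Perm (Fin r)) :
    CoverGraph r n where
  V := PathV s
  E := PathE κ s
  fintypeV := Fintype.ofFinite _
  fintypeE := Fintype.ofFinite _
  genus := Sum.elim (fun o => Classical.choose (hq.exists_genus o)) fun _ => 0
  src := Quotient.lift (fun t => owner κ s t.1.1.castSucc (κ t.1.1) t.1.2) (by
    rintro ⟨⟨i, x⟩, hx⟩ ⟨⟨j, y⟩, hy⟩ ⟨rfl, h⟩
    exact hq.owner_eq _ h)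
  tgt := Quotient.lift (fun t => Sum.inr t.1.1) (by
    rintro ⟨⟨i, x⟩, hx⟩ ⟨⟨j, y⟩, hy⟩ ⟨rfl, h⟩
    rfl)
  weight := Quotient.lift
    (fun t => Nat.card {y // (s t.1.1.castSucc (κ t.1.1)).SameCycle t.1.2 y}) (by
    rintro ⟨⟨i, x⟩, hx⟩ ⟨⟨j, y⟩, hy⟩ ⟨rfl, h⟩
    exact Nat.card_congr (Equiv.subtypeEquivRight fun z =>
      ⟨fun h' => h.symm.trans h', fun h' => h.trans h'⟩))
  ends k i := owner κ s (Fin.last r) k (Function.surjInv (hq.mark_surjective hΔ k) i)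
  label i := Sum.inr (π.symm i)
  cell := pathCell κ s

section Graph

variable [Finite X] (hq : IsPath Δ κ s mark) (hΔ : ∀ k i, 0 < Δ k i) (π : Perm (Fin r))

/-- The vertex of the graph of a path that belongs to a step. -/
abbrev stepVertex : Fin r → (pathGraph hq hΔ π).V := fun j => Sum.inr j

/-- The edge of a touched point, as a strand. -/
def edgeStrand {j : Fin r} {x : X} (h : TouchedAt κ s j x) : Strand (pathGraph hq hΔ π) :=
  Sum.inl (edgeMk h)

theorem edgeStrand_eq {j : Fin r} {x y : X} (h : TouchedAt κ s j x) (h' : TouchedAt κ s j y) :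
    edgeStrand hq hΔ π h = edgeStrand hq hΔ π h' ↔ (s j.castSucc (κ j)).SameCycle x y :=
  ⟨fun e => (edgeMk_eq.1 (Sum.inl.inj e)).2, fun e => congrArg Sum.inl (edgeMk_eq.2 ⟨rfl, e⟩)⟩

/-- The vertex of the graph of a path that belongs to an orbit of the first triple. -/
abbrev orbitVertex (o : Orbit (s 0)) : (pathGraph hq hΔ π).V := Sum.inl o

/-- The strand of the graph of a path on which the point `x` lies over the ray `k`, at the `j`-th
front: the edge that finishes at the next step over `k` that touches `x`, or an end. -/
def strandOf (j : Fin (r + 1)) : Fin 3 → X → Strand (pathGraph hq hΔ π) :=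
  Fin.reverseInduction (motive := fun _ => Fin 3 → X → Strand (pathGraph hq hΔ π))
    (fun k x => Sum.inr ⟨k, mark k x⟩)
    (fun j m k x => if h : k = κ j ∧ TouchedAt κ s j x then edgeStrand hq hΔ π h.2 else m k x) j

theorem strandOf_last (k : Fin 3) (x : X) :
    strandOf hq hΔ π (Fin.last r) k x = Sum.inr ⟨k, mark k x⟩ := by
  rw [strandOf, Fin.reverseInduction_last]

theorem strandOf_castSucc (j : Fin r) (k : Fin 3) (x : X) : strandOf hq hΔ π j.castSucc k x
    = if h : k = κ j ∧ TouchedAt κ s j x then edgeStrand hq hΔ π h.2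
      else strandOf hq hΔ π j.succ k x := by
  rw [strandOf, Fin.reverseInduction_castSucc]
  rfl

theorem strandOf_touched {j : Fin r} {x : X} (h : TouchedAt κ s j x) :
    strandOf hq hΔ π j.castSucc (κ j) x = edgeStrand hq hΔ π h := by
  rw [strandOf_castSucc, dif_pos ⟨rfl, h⟩]

theorem strandOf_keep {j : Fin r} {k : Fin 3} {x : X} (h : ¬ (k = κ j ∧ TouchedAt κ s j x)) :
    strandOf hq hΔ π j.succ k x = strandOf hq hΔ π j.castSucc k x := by
  rw [strandOf_castSucc, dif_neg h]

theorem start_strandOf (j : Fin (r + 1)) (k : Fin 3) (x : X) :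
    start (strandOf hq hΔ π j k x) = (owner κ s j k x : PathV s) := by
  induction j using Fin.reverseInduction with
  | last =>
    rw [strandOf_last]
    refine hq.owner_eq _ ((hq.fibre k _ _).1 ?_)
    exact Function.surjInv_eq (hq.mark_surjective hΔ k) (mark k x)
  | cast j ih =>
    by_cases h : k = κ j ∧ TouchedAt κ s j x
    · obtain ⟨rfl, h⟩ := h
      rw [strandOf_touched hq hΔ π h]
      rfl
    · rw [← strandOf_keep hq hΔ π h, ih, owner_succ, if_neg h]

theorem dir_strandOf (j : Fin (r + 1)) (k : Fin 3) (x : X) :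
    dir (strandOf hq hΔ π j k x) = some k := by
  induction j using Fin.reverseInduction with
  | last => rw [strandOf_last]; rfl
  | cast j ih =>
    by_cases h : k = κ j ∧ TouchedAt κ s j x
    · obtain ⟨rfl, h⟩ := h
      rw [strandOf_touched hq hΔ π h]
      rfl
    · rw [← strandOf_keep hq hΔ π h, ih]

theorem finish_strandOf (j : Fin (r + 1)) {k : Fin 3} {x : X} {i : Fin r} :
    finish (strandOf hq hΔ π j k x) = some (stepVertex hq hΔ π i) → (j : ℕ) ≤ i := by
  induction j using Fin.reverseInduction with
  | last => rw [strandOf_last]; intro h; cases h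
  | cast j ih =>
    by_cases h : k = κ j ∧ TouchedAt κ s j x
    · obtain ⟨rfl, h⟩ := h
      rw [strandOf_touched hq hΔ π h]
      intro h
      have : j = i := Sum.inr.inj (Option.some.inj h)
      rw [this]
      exact le_rfl
    · rw [← strandOf_keep hq hΔ π h]
      exact fun h => (Nat.le_succ _).trans (ih h)

theorem front_strandOf (j : Fin (r + 1)) (k : Fin 3) (x : X) :
    Front (stepVertex hq hΔ π) j k (strandOf hq hΔ π j k x) where
  dir_eq := dir_strandOf hq hΔ π j k x
  born i hi := by
    rw [start_strandOf] at hi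
    exact owner_lt j hi
  alive i hi := finish_strandOf hq hΔ π j hi

theorem finish_strandOf_iff {j : Fin r} {k : Fin 3} {x : X} :
    finish (strandOf hq hΔ π j.castSucc k x) = some (stepVertex hq hΔ π j)
      ↔ k = κ j ∧ TouchedAt κ s j x := by
  constructor
  · intro h
    by_contra hk
    rw [← strandOf_keep hq hΔ π hk] at h
    have := finish_strandOf hq hΔ π j.succ h
    simp at this
  · rintro ⟨rfl, h⟩
    rw [strandOf_touched hq hΔ π h]
    rfl

theorem exists_strandOf {j : Fin r} {e : Strand (pathGraph hq hΔ π)}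
    (h : finish e = some (stepVertex hq hΔ π j)) :
    ∃ x, ∃ hx : TouchedAt κ s j x, e = edgeStrand hq hΔ π hx := by
  rcases e with e | e
  · obtain ⟨i, x, hx, rfl⟩ := exists_edgeMk e
    obtain rfl : i = j := Sum.inr.inj (Option.some.inj h)
    exact ⟨x, hx, rfl⟩
  · cases h

theorem isOrder_stepVertex : IsOrder (stepVertex hq hΔ π) κ where
  cell_vert _ := rfl
  inj _ _ h := Sum.inr.inj h
  surj v hv := by
    rcases v with o | j
    · exact absurd rfl hv
    · exact ⟨j, rfl⟩
  lt e i j hi hj := by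
    obtain ⟨x, hx, he⟩ := exists_strandOf hq hΔ π (e := Sum.inl e) (congrArg some hj)
    cases he
    exact owner_lt j.castSucc hi

/-- The strands of a front are the cycles of the permutations. -/
theorem strandOf_fibre (j : Fin (r + 1)) (k : Fin 3) (x y : X) :
    strandOf hq hΔ π j k x = strandOf hq hΔ π j k y ↔ (s j k).SameCycle x y := by
  induction j using Fin.reverseInduction with
  | last =>
    rw [strandOf_last, strandOf_last, ← hq.fibre]
    simp
  | cast j ih =>
    have key : ∀ x y, k = κ j → TouchedAt κ s j x → ¬ TouchedAt κ s j y →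
        strandOf hq hΔ π j.castSucc k x ≠ strandOf hq hΔ π j.castSucc k y := by
      intro x y hk hx hy h
      have h1 := (finish_strandOf_iff hq hΔ π).2 ⟨hk, hx⟩
      rw [h] at h1
      exact hy ((finish_strandOf_iff hq hΔ π).1 h1).2
    by_cases hk : k = κ j
    · by_cases hx : TouchedAt κ s j x
      · by_cases hy : TouchedAt κ s j y
        · subst hk
          rw [strandOf_touched hq hΔ π hx, strandOf_touched hq hΔ π hy, edgeStrand_eq]
        · refine iff_of_false (key x y hk hx hy) fun h => hy ((Touched.congr ?_).1 hx)
          rwa [hk] at h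
      · by_cases hy : TouchedAt κ s j y
        · refine iff_of_false (key y x hk hy hx).symm fun h => hx ((Touched.congr ?_).2 hy)
          rwa [hk] at h
        · rw [← strandOf_keep hq hΔ π fun h => hx h.2, ← strandOf_keep hq hΔ π fun h => hy h.2, ih,
            hk, sameCycle_iff_of_not_touched hx]
    · rw [← strandOf_keep hq hΔ π fun h => hk h.1, ← strandOf_keep hq hΔ π fun h => hk h.1, ih,
        hq.keep j k hk]

/-- The weights of the strands are the lengths of the cycles. -/
theorem strandOf_size (j : Fin (r + 1)) (k : Fin 3) {e : Strand (pathGraph hq hΔ π)}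
    (he : Front (stepVertex hq hΔ π) j k e) :
    Nat.card {x // strandOf hq hΔ π j k x = e} = wt Δ e := by
  induction j using Fin.reverseInduction with
  | last =>
    rcases e with e | ⟨l, i⟩
    · obtain ⟨j, x, hx, rfl⟩ := exists_edgeMk e
      have := he.alive j rfl
      exact absurd j.2 (not_lt.2 this)
    · obtain rfl : l = k := Option.some.inj he.dir_eq
      refine Eq.trans (Nat.card_congr (Equiv.subtypeEquivRight fun x => ?_)) (hq.size l i)
      rw [strandOf_last]
      simp
  | cast j ih =>
    by_cases hf : finish e = some (stepVertex hq hΔ π j)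
    · obtain ⟨x, hx, rfl⟩ := exists_strandOf hq hΔ π hf
      obtain rfl : κ j = k := Option.some.inj he.dir_eq
      rw [← strandOf_touched hq hΔ π hx]
      simp_rw [strandOf_fibre]
      rw [strandOf_touched hq hΔ π hx]
      exact Nat.card_congr (Equiv.subtypeEquivRight fun y => ⟨fun h => h.symm, fun h => h.symm⟩)
    · rw [← ih ⟨he.dir_eq, fun i hi => Nat.lt_succ_of_lt (he.born i hi), fun i hi => ?_⟩]
      · refine Nat.card_congr (Equiv.subtypeEquivRight fun x => ?_)
        by_cases h : k = κ j ∧ TouchedAt κ s j x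
        · refine iff_of_false ?_ ?_
          · intro h'
            exact hf (by rw [← h', finish_strandOf_iff]; exact h)
          · intro h'
            have h1 := start_strandOf hq hΔ π j.succ k x
            rw [owner_succ, if_pos h, h'] at h1
            exact lt_irrefl _ (he.born j h1)
        · rw [strandOf_keep hq hΔ π h]
      · refine lt_of_le_of_ne (he.alive i hi) fun h => hf ?_
        obtain rfl : j = i := Fin.ext h
        exact hi

theorem isMarked_strandOf (j : Fin (r + 1)) :
    IsMarked Δ (stepVertex hq hΔ π) j (s j) (strandOf hq hΔ π j) where
  mem := front_strandOf hq hΔ π j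
  fibre := strandOf_fibre hq hΔ π j
  size k _ he := strandOf_size hq hΔ π j k he

theorem wt_pathGraph_pos (e : Strand (pathGraph hq hΔ π)) : 0 < wt Δ e := by
  rcases e with e | e
  · obtain ⟨j, x, hx, rfl⟩ := exists_edgeMk e
    have : Nonempty {y // (s j.castSucc (κ j)).SameCycle x y} := ⟨x, SameCycle.refl _ _⟩
    exact Nat.card_pos
  · exact hΔ _ _

end Graph

end PathGraph

/-! ### The type of a path of permutations -/

theorem sum_val {r : ℕ} {n : Fin 3 → ℕ} (G : CoverGraph r n) :
    ∑ v, G.val v = 2 * Fintype.card G.E + ∑ k, n k := by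
  simp_rw [CoverGraph.val]
  rw [Finset.sum_add_distrib, Finset.sum_add_distrib, Finset.sum_comm]
  have h : ∀ {A : Type} [Fintype A] (f : A → G.V),
      ∑ v, Fintype.card {a // f a = v} = Fintype.card A := by
    intro A _ f
    rw [← Fintype.card_sigma]
    exact Fintype.card_congr (Equiv.sigmaFiberEquiv f)
  rw [h, h, Finset.sum_congr rfl fun k _ => h (G.ends k)]
  simp only [Fintype.card_fin]
  ring

/-- A map on the touched points whose fibres are cycles takes one or two values. -/
theorem card_of_touched {T B : Type} {f : T → B} (hf : Function.Surjective f)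
    {x y : T} (h : ∀ z, f z = f x ∨ f z = f y) : Nat.card B = if f x = f y then 1 else 2 := by
  split_ifs with hxy
  · rw [Nat.card_eq_one_iff_unique]
    refine ⟨⟨fun b c => ?_⟩, ⟨f x⟩⟩
    obtain ⟨z, rfl⟩ := hf b
    obtain ⟨w, rfl⟩ := hf c
    have h1 : ∀ z, f z = f x := fun z => (h z).elim id fun e => e.trans hxy.symm
    rw [h1 z, h1 w]
  · have : (Set.univ : Set B) = {f x, f y} := by
      ext b
      obtain ⟨z, rfl⟩ := hf b
      simpa using h z
    rw [← Nat.card_univ (α := B), this, Nat.card_coe_set_eq, Set.ncard_pair hxy]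

section PathType

variable {r : ℕ} {n : Fin 3 → ℕ} {Δ : ∀ k, Fin (n k) → ℕ} {X : Type}
  {κ : Fin r → Fin 3} {s : Fin (r + 1) → Fin 3 → Perm X} {mark : ∀ k, X → Fin (n k)}
  [Finite X] (hq : IsPath Δ κ s mark) (hΔ : ∀ k i, 0 < Δ k i) (π : Perm (Fin r))

theorem exists_strandOf_of_front {j : Fin (r + 1)} {k : Fin 3} {e : Strand (pathGraph hq hΔ π)}
    (he : Front (stepVertex hq hΔ π) j k e) : ∃ x, strandOf hq hΔ π j k x = e := by
  by_contra h
  push Not at h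
  have h1 := strandOf_size hq hΔ π j k he
  have : IsEmpty {x // strandOf hq hΔ π j k x = e} := ⟨fun x => h x.1 x.2⟩
  rw [Nat.card_of_isEmpty] at h1
  exact absurd (wt_pathGraph_pos hq hΔ π e) (by omega)

theorem front_of_orbit {o : Orbit (s 0)} {k : Fin 3} {e : Strand (pathGraph hq hΔ π)}
    (h : start e = orbitVertex hq hΔ π o) (hk : dir e = some k) :
    Front (stepVertex hq hΔ π) (0 : Fin (r + 1)) k e where
  dir_eq := hk
  born i hi := by cases h.symm.trans hi
  alive i _ := Nat.zero_le _

theorem front_of_finish_step {j : Fin r} {e : Strand (pathGraph hq hΔ π)}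
    (h : finish e = some (stepVertex hq hΔ π j)) :
    Front (stepVertex hq hΔ π) j.castSucc (κ j) e := by
  obtain ⟨x, hx, rfl⟩ := exists_strandOf hq hΔ π h
  rw [← strandOf_touched]
  exact front_strandOf hq hΔ π j.castSucc (κ j) x

theorem front_of_start_step {j : Fin r} {k : Fin 3} {e : Strand (pathGraph hq hΔ π)}
    (h : start e = stepVertex hq hΔ π j) (hk : dir e = some k) :
    Front (stepVertex hq hΔ π) j.succ k e where
  dir_eq := hk
  born i hi := by
    have hi : start e = stepVertex hq hΔ π i := hi
    rw [Sum.inr.inj (hi.symm.trans h)]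
    exact Nat.lt_succ_self _
  alive i hi := by
    have := front_of_finish_step hq hΔ π hi
    exact this.born j h

omit [Finite X] in
theorem owner_succ_eq_iff {j : Fin r} {k : Fin 3} {x : X} :
    owner κ s j.succ k x = Sum.inr j ↔ k = κ j ∧ TouchedAt κ s j x := by
  rw [owner_succ]
  split_ifs with h
  · exact iff_of_true rfl h
  · exact iff_of_false (fun h' => lt_irrefl _ (owner_lt j.castSucc h')) h

theorem start_strandOf_step {j : Fin r} {k : Fin 3} {x : X} :
    start (strandOf hq hΔ π j.succ k x) = stepVertex hq hΔ π j ↔ k = κ j ∧ TouchedAt κ s j x := by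
  rw [start_strandOf]
  exact owner_succ_eq_iff

theorem start_strandOf_zero (k : Fin 3) (x : X) (o : Orbit (s 0)) :
    start (strandOf hq hΔ π 0 k x) = orbitVertex hq hΔ π o ↔ orbitMk (s 0) x = o := by
  rw [start_strandOf, owner_zero]
  exact Sum.inl_injective.eq_iff

theorem outflow_orbit (o : Orbit (s 0)) (k : Fin 3) :
    (pathGraph hq hΔ π).outflow Δ (orbitVertex hq hΔ π o) k
      = Nat.card {x // orbitMk (s 0) x = o} := by
  rw [outflow_eq_sum, ← (isMarked_strandOf hq hΔ π 0).card_eq_sum k _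
    fun e he => front_of_orbit hq hΔ π he.1 he.2]
  refine Nat.card_congr (Equiv.subtypeEquivRight fun x => ?_)
  rw [start_strandOf_zero, dir_strandOf]
  exact ⟨fun h => h.1, fun h => ⟨h, rfl⟩⟩

theorem inflow_step (j : Fin r) : (pathGraph hq hΔ π).inflow (stepVertex hq hΔ π j)
    = Nat.card {x // TouchedAt κ s j x} := by
  rw [inflow_eq_sum, ← (isMarked_strandOf hq hΔ π j.castSucc).card_eq_sum (κ j) _
    fun e he => front_of_finish_step hq hΔ π he]
  refine Nat.card_congr (Equiv.subtypeEquivRight fun x => ?_)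
  rw [finish_strandOf_iff]
  exact ⟨fun h => h.2, fun h => ⟨rfl, h⟩⟩

theorem outflow_step (j : Fin r) : (pathGraph hq hΔ π).outflow Δ (stepVertex hq hΔ π j) (κ j)
    = Nat.card {x // TouchedAt κ s j x} := by
  rw [outflow_eq_sum, ← (isMarked_strandOf hq hΔ π j.succ).card_eq_sum (κ j) _
    fun e he => front_of_start_step hq hΔ π he.1 he.2]
  refine Nat.card_congr (Equiv.subtypeEquivRight fun x => ?_)
  rw [start_strandOf_step, dir_strandOf]
  exact ⟨fun h => h.1.2, fun h => ⟨⟨rfl, h⟩, rfl⟩⟩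

theorem exists_dir_path (e : Strand (pathGraph hq hΔ π)) : ∃ k, dir e = some k := by
  rcases e with e | e
  · obtain ⟨j, x, hx, rfl⟩ := exists_edgeMk e
    exact ⟨κ j, rfl⟩
  · exact ⟨e.1, rfl⟩

/-- The edges and ends at a vertex over the center are the cycles in the orbit. -/
theorem val_orbit (o : Orbit (s 0)) : (pathGraph hq hΔ π).val (orbitVertex hq hΔ π o)
    = ∑ k, cycleCount ((s 0 k).subtypePerm (p := fun x => orbitMk (s 0) x = o)
      fun x => by rw [orbitMk_apply]) := by
  rw [val_eq_card, Finset.card_eq_zero.2, zero_add]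
  · have h : Finset.univ.filter
          (fun e : Strand (pathGraph hq hΔ π) => start e = orbitVertex hq hΔ π o)
        = Finset.univ.biUnion fun k : Fin 3 =>
          Finset.univ.filter (fun e => start e = orbitVertex hq hΔ π o ∧ dir e = some k) := by
      ext e
      simp only [Finset.mem_filter, Finset.mem_univ, true_and, Finset.mem_biUnion]
      exact ⟨fun h => (exists_dir_path hq hΔ π e).imp fun k hk => ⟨h, hk⟩, fun ⟨k, h, _⟩ => h⟩
    rw [h, Finset.card_biUnion]
    · refine Finset.sum_congr rfl fun k _ => ?_
      rw [← Fintype.card_subtype, ← Nat.card_eq_fintype_card]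
      refine (cycleCount_eq_card (q := fun x : {x // orbitMk (s 0) x = o} =>
        (⟨strandOf hq hΔ π 0 k x.1, (start_strandOf_zero hq hΔ π k x.1 o).2 x.2,
          dir_strandOf hq hΔ π 0 k x.1⟩ :
          {e : Strand (pathGraph hq hΔ π) //
            start e = orbitVertex hq hΔ π o ∧ dir e = some k})) ?_ ?_).symm
      · rintro ⟨e, he, hk⟩
        obtain ⟨x, rfl⟩ := exists_strandOf_of_front hq hΔ π (front_of_orbit hq hΔ π he hk)
        exact ⟨⟨x, (start_strandOf_zero hq hΔ π k x o).1 he⟩, rfl⟩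
      · rintro x y
        rw [Subtype.mk.injEq, strandOf_fibre, sameCycle_subtypePerm]
    · intro k _ l _ hkl
      refine Finset.disjoint_left.2 fun e he he' => hkl ?_
      exact Option.some.inj ((Finset.mem_filter.1 he).2.2.symm.trans (Finset.mem_filter.1 he').2.2)
  · refine Finset.filter_eq_empty_iff.2 fun e _ he => ?_
    rcases e with e | e
    · obtain ⟨j, x, hx, rfl⟩ := exists_edgeMk e
      cases he
    · cases he

/-- The vertices of the steps are trivalent, since a transposition cuts a cycle into two or joins
two cycles. -/
theorem val_step (j : Fin r) : (pathGraph hq hΔ π).val (stepVertex hq hΔ π j) = 3 := by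
  obtain ⟨x, y, hxy, hs⟩ := hq.step j
  have hx : TouchedAt κ s j x := by
    rw [TouchedAt, hs, touched_mul_swap hxy]
    exact Or.inl (SameCycle.refl _ _)
  have hy : TouchedAt κ s j y := by
    rw [TouchedAt, hs, touched_mul_swap hxy]
    exact Or.inr (SameCycle.refl _ _)
  have h1 := card_of_touched (x := (⟨x, hx⟩ : {x // TouchedAt κ s j x})) (y := ⟨y, hy⟩)
    (f := fun z : {x // TouchedAt κ s j x} =>
      (⟨strandOf hq hΔ π j.castSucc (κ j) z.1, (finish_strandOf_iff hq hΔ π).2 ⟨rfl, z.2⟩⟩ :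
      {e : Strand (pathGraph hq hΔ π) // finish e = some (stepVertex hq hΔ π j)}))
    (by
      rintro ⟨e, he⟩
      obtain ⟨z, hz, rfl⟩ := exists_strandOf hq hΔ π he
      exact ⟨⟨z, hz⟩, Subtype.ext (strandOf_touched hq hΔ π hz)⟩) (by
      rintro ⟨z, hz⟩
      rw [Subtype.mk.injEq, Subtype.mk.injEq, strandOf_fibre, strandOf_fibre]
      rw [TouchedAt, hs, touched_mul_swap hxy] at hz
      exact hz)
  have h2 := card_of_touched (x := (⟨x, hx⟩ : {x // TouchedAt κ s j x})) (y := ⟨y, hy⟩)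
    (f := fun z : {x // TouchedAt κ s j x} =>
      (⟨strandOf hq hΔ π j.succ (κ j) z.1, by
        exact (start_strandOf_step hq hΔ π).2 ⟨rfl, z.2⟩⟩ :
      {e : Strand (pathGraph hq hΔ π) // start e = stepVertex hq hΔ π j}))
    (by
      rintro ⟨e, he⟩
      obtain ⟨k, hk⟩ := exists_dir_path hq hΔ π e
      obtain ⟨z, rfl⟩ := exists_strandOf_of_front hq hΔ π (front_of_start_step hq hΔ π he hk)
      obtain ⟨rfl, hz⟩ := (start_strandOf_step hq hΔ π).1 he
      exact ⟨⟨z, hz⟩, rfl⟩) (by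
      rintro ⟨z, hz⟩
      rw [Subtype.mk.injEq, Subtype.mk.injEq, strandOf_fibre, strandOf_fibre]
      rw [TouchedAt, hs, touched_mul_swap' hxy, ← hs] at hz
      exact hz)
  rw [Subtype.mk.injEq, strandOf_fibre] at h1 h2
  rw [val_eq_card, ← Fintype.card_subtype, ← Fintype.card_subtype, ← Nat.card_eq_fintype_card,
    ← Nat.card_eq_fintype_card, h1]
  change _ + Nat.card {e : Strand (pathGraph hq hΔ π) // start e = stepVertex hq hΔ π j} = 3
  rw [h2]
  by_cases h : (s j.castSucc (κ j)).SameCycle x y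
  · rw [if_pos h, if_neg]
    rw [hs]
    exact not_sameCycle_mul_swap hxy h
  · rw [if_neg h, if_pos]
    rw [hs]
    exact sameCycle_mul_swap_of_not h

theorem genus_orbit (o : Orbit (s 0)) :
    (pathGraph hq hΔ π).val (orbitVertex hq hΔ π o)
        + 2 * (pathGraph hq hΔ π).genus (orbitVertex hq hΔ π o)
      = Nat.card {x // orbitMk (s 0) x = o} + 2 := by
  rw [val_orbit]
  exact Classical.choose_spec (hq.exists_genus o)

theorem rhNumber_orbit (o : Orbit (s 0)) :
    (pathGraph hq hΔ π).rhNumber Δ (orbitVertex hq hΔ π o) = 0 := by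
  have h := genus_orbit hq hΔ π o
  have hc : (pathGraph hq hΔ π).cell (orbitVertex hq hΔ π o) = none := rfl
  rw [CoverGraph.rhNumber, CoverGraph.localDegree, CoverGraph.targetVal, if_pos hc, if_pos hc,
    outflow_orbit]
  push_cast
  omega

theorem rhNumber_step (j : Fin r) : (pathGraph hq hΔ π).rhNumber Δ (stepVertex hq hΔ π j) = 1 := by
  have hc : (pathGraph hq hΔ π).cell (stepVertex hq hΔ π j) ≠ none := by
    intro h; cases h
  have hg : (pathGraph hq hΔ π).genus (stepVertex hq hΔ π j) = 0 := rfl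
  rw [CoverGraph.rhNumber, CoverGraph.targetVal, if_neg hc, val_step, hg]
  norm_num

theorem joined_owner (j : Fin (r + 1)) (k : Fin 3) (x : X) :
    (pathGraph hq hΔ π).Joined Set.univ (owner κ s 0 0 x) (owner κ s j k x) := by
  induction j using Fin.induction generalizing k with
  | zero => exact Relation.EqvGen.refl _
  | succ j ih =>
    rw [owner_succ]
    split_ifs with h
    · exact Relation.EqvGen.trans _ _ _ (ih (κ j))
        (Relation.EqvGen.rel _ _ ⟨edgeMk h.2, Set.mem_univ _, rfl, rfl⟩)
    · exact ih k

/-- The graph of a path is connected because the action is transitive. -/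
theorem pathGraph_connected (v w : (pathGraph hq hΔ π).V) :
    (pathGraph hq hΔ π).Joined Set.univ v w := by
  have h1 : ∀ x y, (pathGraph hq hΔ π).Joined Set.univ (owner κ s 0 0 x) (owner κ s 0 0 y) := by
    intro x
    refine fun y => hq.trans (fun y => (pathGraph hq hΔ π).Joined Set.univ (owner κ s 0 0 x)
      (owner κ s 0 0 y)) (fun j k z hz => ?_) x y (Relation.EqvGen.refl _)
    refine hz.trans _ _ _ ((joined_owner hq hΔ π j k z).trans _ _ _ ?_)
    rw [hq.owner_eq j (sameCycle_apply_right.2 (SameCycle.refl (s j k) z))]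
    exact (joined_owner hq hΔ π j k _).symm
  have h2 : ∀ v : (pathGraph hq hΔ π).V, ∃ x,
      (pathGraph hq hΔ π).Joined Set.univ (owner κ s 0 0 x) v := by
    rintro (o | j)
    · induction o using Quotient.inductionOn with
      | h x => exact ⟨x, Relation.EqvGen.refl _⟩
    · obtain ⟨x, y, hxy, hs⟩ := hq.step j
      refine ⟨x, ?_⟩
      have hx : TouchedAt κ s j x := by
        rw [TouchedAt, hs, touched_mul_swap hxy]
        exact Or.inl (SameCycle.refl _ _)
      have := joined_owner hq hΔ π j.succ (κ j) x
      rwa [owner_succ_eq_iff.2 ⟨rfl, hx⟩] at this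
  obtain ⟨x, hx⟩ := h2 v
  obtain ⟨y, hy⟩ := h2 w
  exact (hx.symm.trans _ _ _ (h1 x y)).trans _ _ _ hy

theorem card_label_path (v : (pathGraph hq hΔ π).V) :
    (Fintype.card {i // (pathGraph hq hΔ π).label i = v} : ℤ)
      = (pathGraph hq hΔ π).rhNumber Δ v := by
  rcases v with o | j
  · rw [rhNumber_orbit]
    have : IsEmpty {i // (pathGraph hq hΔ π).label i = orbitVertex hq hΔ π o} :=
      ⟨fun i => by cases i.2⟩
    rw [Fintype.card_of_isEmpty]
    rfl
  · refine Eq.trans ?_ (rhNumber_step hq hΔ π j).symm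
    rw [Nat.cast_eq_one, Fintype.card_eq_one_iff]
    refine ⟨⟨π j, congrArg Sum.inr (π.symm_apply_apply j)⟩, fun i => Subtype.ext ?_⟩
    exact (π.apply_symm_apply i.1).symm.trans (congrArg π (Sum.inr.inj i.2))

/-- The total Riemann-Hurwitz formula of a graph. -/
theorem sum_rhNumber (G : CoverGraph r n) : ∑ v, G.rhNumber Δ v
    = 2 * (Fintype.card G.E : ℤ) + ∑ k, (n k : ℤ) - 2 * (Fintype.card G.V : ℤ)
      + 2 * ∑ v, (G.genus v : ℤ) - ∑ v : {v // G.cell v = none}, (G.outflow Δ v.1 0 : ℤ) := by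
  have h1 : ∑ v, (G.localDegree Δ v : ℤ) * ((G.targetVal v : ℤ) - 2)
      = ∑ v : {v // G.cell v = none}, (G.outflow Δ v.1 0 : ℤ) := by
    rw [← Finset.sum_subtype (Finset.univ.filter fun v => G.cell v = none) (by simp)
      (fun v => (G.outflow Δ v 0 : ℤ)), Finset.sum_filter]
    refine Finset.sum_congr rfl fun v _ => ?_
    rw [CoverGraph.localDegree, CoverGraph.targetVal]
    split_ifs
    · norm_num
    · norm_num
  have h2 := congrArg (Nat.cast : ℕ → ℤ) (sum_val G)
  push_cast at h2
  simp_rw [CoverGraph.rhNumber]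
  rw [Finset.sum_sub_distrib, Finset.sum_sub_distrib, Finset.sum_add_distrib, h1, h2,
    ← Finset.mul_sum, Finset.sum_const, Finset.card_univ, nsmul_eq_mul]
  ring

theorem sum_card_label (G : CoverGraph r n) : ∑ v, (Fintype.card {i // G.label i = v} : ℤ) = r := by
  rw [← Nat.cast_sum, ← Fintype.card_sigma, Fintype.card_congr (Equiv.sigmaFiberEquiv G.label),
    Fintype.card_fin]

/-- The genus is determined by the numbers of labels and ends and by the degree. -/
theorem genus_of_card_label {g d : ℕ} {G : CoverGraph r n}
    (hl : ∀ v, (Fintype.card {i // G.label i = v} : ℤ) = G.rhNumber Δ v)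
    (hd : ∑ v : {v // G.cell v = none}, G.outflow Δ v.1 0 = d)
    (hr : (r : ℤ) = (∑ k, (n k : ℤ)) + 2 * (g : ℤ) - 2 - (d : ℤ)) :
    (g : ℤ) = ((Fintype.card G.E : ℤ) - (Fintype.card G.V : ℤ) + 1) + ∑ v, (G.genus v : ℤ) := by
  have h1 := sum_rhNumber (Δ := Δ) G
  rw [← Finset.sum_congr rfl fun v _ => hl v, sum_card_label,
    ← Nat.cast_sum (f := fun v : {v // G.cell v = none} => G.outflow Δ v.1 0), hd] at h1
  linarith

/-- The combinatorial type of a path of permutations. Its genus is `g` by the Riemann-Hurwitz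
formula `hr`. -/
def pathType [Nonempty X] {g : ℕ}
    (hr : (r : ℤ) = (∑ k, (n k : ℤ)) + 2 * (g : ℤ) - 2 - (Nat.card X : ℤ)) : CoverType g r Δ where
  toCoverGraph := pathGraph hq hΔ π
  weight_pos e := wt_pathGraph_pos hq hΔ π (Sum.inl e)
  edge_cell e := by
    obtain ⟨j, x, hx, rfl⟩ := exists_edgeMk e
    exact ⟨κ j, rfl, pathCell_owner j.castSucc (κ j) x⟩
  ends_cell k i := pathCell_owner (Fin.last r) k (Function.surjInv (hq.mark_surjective hΔ k) i)
  balanced_center v hv k l := by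
    rcases v with o | j
    · exact (outflow_orbit hq hΔ π o k).trans (outflow_orbit hq hΔ π o l).symm
    · cases hv
  balanced_ray v k hv := by
    rcases v with o | j
    · cases hv
    · obtain rfl : κ j = k := Option.some.inj hv
      exact (inflow_step hq hΔ π j).trans (outflow_step hq hΔ π j).symm
  two_valent v hv := by
    rcases v with o | j
    · have h := genus_orbit hq hΔ π o
      have : Nonempty {x // orbitMk (s 0) x = o} := by
        induction o using Quotient.inductionOn with
        | h x => exact ⟨x, rfl⟩
      have : 0 < Nat.card {x // orbitMk (s 0) x = o} := Nat.card_pos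
      rw [show (pathGraph hq hΔ π).val (orbitVertex hq hΔ π o) = 2 from hv] at h
      change 1 ≤ (pathGraph hq hΔ π).genus (orbitVertex hq hΔ π o)
      omega
    · have := val_step hq hΔ π j
      rw [this] at hv
      omega
  card_label := card_label_path hq hΔ π
  nonempty := ⟨Sum.inl (orbitMk (s 0) (Classical.arbitrary X))⟩
  connected := pathGraph_connected hq hΔ π
  genus_eq := by
    refine genus_of_card_label (d := Nat.card X) (card_label_path hq hΔ π) ?_ hr
    have h : ∀ v : {v // (pathGraph hq hΔ π).cell v = none},
        (pathGraph hq hΔ π).outflow Δ v.1 0 = Nat.card {x // (Sum.inl (orbitMk (s 0) x) :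
          (pathGraph hq hΔ π).V) = v.1} := by
      rintro ⟨o | j, hv⟩
      · rw [outflow_orbit]
        exact Nat.card_congr (Equiv.subtypeEquivRight fun x => Sum.inl_injective.eq_iff.symm)
      · cases hv
    rw [Finset.sum_congr rfl fun v _ => h v, ← Nat.card_sigma]
    refine Nat.card_congr ⟨fun x => x.2.1, fun x => ⟨⟨Sum.inl (orbitMk (s 0) x), rfl⟩, x, rfl⟩,
      ?_, fun x => rfl⟩
    rintro ⟨⟨v, hv⟩, x, hx⟩
    obtain rfl : _ = v := hx
    rfl

theorem isTrivalent_pathType [Nonempty X] {g : ℕ}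
    (hr : (r : ℤ) = (∑ k, (n k : ℤ)) + 2 * (g : ℤ) - 2 - (Nat.card X : ℤ)) :
    (pathType hq hΔ π hr).IsTrivalent := by
  intro v
  rcases v with o | j
  · exact ⟨fun _ => rhNumber_orbit hq hΔ π o, fun h => absurd rfl h⟩
  · exact ⟨fun h => (nomatch h), fun _ => ⟨val_step hq hΔ π j, rfl⟩⟩

/-- The tautological chain of a path, on its own type. -/
theorem isChainOver_strandOf [Nonempty X] {g : ℕ}
    (hr : (r : ℤ) = (∑ k, (n k : ℤ)) + 2 * (g : ℤ) - 2 - (Nat.card X : ℤ)) :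
    IsChainOver (G := (pathType hq hΔ π hr).toCoverGraph) Δ (stepVertex hq hΔ π) κ
      (fun j => (s j, strandOf hq hΔ π j)) (s, mark) where
  chain :=
    { first :=
        { marked := isMarked_strandOf hq hΔ π 0
          prod := hq.prod
          base := fun k x => by
            exact (start_strandOf hq hΔ π 0 k x).trans (start_strandOf hq hΔ π 0 0 x).symm
          trans := fun S hS x y h hx => by
            have h1 := (start_strandOf_zero hq hΔ π 0 x (orbitMk (s 0) y)).1
              (h.trans (start_strandOf hq hΔ π 0 0 y))
            exact ((Quotient.exact h1 : ∀ S : X → Prop, (∀ k z, S (s 0 k z) ↔ S z) → (S x ↔ S y)) S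
              (fun k => iff_of_invariant hS k)).1 hx }
      step := fun j =>
        { marked := isMarked_strandOf hq hΔ π j.succ
          perm := hq.keep j
          mark := fun k hk => funext fun x => strandOf_keep hq hΔ π fun h => hk h.1
          step :=
            { swap := hq.step j
              touched := fun x => mem_inStrands.trans
                ((finish_strandOf_iff hq hΔ π).trans ⟨fun h => h.2, fun h => ⟨rfl, h⟩⟩)
              keep := fun x hx => strandOf_keep hq hΔ π fun h =>
                hx (mem_inStrands.2 ((finish_strandOf_iff hq hΔ π).2 h))
              out := fun x hx => mem_outStrands.2 ((start_strandOf_step hq hΔ π).2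
                ((finish_strandOf_iff hq hΔ π).1 (mem_inStrands.1 hx)))
              fibre := strandOf_fibre hq hΔ π j.succ (κ j)
              size := fun e he => by
                have he := mem_outStrands.1 he
                refine strandOf_size hq hΔ π j.succ (κ j) (front_of_start_step hq hΔ π he ?_)
                exact dir_of_start (α := pathType hq hΔ π hr) (by rw [he]; rfl) } } }
  perm _ := rfl
  mark k x := strandOf_last hq hΔ π k x

end PathType

/-! ### Contractions of covers -/

theorem tropLine_ext {p q : TropLine} (hc : p.cell = q.cell) (hh : p.height = q.height) :
    p = q := by
  rcases p with _ | ⟨k, t, ht⟩ <;> rcases q with _ | ⟨l, u, hu⟩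
  · rfl
  · cases hc
  · cases hc
  · obtain rfl : k = l := Option.some.inj hc
    obtain rfl : t = u := hh
    rfl

theorem height_pos_iff {p : TropLine} : 0 < p.height ↔ p.cell ≠ none := by
  rcases p with _ | ⟨k, t, ht⟩
  · simp [TropLine.height, TropLine.cell]
  · simpa [TropLine.height, TropLine.cell] using ht

section Sums

variable {r : ℕ} {n : Fin 3 → ℕ} (G : CoverGraph r n) (Δ : ∀ k, Fin (n k) → ℕ)

theorem sum_subtype_eq_sum_ite {A M : Type} [Fintype A] [AddCommMonoid M] (p : A → Prop)
    [DecidablePred p] [Fintype {a // p a}] (f : A → M) :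
    ∑ a : {a // p a}, f a.1 = ∑ a, if p a then f a else 0 := by
  rw [← Finset.sum_filter]
  exact (Finset.sum_subtype _ (by simp) f).symm

theorem outflow_eq_ite (v : G.V) (k : Fin 3) : G.outflow Δ v k
    = ∑ e, (if G.src e = v ∧ G.cell (G.tgt e) = some k then G.weight e else 0)
      + ∑ i, if G.ends k i = v then Δ k i else 0 := by
  rw [CoverGraph.outflow, Fintype.sum_sum_type]
  exact congrArg₂ _ (sum_subtype_eq_sum_ite _ G.weight) (sum_subtype_eq_sum_ite _ (Δ k))

theorem inflow_eq_ite (v : G.V) :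
    G.inflow v = ∑ e, if G.tgt e = v then G.weight e else 0 :=
  sum_subtype_eq_sum_ite _ G.weight

theorem val_eq_ite (v : G.V) : G.val v = ∑ e, (if G.src e = v then 1 else 0)
    + ∑ e, (if G.tgt e = v then 1 else 0) + ∑ k, ∑ i, if G.ends k i = v then 1 else 0 := by
  have h : ∀ {A : Type} [Fintype A] (p : A → Prop), Fintype.card {a // p a}
      = ∑ a, if p a then 1 else 0 := by
    intro A _ p
    rw [Fintype.card_subtype, Finset.card_filter]
  simp_rw [CoverGraph.val, h]

theorem sum_fibre_ite {V W A M : Type} [Fintype V] [Fintype A] [AddCommMonoid M] (m : V → W)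
    (x : W) (f : A → V) (p : A → Prop) [DecidablePred p] (c : A → M) :
    ∑ v : {v // m v = x}, ∑ a, (if f a = v.1 ∧ p a then c a else 0)
      = ∑ a, if m (f a) = x ∧ p a then c a else 0 := by
  rw [Finset.sum_comm]
  refine Finset.sum_congr rfl fun a _ => ?_
  rw [sum_subtype_eq_sum_ite (fun v => m v = x) (fun v => if f a = v ∧ p a then c a else 0),
    Finset.sum_eq_single (f a)]
  · by_cases h : m (f a) = x <;> simp [h]
  · intro v _ hv
    rw [if_neg (fun h : f a = v ∧ p a => hv h.1.symm), ite_self]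
  · simp

theorem sum_fibre_ite' {V W A M : Type} [Fintype V] [Fintype A] [AddCommMonoid M] (m : V → W)
    (x : W) (f : A → V) (c : A → M) : ∑ v : {v // m v = x}, ∑ a, (if f a = v.1 then c a else 0)
      = ∑ a, if m (f a) = x then c a else 0 := by
  simpa using sum_fibre_ite m x f (fun _ => True) c

theorem sum_outflow_fibre {W : Type} (m : G.V → W) (x : W) (k : Fin 3) :
    ∑ v : {v // m v = x}, G.outflow Δ v.1 k
      = ∑ e, (if m (G.src e) = x ∧ G.cell (G.tgt e) = some k then G.weight e else 0)
        + ∑ i, if m (G.ends k i) = x then Δ k i else 0 := by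
  simp_rw [outflow_eq_ite, Finset.sum_add_distrib]
  rw [sum_fibre_ite m x G.src (fun e => G.cell (G.tgt e) = some k), sum_fibre_ite' m x (G.ends k)]

theorem sum_inflow_fibre {W : Type} (m : G.V → W) (x : W) :
    ∑ v : {v // m v = x}, G.inflow v.1 = ∑ e, if m (G.tgt e) = x then G.weight e else 0 := by
  simp_rw [inflow_eq_ite]
  rw [sum_fibre_ite' m x G.tgt]

theorem sum_val_fibre {W : Type} (m : G.V → W) (x : W) :
    ∑ v : {v // m v = x}, G.val v.1 = ∑ e, (if m (G.src e) = x then 1 else 0)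
      + ∑ e, (if m (G.tgt e) = x then 1 else 0)
      + ∑ k, ∑ i, if m (G.ends k i) = x then 1 else 0 := by
  simp_rw [val_eq_ite, Finset.sum_add_distrib]
  rw [sum_fibre_ite' m x G.src, sum_fibre_ite' m x G.tgt, Finset.sum_comm]
  congr 1
  exact Finset.sum_congr rfl fun k _ => sum_fibre_ite' m x (G.ends k) fun _ => 1

/-- A connected subgraph has at most one vertex more than it has edges. -/
theorem card_fibre_le {W : Type} (S : Set G.E) (m : G.V → W)
    (hm : ∀ v w, m v = m w ↔ G.Joined S v w) (x : W) :
    Nat.card {v // m v = x} ≤ Nat.card {e // e ∈ S ∧ m (G.src e) = x} + 1 := by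
  have hst : ∀ e ∈ S, m (G.src e) = m (G.tgt e) := fun e he =>
    (hm _ _).2 (Relation.EqvGen.rel _ _ ⟨e, he, rfl, rfl⟩)
  -- the coboundary of the subgraph, whose kernel consists of the constant functions
  let δ : ({v // m v = x} → ℚ) →ₗ[ℚ] ({e // e ∈ S ∧ m (G.src e) = x} → ℚ) :=
    LinearMap.funLeft ℚ ℚ (fun e => ⟨G.tgt e.1, (hst e.1 e.2.1).symm.trans e.2.2⟩)
      - LinearMap.funLeft ℚ ℚ (fun e => ⟨G.src e.1, e.2.2⟩)
  have hker : LinearMap.ker δ ≤ Submodule.span ℚ {fun _ => 1} := by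
    intro f hf
    set F : G.V → ℚ := fun v => if h : m v = x then f ⟨v, h⟩ else 0 with hF
    have hFe : ∀ e ∈ S, F (G.src e) = F (G.tgt e) := by
      intro e he
      by_cases hx : m (G.src e) = x
      · have := congrFun (LinearMap.mem_ker.1 hf) ⟨e, he, hx⟩
        simp only [δ, LinearMap.sub_apply, Pi.sub_apply, LinearMap.funLeft_apply, Pi.zero_apply,
          sub_eq_zero] at this
        simp only [hF]
        rw [dif_pos hx, dif_pos ((hst e he).symm.trans hx)]
        exact this.symm
      · simp only [hF]
        rw [dif_neg hx, dif_neg (by rw [← hst e he]; exact hx)]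
    have hFj : ∀ v w, G.Joined S v w → F v = F w := by
      intro v w h
      unfold CoverGraph.Joined at h
      induction h with
      | rel v w h =>
        obtain ⟨e, he, rfl, rfl⟩ := h
        exact hFe e he
      | refl v => rfl
      | symm v w _ ih => exact ih.symm
      | trans u v w _ _ ih ih' => exact ih.trans ih'
    by_cases hne : Nonempty {v // m v = x}
    · obtain ⟨v, hv⟩ := hne
      refine Submodule.mem_span_singleton.2 ⟨f ⟨v, hv⟩, ?_⟩
      funext w
      have := hFj v w.1 ((hm _ _).1 (hv.trans w.2.symm))
      simp only [hF] at this
      rw [dif_pos hv, dif_pos w.2] at this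
      simpa using this
    · have : f = 0 := funext fun v => absurd ⟨v⟩ hne
      rw [this]
      exact Submodule.zero_mem _
  have h1 := LinearMap.finrank_range_add_finrank_ker δ
  have h2 := (Submodule.finrank_mono hker).trans (finrank_span_le_one _)
  have h3 := Submodule.finrank_le (LinearMap.range δ)
  rw [Module.finrank_fintype_fun_eq_card] at h1 h3
  rw [Nat.card_eq_fintype_card, Nat.card_eq_fintype_card]
  omega

end Sums

section Contraction

variable {g r : ℕ} {n : Fin 3 → ℕ} {Δ : ∀ k, Fin (n k) → ℕ}

/-- A cover of type `α` in which bounded edges of length zero are allowed. -/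
structure DegenerateCover (α : CoverType g r Δ) where
  lim : α.E → ℝ
  lim_nonneg : ∀ e, 0 ≤ lim e
  pos : α.V → TropLine
  pos_cell : ∀ v, (pos v).cell = α.cell v
  pos_edge : ∀ e, (pos (α.tgt e)).height = (pos (α.src e)).height + (α.weight e : ℝ) * lim e

/-- Positive lengths that come from a height function on the vertices are a point of the cone. -/
theorem mem_cone {α : CoverType g r Δ} {ℓ : α.E → ℝ} (hℓ : ∀ e, 0 < ℓ e) {y : α.V → ℝ}
    (hy : ∀ v, α.cell v = none → y v = 0)
    (hye : ∀ e, y (α.tgt e) = y (α.src e) + (α.weight e : ℝ) * ℓ e) : ℓ ∈ α.cone := by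
  refine ⟨hℓ, fun z hz => ?_⟩
  have h := sum_boundary α z (fun v => v.elim 0 y)
  rw [(mem_cycles_iff α z).1 hz] at h
  simp only [Pi.zero_apply, Int.cast_zero, zero_mul, Finset.sum_const_zero] at h
  rw [h]
  have hm : ∀ v, (α.mergedVertex v).elim 0 y = y v := by
    intro v
    unfold CoverType.mergedVertex
    split_ifs with hv
    · exact (hy v hv).symm
    · rfl
  refine Finset.sum_congr rfl fun e _ => ?_
  rw [hm, hm, hye]
  ring

namespace DegenerateCover

variable {α : CoverType g r Δ} (L : DegenerateCover α)

/-- A degenerate cover is a point of the closed cone of its type if this type is realized by some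
cover: it is the limit along the segment from that cover. -/
theorem lim_mem_closure {ℓ : α.E → ℝ} (hℓ : ∀ e, 0 < ℓ e) {y : α.V → ℝ}
    (hy : ∀ v, α.cell v = none → y v = 0)
    (hye : ∀ e, y (α.tgt e) = y (α.src e) + (α.weight e : ℝ) * ℓ e) :
    L.lim ∈ closure α.cone := by
  have ht : Filter.Tendsto (fun ε : ℝ => L.lim + ε • ℓ) (nhdsWithin 0 (Set.Ioi 0))
      (nhds (L.lim + (0 : ℝ) • ℓ)) := by
    refine Filter.Tendsto.mono_left ?_ nhdsWithin_le_nhds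
    exact (continuous_const.add (continuous_id.smul continuous_const)).tendsto 0
  rw [zero_smul, add_zero] at ht
  refine mem_closure_of_tendsto ht (Filter.eventually_of_mem self_mem_nhdsWithin fun ε hε => ?_)
  refine mem_cone (y := fun v => (L.pos v).height + ε * y v) (fun e => ?_) (fun v hv => ?_)
    fun e => ?_
  · have := mul_pos (Set.mem_Ioi.1 hε) (hℓ e)
    have := L.lim_nonneg e
    simp only [Pi.add_apply, Pi.smul_apply, smul_eq_mul]
    linarith
  · rw [eq_center_of_cell ((L.pos_cell v).trans hv), hy v hv]
    simp [TropLine.height]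
  · simp only [Pi.add_apply, Pi.smul_apply, smul_eq_mul, L.pos_edge, hye]
    ring

theorem cell_src_of_lim_eq_zero {e : α.E} (he : L.lim e = 0) :
    α.cell (α.src e) = α.cell (α.tgt e) := by
  obtain ⟨k, hk, h⟩ := α.edge_cell e
  rcases h with h | h
  · exfalso
    have h1 := L.pos_edge e
    rw [he, mul_zero, add_zero] at h1
    have h2 := height_pos_iff.2 (show (L.pos (α.tgt e)).cell ≠ none by
      rw [L.pos_cell, hk]; simp)
    rw [h1, height_pos_iff, L.pos_cell] at h2
    exact h2 h
  · rw [h, hk]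

theorem pos_src_of_lim_eq_zero {e : α.E} (he : L.lim e = 0) :
    L.pos (α.src e) = L.pos (α.tgt e) := by
  refine tropLine_ext ?_ ?_
  · rw [L.pos_cell, L.pos_cell, L.cell_src_of_lim_eq_zero he]
  · rw [L.pos_edge, he, mul_zero, add_zero]

/-- The equivalence relation generated by the edges of length zero. -/
def setoid : Setoid α.V :=
  Relation.EqvGen.setoid fun a b => ∃ e ∈ {e | L.lim e = 0}, α.src e = a ∧ α.tgt e = b

/-- The vertices after the contraction of the edges of length zero. -/
def Class : Type := Quotient L.setoid

instance : Finite L.Class := inferInstanceAs (Finite (Quotient L.setoid))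

/-- The vertex after the contraction into which a vertex is contracted. -/
def classOf (v : α.V) : L.Class := Quotient.mk L.setoid v

theorem classOf_eq (v w : α.V) : L.classOf v = L.classOf w ↔ α.Joined {e | L.lim e = 0} v w :=
  Quotient.eq (r := L.setoid)

theorem classOf_src {e : α.E} (he : L.lim e = 0) : L.classOf (α.src e) = L.classOf (α.tgt e) :=
  (L.classOf_eq _ _).2 (Relation.EqvGen.rel _ _ ⟨e, he, rfl, rfl⟩)

theorem eq_of_joined {B : Type} {f : α.V → B} (hf : ∀ e, L.lim e = 0 → f (α.src e) = f (α.tgt e))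
    {v w : α.V} (h : α.Joined {e | L.lim e = 0} v w) : f v = f w := by
  unfold CoverGraph.Joined at h
  induction h with
  | rel v w h =>
    obtain ⟨e, he, rfl, rfl⟩ := h
    exact hf e he
  | refl v => rfl
  | symm v w _ ih => exact ih.symm
  | trans u v w _ _ ih ih' => exact ih.trans ih'

/-- The edges of length zero in a contracted subgraph. -/
abbrev ZeroEdge (x : L.Class) : Type := {e // L.lim e = 0 ∧ L.classOf (α.src e) = x}

theorem card_class_le (x : L.Class) :
    Fintype.card {v // L.classOf v = x} ≤ Fintype.card (L.ZeroEdge x) + 1 := by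
  rw [← Nat.card_eq_fintype_card, ← Nat.card_eq_fintype_card]
  exact card_fibre_le α.toCoverGraph {e | L.lim e = 0} L.classOf L.classOf_eq x

/-- The contraction of the edges of length zero in a graph. -/
def graph : CoverGraph r n where
  V := L.Class
  E := {e // L.lim e ≠ 0}
  fintypeV := Fintype.ofFinite _
  fintypeE := Fintype.ofFinite _
  genus x := ∑ v : {v // L.classOf v = x}, α.genus v.1
    + (Fintype.card (L.ZeroEdge x) + 1 - Fintype.card {v // L.classOf v = x})
  src e := L.classOf (α.src e.1)
  tgt e := L.classOf (α.tgt e.1)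
  weight e := α.weight e.1
  ends k i := L.classOf (α.ends k i)
  label i := L.classOf (α.label i)
  cell := Quotient.lift α.cell fun _ _ h =>
    L.eq_of_joined (fun _ he => L.cell_src_of_lim_eq_zero he) h

/-- The contraction map on vertices. -/
abbrev toGraph (v : α.V) : L.graph.V := L.classOf v

theorem cell_toGraph (v : α.V) : L.graph.cell (L.toGraph v) = α.cell v := rfl

theorem exists_toGraph (x : L.graph.V) : ∃ v, L.toGraph v = x := Quotient.exists_rep x

theorem genus_graph (x : L.graph.V) : (L.graph.genus x : ℤ)
    = ∑ v : {v // L.toGraph v = x}, (α.genus v.1 : ℤ)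
      + ((Fintype.card (L.ZeroEdge x) : ℤ) - (Fintype.card {v // L.toGraph v = x} : ℤ) + 1) := by
  have h : Fintype.card {v // L.toGraph v = x} ≤ Fintype.card (L.ZeroEdge x) + 1 :=
    L.card_class_le x
  have h1 : L.graph.genus x = ∑ v : {v // L.toGraph v = x}, α.genus v.1
    + (Fintype.card (L.ZeroEdge x) + 1 - Fintype.card {v // L.toGraph v = x}) := rfl
  rw [h1, Nat.cast_add, Nat.cast_sub h]
  push_cast
  ring

theorem sum_graphE {M : Type} [AddCommMonoid M] (f : α.E → M) :
    ∑ e : L.graph.E, f e.1 + ∑ e : {e // L.lim e = 0}, f e.1 = ∑ e, f e := by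
  rw [add_comm, ← Fintype.sum_subtype_add_sum_subtype (fun e => L.lim e = 0) f]
  exact congrArg _ (@Fintype.sum_equiv L.graph.E {e // L.lim e ≠ 0} M L.graph.fintypeE _ _
    (Equiv.refl _) _ _ fun _ => rfl)

/-- The weights of the contracted edges at a vertex, over a ray. -/
def zeroWeight (x : L.graph.V) (k : Fin 3) : ℕ :=
  ∑ e : {e // L.lim e = 0},
    if L.toGraph (α.src e.1) = x ∧ α.cell (α.tgt e.1) = some k then α.weight e.1 else 0

theorem outflow_graph (x : L.graph.V) (k : Fin 3) :
    L.graph.outflow Δ x k + L.zeroWeight x k = ∑ v : {v // L.toGraph v = x}, α.outflow Δ v.1 k := by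
  rw [sum_outflow_fibre, outflow_eq_ite, ← L.sum_graphE]
  exact add_right_comm _ _ _

theorem inflow_graph {x : L.graph.V} {k : Fin 3} (hx : L.graph.cell x = some k) :
    L.graph.inflow x + L.zeroWeight x k = ∑ v : {v // L.toGraph v = x}, α.inflow v.1 := by
  rw [sum_inflow_fibre, inflow_eq_ite, ← L.sum_graphE]
  refine congrArg₂ _ rfl (Finset.sum_congr rfl fun e _ => if_congr ?_ rfl rfl)
  rw [show L.toGraph (α.src e.1) = L.toGraph (α.tgt e.1) from L.classOf_src e.2]
  exact ⟨fun h => h.1, fun h => ⟨h, by rw [← L.cell_toGraph, h, hx]⟩⟩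

theorem not_zero_of_center {x : L.graph.V} (hx : L.graph.cell x = none) {e : α.E}
    (he : L.lim e = 0) : L.toGraph (α.src e) ≠ x := by
  rintro rfl
  rw [L.cell_toGraph, L.cell_src_of_lim_eq_zero he] at hx
  obtain ⟨k, hk, -⟩ := α.edge_cell e
  rw [hk] at hx
  cases hx

theorem outflow_graph_center {x : L.graph.V} (hx : L.graph.cell x = none) (k : Fin 3) :
    L.graph.outflow Δ x k = ∑ v : {v // L.toGraph v = x}, α.outflow Δ v.1 k := by
  rw [← L.outflow_graph, zeroWeight, Finset.sum_eq_zero, add_zero]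
  exact fun e _ => if_neg fun h => L.not_zero_of_center hx e.2 h.1

theorem val_graph (x : L.graph.V) : L.graph.val x + 2 * Fintype.card (L.ZeroEdge x)
    = ∑ v : {v // L.toGraph v = x}, α.val v.1 := by
  have h : ∑ e : {e // L.lim e = 0}, (if L.toGraph (α.src e.1) = x then 1 else 0)
      = Fintype.card (L.ZeroEdge x) := by
    rw [sum_subtype_eq_sum_ite (fun e => L.lim e = 0)
      (fun e => if L.toGraph (α.src e) = x then 1 else 0), Fintype.card_subtype,
      Finset.card_filter]
    exact Finset.sum_congr rfl fun e _ => by rw [← ite_and]; rfl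
  have h' : ∑ e : {e // L.lim e = 0}, (if L.toGraph (α.tgt e.1) = x then 1 else 0)
      = Fintype.card (L.ZeroEdge x) := by
    rw [← h]
    refine Finset.sum_congr rfl fun e _ => ?_
    rw [show L.toGraph (α.src e.1) = L.toGraph (α.tgt e.1) from L.classOf_src e.2]
  rw [sum_val_fibre, val_eq_ite, ← L.sum_graphE, ← L.sum_graphE, h, h']
  change _ + _ + _ + 2 * _ = _
  have h2 : ∀ a b c d : ℕ, a + b + c + 2 * d = a + d + (b + d) + c := by intros; ring
  exact h2 _ _ _ _

theorem rhNumber_graph (x : L.graph.V) :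
    L.graph.rhNumber Δ x = ∑ v : {v // L.toGraph v = x}, α.rhNumber Δ v.1 := by
  have h1 : ∀ (G : CoverGraph r n) (v : G.V), (G.localDegree Δ v : ℤ) * ((G.targetVal v : ℤ) - 2)
      = if G.cell v = none then (G.outflow Δ v 0 : ℤ) else 0 := by
    intro G v
    rw [CoverGraph.localDegree, CoverGraph.targetVal]
    split_ifs <;> norm_num
  have h2 : (if L.graph.cell x = none then (L.graph.outflow Δ x 0 : ℤ) else 0)
      = ∑ v : {v // L.toGraph v = x}, if α.cell v.1 = none then (α.outflow Δ v.1 0 : ℤ) else 0 := by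
    have hc : ∀ v : {v // L.toGraph v = x}, α.cell v.1 = L.graph.cell x := fun v =>
      congrArg L.graph.cell v.2
    simp_rw [hc]
    split_ifs with hx
    · rw [L.outflow_graph_center hx, Nat.cast_sum]
    · rw [Finset.sum_const_zero]
  have h3 := congrArg (Nat.cast : ℕ → ℤ) (L.val_graph x)
  push_cast at h3
  simp_rw [CoverGraph.rhNumber, h1]
  rw [h2, L.genus_graph, Finset.sum_sub_distrib, Finset.sum_sub_distrib, Finset.sum_add_distrib,
    ← h3, ← Finset.mul_sum, Finset.sum_const, Finset.card_univ, nsmul_eq_mul]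
  ring

theorem card_label_graph (x : L.graph.V) : Fintype.card {i // L.graph.label i = x}
    = ∑ v : {v // L.toGraph v = x}, Fintype.card {i // α.label i = v.1} := by
  rw [← Fintype.card_sigma]
  exact Fintype.card_congr
    ⟨fun i => ⟨⟨α.label i.1, i.2⟩, i.1, rfl⟩,
      fun i => ⟨i.2.1, (congrArg L.toGraph i.2.2).trans i.1.2⟩,
      fun i => rfl, by rintro ⟨⟨v, hv⟩, i, hi⟩; obtain rfl : _ = v := hi; rfl⟩

theorem joined_graph {v w : α.V} (h : α.Joined Set.univ v w) :
    L.graph.Joined Set.univ (L.toGraph v) (L.toGraph w) := by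
  unfold CoverGraph.Joined at h
  induction h with
  | rel v w h =>
    obtain ⟨e, -, rfl, rfl⟩ := h
    by_cases he : L.lim e = 0
    · rw [show L.toGraph (α.src e) = L.toGraph (α.tgt e) from L.classOf_src he]
      exact Relation.EqvGen.refl _
    · exact Relation.EqvGen.rel _ _ ⟨⟨e, he⟩, Set.mem_univ _, rfl, rfl⟩
  | refl v => exact Relation.EqvGen.refl _
  | symm v w _ ih => exact ih.symm
  | trans u v w _ _ ih ih' => exact ih.trans _ _ _ ih'

/-- Only vertices outside the center are contracted with others; there a two-valent vertex has
positive genus because it carries a label. -/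
theorem two_valent_graph (hα : α.IsTrivalent) (x : L.graph.V) (hx : L.graph.val x = 2) :
    1 ≤ L.graph.genus x := by
  obtain ⟨v, rfl⟩ := L.exists_toGraph x
  by_cases hc : α.cell v = none
  · -- vertices over the center are not contracted with others
    have huniq : ∀ w, L.toGraph w = L.toGraph v → w = v := by
      intro w hw
      have := (L.eq_of_joined (f := fun u => if α.cell u = none then some u else none)
        (fun e he => by
          obtain ⟨k, hk, -⟩ := α.edge_cell e
          rw [L.cell_src_of_lim_eq_zero he, hk]
          simp) ((L.classOf_eq _ _).1 hw))
      have hw' : α.cell w = none := by rw [← L.cell_toGraph, hw, L.cell_toGraph, hc]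
      simpa [hc, hw'] using this
    let _ : Unique {w // L.toGraph w = L.toGraph v} :=
      ⟨⟨⟨v, rfl⟩⟩, fun w => Subtype.ext (huniq w.1 w.2)⟩
    have : IsEmpty (L.ZeroEdge (L.toGraph v)) :=
      ⟨fun e => L.not_zero_of_center (x := L.toGraph v) hc e.2.1 e.2.2⟩
    have h1 := L.val_graph (L.toGraph v)
    have h2 := L.genus_graph (L.toGraph v)
    rw [Fintype.card_of_isEmpty] at h1 h2
    rw [hx, Fintype.sum_unique] at h1
    rw [Fintype.sum_unique, Fintype.card_unique] at h2
    have h3 := α.two_valent v h1.symm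
    have h4 : (L.graph.genus (L.toGraph v) : ℤ) = α.genus v := by
      rw [h2]
      push_cast
      simp only [add_zero]
      rfl
    omega
  · obtain ⟨i, hi⟩ := exists_label hα hc
    have h1 := L.rhNumber_graph (L.toGraph v)
    rw [← Finset.sum_congr rfl fun v _ => α.card_label v.1, ← Nat.cast_sum,
      ← L.card_label_graph, CoverGraph.rhNumber, CoverGraph.targetVal,
      if_neg (show L.graph.cell (L.toGraph v) ≠ none from hc),
      hx] at h1
    have : 0 < Fintype.card {i // L.graph.label i = L.toGraph v} :=
      Fintype.card_pos_iff.2 ⟨⟨i, congrArg L.toGraph hi⟩⟩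
    push_cast at h1
    omega

/-- The contraction of a type. -/
def type (hα : α.IsTrivalent) : CoverType g r Δ where
  toCoverGraph := L.graph
  weight_pos e := α.weight_pos e.1
  edge_cell e := α.edge_cell e.1
  ends_cell k i := α.ends_cell k i
  balanced_center x hx k l := by
    rw [L.outflow_graph_center hx, L.outflow_graph_center hx]
    refine Finset.sum_congr rfl fun v _ => α.balanced_center v.1 ?_ k l
    rw [← L.cell_toGraph, v.2, hx]
  balanced_ray x k hx := by
    refine Nat.add_right_cancel (m := L.zeroWeight x k) ?_
    rw [L.outflow_graph, L.inflow_graph hx]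
    refine Finset.sum_congr rfl fun v _ => α.balanced_ray v.1 k ?_
    rw [← L.cell_toGraph, v.2, hx]
  two_valent := L.two_valent_graph hα
  card_label x := by
    rw [L.rhNumber_graph, L.card_label_graph, Nat.cast_sum]
    exact Finset.sum_congr rfl fun v _ => α.card_label v.1
  nonempty := ⟨L.toGraph α.nonempty.some⟩
  connected x y := by
    obtain ⟨v, rfl⟩ := L.exists_toGraph x
    obtain ⟨w, rfl⟩ := L.exists_toGraph y
    exact L.joined_graph (α.connected v w)
  genus_eq := by
    have h1 : ∑ x : L.graph.V, ∑ v : {v // L.toGraph v = x}, (α.genus v.1 : ℤ)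
        = ∑ v, (α.genus v : ℤ) := Fintype.sum_fiberwise L.toGraph fun v => (α.genus v : ℤ)
    have h2 : ∑ x : L.graph.V, (Fintype.card {v // L.toGraph v = x} : ℤ) = Fintype.card α.V := by
      rw [← Nat.cast_sum, ← Fintype.card_sigma,
        Fintype.card_congr (Equiv.sigmaFiberEquiv L.toGraph)]
    have h3 : ∑ x : L.graph.V, (Fintype.card (L.ZeroEdge x) : ℤ)
        = Fintype.card {e // L.lim e = 0} := by
      rw [← Nat.cast_sum, ← Fintype.card_sigma]
      exact congrArg _ (Fintype.card_congr ⟨fun e => ⟨e.2.1, e.2.2.1⟩,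
        fun e => ⟨L.toGraph (α.src e.1), e.1, e.2, rfl⟩,
        by rintro ⟨x, e, he, rfl⟩; rfl, fun e => rfl⟩)
    have h4 : (Fintype.card L.graph.E : ℤ) + Fintype.card {e // L.lim e = 0}
        = Fintype.card α.E := by
      have := L.sum_graphE fun _ => 1
      simp only [Finset.sum_const, Finset.card_univ, smul_eq_mul, mul_one] at this
      exact_mod_cast this
    have h5 := α.genus_eq
    simp_rw [L.genus_graph]
    rw [Finset.sum_add_distrib, Finset.sum_add_distrib, Finset.sum_sub_distrib, h1, h2, h3,
      Finset.sum_const, Finset.card_univ, nsmul_eq_mul, h5]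
    linarith

/-- The contraction of a cover with edges of length zero. -/
def toCover (hα : α.IsTrivalent) : TropCover g r Δ where
  toCoverType := L.type hα
  len e := L.lim e.1
  len_pos e := lt_of_le_of_ne (L.lim_nonneg e.1) (Ne.symm e.2)
  pos := Quotient.lift L.pos fun _ _ h =>
    L.eq_of_joined (fun _ he => L.pos_src_of_lim_eq_zero he) h
  pos_cell x := by
    obtain ⟨v, rfl⟩ := L.exists_toGraph x
    exact L.pos_cell v
  pos_edge e := L.pos_edge e.1

/-- The contraction of a cover with edges of length zero is a contraction of its type. -/
def contraction (hα : α.IsTrivalent) (hL : L.lim ∈ closure α.cone) :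
    TropCover.Contraction α (L.toCover hα) where
  lim := L.lim
  lim_mem := hL
  onV := L.toGraph
  onV_surj := L.exists_toGraph
  onV_eq_iff := L.classOf_eq
  onE := Equiv.refl _
  src_eq _ := rfl
  tgt_eq _ := rfl
  weight_eq _ := rfl
  len_eq _ := rfl
  genus_eq := L.genus_graph
  label_eq _ := rfl
  ends_eq _ _ := rfl
  cell_none x := by
    constructor
    · intro hx
      obtain ⟨v, rfl⟩ := L.exists_toGraph x
      exact ⟨v, rfl, hx⟩
    · rintro ⟨v, rfl, hv⟩
      exact hv
  cell_some _ _ := rfl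

end DegenerateCover

end Contraction

/-! ### Covers over a point in general position -/

section GeneralPosition

variable {g r : ℕ} {n : Fin 3 → ℕ} {Δ : ∀ k, Fin (n k) → ℕ}

namespace DegenerateCover

variable {α : CoverType g r Δ} (L : DegenerateCover α)

/-- A degenerate cover without edges of length zero is a cover. -/
def cover (h : ∀ e, L.lim e ≠ 0) : TropCover g r Δ where
  toCoverType := α
  len := L.lim
  len_pos e := lt_of_le_of_ne (L.lim_nonneg e) (Ne.symm (h e))
  pos := L.pos
  pos_cell := L.pos_cell
  pos_edge := L.pos_edge

theorem genus_eq_of_lim_ne_zero (h : ∀ e, L.lim e ≠ 0) (x : α.V) :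
    (α.genus x : ℤ) = ∑ v : {v : α.V // id v = x}, (α.genus v.1 : ℤ)
      + ((Fintype.card {e // L.lim e = 0 ∧ id (α.src e) = x} : ℤ)
        - (Fintype.card {v : α.V // id v = x} : ℤ) + 1) := by
  have : IsEmpty {e // L.lim e = 0 ∧ id (α.src e) = x} := ⟨fun e => h e.1 e.2.1⟩
  let _ : Unique {v : α.V // id v = x} := ⟨⟨⟨x, rfl⟩⟩, fun v => Subtype.ext v.2⟩
  rw [Fintype.card_of_isEmpty, Fintype.card_unique, Fintype.sum_unique, Nat.cast_zero, Nat.cast_one,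
    zero_sub, neg_add_cancel, add_zero]
  rfl

/-- A cover is a contraction of its own type. -/
def selfContraction (h : ∀ e, L.lim e ≠ 0) (hL : L.lim ∈ closure α.cone) :
    TropCover.Contraction α (L.cover h) where
  lim := L.lim
  lim_mem := hL
  onV := id
  onV_surj := Function.surjective_id
  onV_eq_iff v w := ⟨fun hvw => by
      obtain rfl : v = w := hvw
      exact Relation.EqvGen.refl _,
    fun hvw => L.eq_of_joined (f := id) (fun e he => absurd he (h e)) hvw⟩
  onE := Equiv.subtypeUnivEquiv h
  src_eq _ := rfl
  tgt_eq _ := rfl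
  weight_eq _ := rfl
  len_eq _ := rfl
  genus_eq := L.genus_eq_of_lim_ne_zero h
  label_eq _ := rfl
  ends_eq _ _ := rfl
  cell_none x := ⟨fun hx => ⟨x, rfl, hx⟩, by rintro ⟨v, rfl, hv⟩; exact hv⟩
  cell_some _ _ := rfl

end DegenerateCover

section Sorted

variable {α : CoverType g r Δ} {P : Fin r → TropLine} {π : Perm (Fin r)} {κ : Fin r → Fin 3}

theorem IsSorted.cell_label (hs : IsSorted P π κ) (ho : IsOrder (labelled α.toCoverGraph π) κ)
    (i : Fin r) : (P i).cell = α.cell (α.label i) := by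
  have h1 := hs.cell (π.symm i)
  have h2 := ho.cell_vert (π.symm i)
  rw [labelled] at h2
  rw [Equiv.apply_symm_apply] at h1 h2
  rw [h1, h2]

/-- An edge leads to a labelled vertex, from the center or from a labelled vertex that comes before
in the order; the heights at its two ends are as prescribed. -/
theorem exists_lengths (ho : IsOrder (labelled α.toCoverGraph π) κ) {h : Fin r → ℝ} {y : α.V → ℝ}
    (hy : ∀ j, y (labelled α.toCoverGraph π j) = h j)
    (hy0 : ∀ v, α.cell v = none → y v = 0) (e : α.E) :
    ∃ j, α.tgt e = labelled α.toCoverGraph π j ∧ y (α.tgt e) = h j ∧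
      (y (α.src e) = 0 ∨ ∃ i, i < j ∧ α.src e = labelled α.toCoverGraph π i ∧
        y (α.src e) = h i) := by
  obtain ⟨j, hj⟩ := exists_vert_of_edge ho e
  refine ⟨j, hj, by rw [hj, hy], ?_⟩
  by_cases hc : α.cell (α.src e) = none
  · exact Or.inl (hy0 _ hc)
  · obtain ⟨i, hi⟩ := ho.surj _ hc
    exact Or.inr ⟨i, ho.lt e i j hi.symm hj, hi.symm, by rw [← hi, hy]⟩

/-- The cover of a given type over a given point, which is possibly degenerate. -/
theorem exists_degenerateCover (hα : α.IsTrivalent) (ho : IsOrder (labelled α.toCoverGraph π) κ)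
    (hs : IsSorted P π κ) : ∃ L : DegenerateCover α, (∀ i, L.pos (α.label i) = P i) ∧
      L.lim ∈ closure α.cone := by
  let pos : α.V → TropLine := fun v => if h : ∃ i, α.label i = v then P h.choose else .center
  have hpos : ∀ i, pos (α.label i) = P i := by
    intro i
    have h : ∃ i', α.label i' = α.label i := ⟨i, rfl⟩
    simp only [pos]
    rw [dif_pos h, label_injective hα h.choose_spec]
  have hpos0 : ∀ v, α.cell v = none → pos v = .center := by
    intro v hv
    simp only [pos]
    rw [dif_neg]
    rintro ⟨i, rfl⟩
    exact cell_label hα i hv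
  have hcell : ∀ v, (pos v).cell = α.cell v := by
    intro v
    by_cases hv : α.cell v = none
    · rw [hpos0 v hv, hv]
      rfl
    · obtain ⟨i, rfl⟩ := exists_label hα hv
      rw [hpos, hs.cell_label ho]
  have hw : ∀ e, (0 : ℝ) < α.weight e := fun e => Nat.cast_pos.2 (α.weight_pos e)
  have hlen : ∀ (y : α.V → ℝ) (e : α.E), y (α.tgt e)
      = y (α.src e) + (α.weight e : ℝ) * ((y (α.tgt e) - y (α.src e)) / α.weight e) := by
    intro y e
    rw [mul_div_cancel₀ _ (hw e).ne']
    ring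
  have hPpos : ∀ j, 0 < (P (π j)).height := fun j => height_pos_iff.2 (by rw [hs.cell]; simp)
  refine ⟨⟨fun e => ((pos (α.tgt e)).height - (pos (α.src e)).height) / α.weight e, fun e => ?_,
    pos, hcell, fun e => hlen (fun v => (pos v).height) e⟩, hpos, ?_⟩
  · refine div_nonneg (sub_nonneg.2 ?_) (hw e).le
    obtain ⟨j, -, h1, h2⟩ := exists_lengths ho (h := fun j => (P (π j)).height)
      (y := fun v => (pos v).height) (fun j => by rw [labelled, hpos])
      (fun v hv => by rw [hpos0 v hv]; rfl) e
    rcases h2 with h2 | ⟨i, hij, -, h2⟩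
    · rw [h1, h2]
      exact (hPpos j).le
    · rw [h1, h2]
      exact hs.mono hij.le
  · -- lengths for which the labelled vertices lie at the heights `1, 2, 3, …`
    let y : α.V → ℝ := fun v => if h : ∃ j, labelled α.toCoverGraph π j = v
      then (h.choose : ℕ) + 1 else 0
    have hy : ∀ j, y (labelled α.toCoverGraph π j) = (j : ℕ) + 1 := by
      intro j
      have h : ∃ j', labelled α.toCoverGraph π j' = labelled α.toCoverGraph π j := ⟨j, rfl⟩
      simp only [y]
      rw [dif_pos h, ho.inj h.choose_spec]
    have hy0 : ∀ v, α.cell v = none → y v = 0 := by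
      intro v hv
      simp only [y]
      rw [dif_neg]
      rintro ⟨j, rfl⟩
      exact cell_label hα _ hv
    refine DegenerateCover.lim_mem_closure _ (y := y)
      (ℓ := fun e => (y (α.tgt e) - y (α.src e)) / α.weight e) (fun e => ?_) hy0 (hlen y)
    refine div_pos (sub_pos.2 ?_) (hw e)
    obtain ⟨j, -, h1, h2⟩ := exists_lengths ho (h := fun j => ((j : ℕ) : ℝ) + 1) hy hy0 e
    rcases h2 with h2 | ⟨i, hij, -, h2⟩
    · rw [h1, h2]
      positivity
    · rw [h1, h2]
      have : ((i : ℕ) : ℝ) < (j : ℕ) := by exact_mod_cast hij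
      linarith

/-- The chosen representative of a class is isomorphic to the given one. -/
theorem cover_mk (C : {C : TropCover g r Δ // C.InModuli}) :
    Nonempty (TropCover.Iso (TropModuli.cover (Quotient.mk _ C)) C.1) :=
  Quotient.mk_out C

theorem branchMap_cover {Q : TropModuli g r Δ} (hQ : Q.branchMap = P) (i : Fin r) :
    Q.cover.pos (Q.cover.label i) = P i := by
  rw [← hQ]
  conv_rhs => rw [← Quotient.out_eq Q]
  rfl

/-- Every type with the right order of its vertices is realized by a cover over a point in general
position: otherwise the degenerate cover over this point would have a vertex with two labels. -/
theorem exists_cover (hα : α.IsTrivalent) (ho : IsOrder (labelled α.toCoverGraph π) κ)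
    (hs : IsSorted P π κ) (hP : TropModuli.GeneralPosition g Δ P) :
    ∃ L : DegenerateCover α, ∃ h : ∀ e, L.lim e ≠ 0, (L.cover h).InModuli ∧
      ∀ i, L.pos (α.label i) = P i := by
  obtain ⟨L, hL, hcl⟩ := exists_degenerateCover hα ho hs
  have h : ∀ e, L.lim e ≠ 0 := by
    intro e he
    let C : {C : TropCover g r Δ // C.InModuli} :=
      ⟨L.toCover hα, α, hα, ⟨L.contraction hα hcl⟩⟩
    have htri := hP.2 (Quotient.mk _ C) (funext hL)
    obtain ⟨f⟩ := cover_mk C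
    have hlab : ∀ i i', L.toGraph (α.label i) = L.toGraph (α.label i') → i = i' := by
      intro i i' hii
      refine label_injective htri (f.onV.injective ?_)
      rw [← f.label_eq, ← f.label_eq]
      exact hii
    obtain ⟨j, hj⟩ := exists_vert_of_edge ho e
    have hc := L.cell_src_of_lim_eq_zero he
    obtain ⟨i, hi⟩ := ho.surj (α.src e) (by rw [hc, hj, ho.cell_vert]; simp)
    have := hlab (π i) (π j) (by
      rw [show α.label (π i) = α.src e from hi, show α.label (π j) = α.tgt e from hj.symm]
      exact L.classOf_src he)
    exact absurd (π.injective this) (ho.lt e i j hi.symm hj).ne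
  exact ⟨L, h, ⟨α, hα, ⟨L.selfContraction h hcl⟩⟩, hL⟩

end Sorted

end GeneralPosition

/-! ### Finiteness of the fibres -/

section Bounds

variable {g r d : ℕ} {n : Fin 3 → ℕ} {Δ : ∀ k, Fin (n k) → ℕ} {α : CoverType g r Δ}

/-- Every bounded edge leads to one of the `r` labelled vertices, which are trivalent. -/
theorem card_edges_le (hα : α.IsTrivalent) : Fintype.card α.E ≤ 3 * r := by
  have h1 : Fintype.card α.E = ∑ v, Fintype.card {e // α.tgt e = v} := by
    rw [← Fintype.card_sigma]
    exact Fintype.card_congr (Equiv.sigmaFiberEquiv α.tgt).symm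
  have h2 : ∀ v, Fintype.card {e // α.tgt e = v} ≤ 3 * Fintype.card {i // α.label i = v} := by
    intro v
    by_cases hv : α.cell v = none
    · have : IsEmpty {e // α.tgt e = v} := ⟨fun e => by
        obtain ⟨k, hk, -⟩ := α.edge_cell e.1
        rw [e.2, hv] at hk
        cases hk⟩
      rw [Fintype.card_of_isEmpty]
      exact Nat.zero_le _
    · rw [card_label_ray hα hv, mul_one, ← ((hα v).2 hv).1, CoverGraph.val]
      omega
  have h3 : ∑ v, Fintype.card {i // α.label i = v} = r := by
    have := sum_card_label α.toCoverGraph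
    exact_mod_cast this
  calc Fintype.card α.E = _ := h1
    _ ≤ _ := Finset.sum_le_sum fun v _ => h2 v
    _ = 3 * r := by rw [← Finset.mul_sum, h3]

/-- A connected graph has at most one vertex more than it has edges. -/
theorem card_vertices_le (α : CoverType g r Δ) : Fintype.card α.V ≤ Fintype.card α.E + 1 := by
  have h := card_fibre_le α.toCoverGraph Set.univ (fun _ => ())
    (fun v w => ⟨fun _ => α.connected v w, fun _ => rfl⟩) ()
  rw [← Nat.card_eq_fintype_card, ← Nat.card_eq_fintype_card]
  refine (Nat.card_congr (Equiv.subtypeUnivEquiv fun _ => rfl).symm).le.trans (h.trans ?_)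
  exact Nat.add_le_add_right (Finite.card_subtype_le _) 1

theorem genus_le (α : CoverType g r Δ) (v : α.V) : α.genus v ≤ g := by
  have h1 := α.genus_eq
  have h2 := card_vertices_le α
  have h3 : (α.genus v : ℤ) ≤ ∑ v, (α.genus v : ℤ) :=
    Finset.single_le_sum (f := fun v => (α.genus v : ℤ)) (fun _ _ => Int.natCast_nonneg _)
      (Finset.mem_univ v)
  omega

/-- The weight of an edge is at most the degree, because the flow through the edge and through the
vertices beyond it leaves along the ends. -/
theorem weight_le {vert : Fin r → α.V} {κ : Fin r → Fin 3} (ho : IsOrder vert κ)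
    (hsum : ∀ k, ∑ i, Δ k i = d) (e : α.E) : α.weight e ≤ d := by
  obtain ⟨j, hj⟩ := exists_vert_of_edge ho e
  -- the vertices over the ray of `e` from its target on
  set T : Finset α.V := Finset.univ.filter fun v => ∃ i, vert i = v ∧ κ i = κ j ∧ j ≤ i with hT
  have hmem : ∀ v, v ∈ T ↔ ∃ i, vert i = v ∧ κ i = κ j ∧ j ≤ i := fun v => by simp [hT]
  have hflow := sum_finish_eq_sum_start (α := α) (k := κ j) T (by
    intro v hv
    obtain ⟨i, rfl, hi, -⟩ := (hmem v).1 hv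
    rw [ho.cell_vert, hi])
  set A := Finset.univ.filter (fun e : Strand α.toCoverGraph => ∃ v ∈ T, finish e = some v) with hA
  set B := Finset.univ.filter (fun e : Strand α.toCoverGraph => start e ∈ T) with hB
  have hdiff : ∑ e ∈ A \ B, wt Δ e = ∑ e ∈ B \ A, wt Δ e := by
    have h1 := Finset.sum_inter_add_sum_sdiff A B (wt (G := α.toCoverGraph) Δ)
    have h2 := Finset.sum_inter_add_sum_sdiff B A (wt (G := α.toCoverGraph) Δ)
    rw [Finset.inter_comm] at h2
    omega
  have he : (Sum.inl e : Strand α.toCoverGraph) ∈ A \ B := by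
    refine Finset.mem_sdiff.2 ⟨Finset.mem_filter.2 ⟨Finset.mem_univ _, vert j,
      (hmem _).2 ⟨j, rfl, rfl, le_rfl⟩, congrArg some hj⟩, fun h => ?_⟩
    obtain ⟨i, hi, -, hji⟩ := (hmem _).1 (Finset.mem_filter.1 h).2
    exact absurd (ho.lt e i j hi.symm hj) (not_lt.2 hji)
  have hends : B \ A ⊆ Finset.univ.map
      ⟨fun i : Fin (n (κ j)) => (Sum.inr ⟨κ j, i⟩ : Strand α.toCoverGraph), fun i i' h => by
        simpa using h⟩ := by
    intro e he
    obtain ⟨hB, hA⟩ := Finset.mem_sdiff.1 he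
    obtain ⟨i, hi, hk, hji⟩ := (hmem _).1 (Finset.mem_filter.1 hB).2
    have hdir : dir e = some (κ j) := dir_of_start (by rw [← hi, ho.cell_vert, hk])
    rcases e with e | ⟨l, m⟩
    · exfalso
      obtain ⟨i', hi'⟩ := exists_vert_of_edge ho e
      have hd : dir (Sum.inl e : Strand α.toCoverGraph) = some (κ i') :=
        (dir_of_finish (e := Sum.inl e) (v := vert i') (congrArg some hi')).trans (ho.cell_vert i')
      refine hA (Finset.mem_filter.2 ⟨Finset.mem_univ _, vert i', (hmem _).2 ⟨i', rfl, ?_, ?_⟩,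
        congrArg some hi'⟩)
      · exact Option.some.inj (hd.symm.trans hdir)
      · exact hji.trans (ho.lt e i i' hi.symm hi').le
    · obtain rfl : l = κ j := Option.some.inj hdir
      exact Finset.mem_map.2 ⟨m, Finset.mem_univ _, rfl⟩
  calc α.weight e ≤ ∑ e ∈ A \ B, wt Δ e :=
        Finset.single_le_sum (f := wt Δ) (fun _ _ => Nat.zero_le _) he
    _ = ∑ e ∈ B \ A, wt Δ e := hdiff
    _ ≤ _ := Finset.sum_le_sum_of_subset hends
    _ = ∑ i, Δ (κ j) i := Finset.sum_map _ _ _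
    _ = d := hsum _

end Bounds

section Finite

variable {g r d : ℕ} {n : Fin 3 → ℕ} {Δ : ∀ k, Fin (n k) → ℕ}

/-- A bounded graph in coordinates: the numbers of vertices and edges, the genera, the endpoints and
weights of the edges, the vertices of the ends and labels, and the cells of the vertices. -/
abbrev Code (g r d : ℕ) (n : Fin 3 → ℕ) : Type :=
  Σ a : Fin (3 * r + 2), Σ b : Fin (3 * r + 1), (Fin a → Fin (g + 1)) × (Fin b → Fin a) ×
    (Fin b → Fin a) × (Fin b → Fin (d + 1)) × (∀ k, Fin (n k) → Fin a) × (Fin r → Fin a) ×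
    (Fin a → Option (Fin 3))

/-- The graph of a cover has the given coordinates. -/
structure HasCode (G : CoverGraph r n) (c : Code g r d n) (onV : G.V ≃ Fin c.1)
    (onE : G.E ≃ Fin c.2.1) : Prop where
  genus : ∀ v, G.genus v = c.2.2.1 (onV v)
  src : ∀ e, onV (G.src e) = c.2.2.2.1 (onE e)
  tgt : ∀ e, onV (G.tgt e) = c.2.2.2.2.1 (onE e)
  weight : ∀ e, G.weight e = c.2.2.2.2.2.1 (onE e)
  ends : ∀ k i, onV (G.ends k i) = c.2.2.2.2.2.2.1 k i
  label : ∀ i, onV (G.label i) = c.2.2.2.2.2.2.2.1 i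
  cell : ∀ v, G.cell v = c.2.2.2.2.2.2.2.2 (onV v)

theorem exists_code {G : CoverGraph r n} (hV : Fintype.card G.V ≤ 3 * r + 1)
    (hE : Fintype.card G.E ≤ 3 * r) (hg : ∀ v, G.genus v ≤ g) (hw : ∀ e, G.weight e ≤ d) :
    ∃ (c : Code g r d n) (onV : G.V ≃ Fin c.1) (onE : G.E ≃ Fin c.2.1), HasCode G c onV onE := by
  let onV := Fintype.equivFin G.V
  let onE := Fintype.equivFin G.E
  refine ⟨⟨⟨Fintype.card G.V, by omega⟩, ⟨Fintype.card G.E, by omega⟩,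
    fun v => ⟨G.genus (onV.symm v), Nat.lt_succ_of_le (hg _)⟩,
    fun e => onV (G.src (onE.symm e)), fun e => onV (G.tgt (onE.symm e)),
    fun e => ⟨G.weight (onE.symm e), Nat.lt_succ_of_le (hw _)⟩, fun k i => onV (G.ends k i),
    fun i => onV (G.label i), fun v => G.cell (onV.symm v)⟩, onV, onE, ?_⟩
  constructor <;> intros <;> simp

/-- Covers over the same point whose graphs have the same coordinates are isomorphic. -/
theorem Iso.exists_of_code {C D : TropCover g r Δ} {P : Fin r → TropLine} (hC : C.IsTrivalent)
    (hCP : ∀ i, C.pos (C.label i) = P i) (hDP : ∀ i, D.pos (D.label i) = P i) {c : Code g r d n}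
    {onV : C.V ≃ Fin c.1} {onE : C.E ≃ Fin c.2.1} {onV' : D.V ≃ Fin c.1} {onE' : D.E ≃ Fin c.2.1}
    (h : HasCode C.toCoverGraph c onV onE) (h' : HasCode D.toCoverGraph c onV' onE') :
    Nonempty (TropCover.Iso C D) := by
  obtain ⟨f, -⟩ := Iso.exists_of_graph hC hCP hDP (onV.trans onV'.symm) (onE.trans onE'.symm)
    (fun e => onV'.injective (by rw [h'.src]; simp [h.src]))
    (fun e => onV'.injective (by rw [h'.tgt]; simp [h.tgt]))
    (fun e => by rw [h'.weight, h.weight]; simp)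
    (fun v => by rw [h'.genus, h.genus]; simp)
    (fun i => by rw [Equiv.trans_apply, Equiv.eq_symm_apply, h'.label, h.label])
    (fun k i => by rw [Equiv.trans_apply, Equiv.eq_symm_apply, h'.ends, h.ends])
    (fun v => by rw [h'.cell, h.cell]; simp)
  exact ⟨f⟩

theorem eq_of_iso {Q Q' : TropModuli g r Δ} (h : Nonempty (TropCover.Iso Q.cover Q'.cover)) :
    Q = Q' := by
  rw [← Quotient.out_eq Q, ← Quotient.out_eq Q']
  exact Quotient.sound h

/-- There are finitely many covers over a point in general position. -/
theorem finite_fibre (hsum : ∀ k, ∑ i, Δ k i = d) {P : Fin r → TropLine}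
    (hP : TropModuli.GeneralPosition g Δ P) : Finite {Q : TropModuli g r Δ // Q.branchMap = P} := by
  obtain ⟨π, κ, hs⟩ := exists_isSorted hP.1
  have h : ∀ Q : {Q : TropModuli g r Δ // Q.branchMap = P}, ∃ (c : Code g r d n)
      (onV : Q.1.cover.V ≃ Fin c.1) (onE : Q.1.cover.E ≃ Fin c.2.1),
      HasCode Q.1.cover.toCoverGraph c onV onE := by
    rintro ⟨Q, hQ⟩
    have htri := hP.2 Q hQ
    have hE := card_edges_le htri
    have hV := card_vertices_le Q.cover.toCoverType
    exact exists_code (hV.trans (Nat.add_le_add_right hE 1)) hE (genus_le _)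
      (weight_le (isOrder_labelled htri (branchMap_cover hQ) hs) hsum)
  choose c onV onE hc using h
  refine Finite.of_injective c fun Q Q' hcc => Subtype.ext (eq_of_iso ?_)
  have h' := hc Q'
  have key : ∀ (c' : Code g r d n) (onV' : Q'.1.cover.V ≃ Fin c'.1)
      (onE' : Q'.1.cover.E ≃ Fin c'.2.1), HasCode Q'.1.cover.toCoverGraph c' onV' onE' → c Q = c' →
      Nonempty (TropCover.Iso Q.1.cover Q'.1.cover) := by
    rintro c' onV' onE' h rfl
    exact Iso.exists_of_code (hP.2 Q.1 Q.2) (branchMap_cover Q.2) (branchMap_cover Q'.2) (hc Q) h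
  exact key _ _ _ h' hcc

end Finite

/-! ### The degree of the branch map -/

section Degree

variable {g r d : ℕ} {n : Fin 3 → ℕ} {Δ : ∀ k, Fin (n k) → ℕ} {P : Fin r → TropLine}
  {π : Perm (Fin r)} {κ : Fin r → Fin 3}

instance (C D : TropCover g r Δ) : Finite (TropCover.Iso C D) :=
  Finite.of_injective (fun f => (f.onV, f.onE)) (by
    rintro ⟨onV, onE⟩ ⟨onV', onE'⟩ h
    obtain ⟨rfl, rfl⟩ := Prod.mk.inj h
    rfl)

/-- The data of a path of triples of permutations with marked end, as in `IsPath`. -/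
abbrev MarkedPath (r : ℕ) (n : Fin 3 → ℕ) (X : Type) : Type :=
  (Fin (r + 1) → Fin 3 → Perm X) × (∀ k, X → Fin (n k))

/-- The path `q` is the monodromy of the cover `C`: some chain of `C` lies over it. -/
def Carries (C : TropCover g r Δ) (π : Perm (Fin r)) (κ : Fin r → Fin 3) {X : Type}
    (q : MarkedPath r n X) : Prop :=
  ∃ a, IsChainOver Δ (labelled C.toCoverGraph π) κ a q

/-- The contribution of a cover to the degree is the number of its monodromy paths, divided by
`d!`. -/
theorem coneWeight_mul_branchMult [Nonempty (Fin d)] (hΔ : ∀ k i, 0 < Δ k i)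
    (hsum : ∀ k, ∑ i, Δ k i = d) {C : TropCover g r Δ} (hC : C.IsTrivalent)
    (hCP : ∀ i, C.pos (C.label i) = P i) (hs : IsSorted P π κ) :
    C.coneWeight * (C.branchMult : ℚ)
      = (Nat.card {q : MarkedPath r n (Fin d) // Carries C π κ q} : ℚ) / (d ! : ℚ) := by
  have ho := isOrder_labelled hC hCP hs
  have h1 := card_isChain (X := Fin d) hC hΔ ho
  have h2 := card_isStart (X := Fin d) hC ho (by rw [hsum, Fintype.card_fin])
  have h3 := card_isChain_eq (X := Fin d) hΔ hC hCP hs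
  have h4 := latticeIndex_mul_branchMult (label_injective hC) (cell_label hC)
    fun v hv => exists_label hC hv
  rw [Fintype.card_fin] at h2
  rw [h3] at h1
  have h5 : (Nat.card {q : MarkedPath r n (Fin d) // Carries C π κ q} : ℚ)
      * (Nat.card (TropCover.Iso C C) : ℚ)
      = (d ! : ℚ) * (∏ v : {v // C.cell v = none}, C.vertexHurwitz v.1)
        * ((C.latticeIndex : ℚ) * (C.branchMult : ℚ)) := by
    rw [← h2]
    exact_mod_cast h4 ▸ h1
  have : Nonempty (TropCover.Iso C C) := ⟨TropCover.Iso.refl C⟩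
  have hA : (Nat.card (TropCover.Iso C C) : ℚ) ≠ 0 := Nat.cast_ne_zero.2 Nat.card_pos.ne'
  have hd : (d ! : ℚ) ≠ 0 := Nat.cast_ne_zero.2 (Nat.factorial_ne_zero d)
  rw [TropCover.coneWeight, eq_div_iff hd, ← mul_left_inj' hA, h5]
  field_simp

theorem Carries.map {C D : TropCover g r Δ} (f : TropCover.Iso C D) {X : Type}
    {q : MarkedPath r n X} (h : Carries C π κ q) : Carries D π κ q := by
  obtain ⟨a, ha⟩ := h
  refine ⟨mapChain f a, ?_⟩
  have h1 := ha.map f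
  rwa [show f.onV ∘ labelled C.toCoverGraph π = labelled D.toCoverGraph π from
    funext fun j => (f.label_eq (π j)).symm] at h1

/-- Every path is the monodromy of a cover over a given point in general position. -/
theorem exists_carries {X : Type} [Finite X] [Nonempty X] (hΔ : ∀ k i, 0 < Δ k i)
    (hr : (r : ℤ) = (∑ k, (n k : ℤ)) + 2 * (g : ℤ) - 2 - (Nat.card X : ℤ))
    (hP : TropModuli.GeneralPosition g Δ P) (hs : IsSorted P π κ) {q : MarkedPath r n X}
    (hq : IsPath Δ κ q.1 q.2) :
    ∃ Q : {Q : TropModuli g r Δ // Q.branchMap = P}, Carries Q.1.cover π κ q := by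
  have hlab : labelled (pathType hq hΔ π hr).toCoverGraph π = stepVertex hq hΔ π :=
    funext fun j => congrArg Sum.inr (π.symm_apply_apply j)
  have hch := isChainOver_strandOf hq hΔ π hr
  have hor : IsOrder (G := (pathType hq hΔ π hr).toCoverGraph) (stepVertex hq hΔ π) κ :=
    isOrder_stepVertex hq hΔ π
  rw [← hlab] at hch hor
  obtain ⟨L, h, hmod, hL⟩ := exists_cover (isTrivalent_pathType hq hΔ π hr) hor hs hP
  let C : {C : TropCover g r Δ // C.InModuli} := ⟨L.cover h, hmod⟩
  obtain ⟨f⟩ := cover_mk C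
  exact ⟨⟨Quotient.mk _ C, funext hL⟩, Carries.map f.symm ⟨_, hch⟩⟩

/-- Over a point in general position the branch map has degree the number of paths, divided
by `d!`. -/
theorem branchDegreeAt_eq (hd : 0 < d) (hΔ : ∀ k i, 0 < Δ k i) (hsum : ∀ k, ∑ i, Δ k i = d)
    (hr : (r : ℤ) = (∑ k, (n k : ℤ)) + 2 * (g : ℤ) - 2 - (d : ℤ))
    (hP : TropModuli.GeneralPosition g Δ P) (hs : IsSorted P π κ) :
    TropModuli.branchDegreeAt g Δ P
      = (Nat.card {q : MarkedPath r n (Fin d) // IsPath Δ κ q.1 q.2} : ℚ) / (d ! : ℚ) := by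
  have : Nonempty (Fin d) := ⟨⟨0, hd⟩⟩
  have hfin := finite_fibre hsum hP
  have := Fintype.ofFinite {Q : TropModuli g r Δ // Q.branchMap = P}
  have htri : ∀ Q : {Q : TropModuli g r Δ // Q.branchMap = P}, Q.1.cover.IsTrivalent :=
    fun Q => hP.2 Q.1 Q.2
  have hpos := fun Q : {Q : TropModuli g r Δ // Q.branchMap = P} => branchMap_cover Q.2
  rw [TropModuli.branchDegreeAt, finsum_eq_sum_of_fintype,
    Finset.sum_congr rfl fun Q _ => coneWeight_mul_branchMult hΔ hsum (htri Q) (hpos Q) hs,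
    ← Finset.sum_div, ← Nat.cast_sum, ← Nat.card_sigma]
  congr 2
  refine Nat.card_congr (Equiv.ofBijective (fun x => ⟨x.2.1, ?_⟩) ⟨?_, ?_⟩)
  · obtain ⟨a, ha⟩ := x.2.2
    exact IsChain.isPath hΔ (isOrder_labelled (htri x.1) (hpos x.1) hs) ha
  · rintro ⟨Q, q, a, ha⟩ ⟨Q', q', a', ha'⟩ h
    obtain rfl : q = q' := congrArg Subtype.val h
    obtain ⟨f, -⟩ := Iso.exists_of_chains hΔ (htri Q) (htri Q') (hpos Q) (hpos Q') hs ha ha'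
    obtain rfl : Q = Q' := Subtype.ext (eq_of_iso ⟨f⟩)
    rfl
  · rintro ⟨q, hq⟩
    obtain ⟨Q, hQ⟩ := exists_carries hΔ (by rwa [Nat.card_fin]) hP hs hq
    exact ⟨⟨Q, q, hQ⟩, rfl⟩

end Degree

/-! ### Points in general position exist -/

section Existence

variable {g r d : ℕ} {n : Fin 3 → ℕ} {Δ : ∀ k, Fin (n k) → ℕ}

/-- No vertex over a ray is isolated, and so both sides of the balancing condition are positive. -/
theorem outflow_pos (α : CoverType g r Δ) (hd : 0 < d) (hΔ : ∀ k i, 0 < Δ k i)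
    (hsum : ∀ k, ∑ i, Δ k i = d) {v : α.V} {k : Fin 3} (hv : α.cell v = some k) :
    0 < α.outflow Δ v k := by
  by_contra h0
  have hout : ∀ e : Strand α.toCoverGraph, start e ≠ v := by
    intro e he
    have h1 : wt Δ e ≤ α.outflow Δ v k := by
      rw [outflow_eq_of_ray hv]
      exact Finset.single_le_sum (f := wt Δ) (fun _ _ => Nat.zero_le _) (mem_outStrands.2 he)
    have := wt_pos hΔ e
    omega
  have hin : ∀ e, α.tgt e ≠ v := by
    intro e he
    have h1 : wt Δ (Sum.inl e : Strand α.toCoverGraph) ≤ α.inflow v := by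
      rw [inflow_eq]
      exact Finset.single_le_sum (f := wt Δ) (fun _ _ => Nat.zero_le _)
        (mem_inStrands.2 (congrArg some he))
    have := wt_pos hΔ (Sum.inl e : Strand α.toCoverGraph)
    rw [α.balanced_ray v k hv] at h1
    omega
  have hall : ∀ u w, α.Joined Set.univ u w → (u = v ↔ w = v) := by
    intro u w h
    unfold CoverGraph.Joined at h
    induction h with
    | rel u w h =>
      obtain ⟨e, -, rfl, rfl⟩ := h
      exact iff_of_false (hout (Sum.inl e)) (hin e)
    | refl v => rfl
    | symm v w _ ih => exact ih.symm
    | trans u v w _ _ ih ih' => exact ih.trans ih'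
  have hn : Nonempty (Fin (n 0)) := by
    by_contra hne
    rw [not_nonempty_iff] at hne
    have := hsum 0
    rw [Finset.univ_eq_empty, Finset.sum_empty] at this
    omega
  obtain ⟨i⟩ := hn
  exact hout (Sum.inr ⟨0, i⟩) ((hall v _ (α.connected _ _)).1 rfl)

/-- A type is trivalent if all labels lie on distinct vertices outside the center: by the formula
for the number of labels, a vertex outside the center has `val + 2 * genus ≤ 3`, and its valence is
at least two, and two only if the genus is positive. -/
theorem isTrivalent_of_card_label_le (α : CoverType g r Δ) (hd : 0 < d) (hΔ : ∀ k i, 0 < Δ k i)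
    (hsum : ∀ k, ∑ i, Δ k i = d) (hcell : ∀ i, α.cell (α.label i) ≠ none)
    (hinj : Function.Injective α.label) : α.IsTrivalent := by
  intro v
  refine ⟨fun hv => ?_, fun hv => ?_⟩
  · have : IsEmpty {i // α.label i = v} := ⟨fun i => hcell i.1 (by rw [i.2]; exact hv)⟩
    rw [← α.card_label, Fintype.card_of_isEmpty]
    rfl
  · obtain ⟨k, hk⟩ := Option.ne_none_iff_exists'.1 hv
    have hpos := outflow_pos α hd hΔ hsum hk
    have hpos' := hpos
    rw [← α.balanced_ray v k hk, inflow_eq] at hpos'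
    rw [outflow_eq_of_ray hk] at hpos
    have h1 : 0 < (outStrands (G := α.toCoverGraph) v).card := by
      rw [Finset.card_pos]
      exact Finset.nonempty_of_sum_ne_zero hpos.ne'
    have h2 : 0 < (inStrands (G := α.toCoverGraph) v).card := by
      rw [Finset.card_pos]
      exact Finset.nonempty_of_sum_ne_zero hpos'.ne'
    have h3 : α.val v = (inStrands (G := α.toCoverGraph) v).card
      + (outStrands (G := α.toCoverGraph) v).card := val_eq_card _ v
    have h4 : Fintype.card {i // α.label i = v} ≤ 1 := Fintype.card_le_one_iff.2 fun i i' =>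
      Subtype.ext (hinj (i.2.trans i'.2.symm))
    have h5 := α.card_label v
    rw [CoverGraph.rhNumber, CoverGraph.targetVal, if_neg hv] at h5
    have h6 := α.two_valent v
    push_cast at h5
    omega

/-- A point with components on one ray, at different heights, is in general position. -/
theorem exists_generalPosition (g : ℕ) (hd : 0 < d) (hΔ : ∀ k i, 0 < Δ k i)
    (hsum : ∀ k, ∑ i, Δ k i = d) : ∃ P : Fin r → TropLine, TropModuli.GeneralPosition g Δ P := by
  refine ⟨fun i => .ray 0 ((i : ℕ) + 1) (by positivity), fun i h => (nomatch h),
    fun Q hQ => ?_⟩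
  have hpos := branchMap_cover hQ
  refine isTrivalent_of_card_label_le _ hd hΔ hsum (fun i => ?_) fun i i' h => ?_
  · rw [← TropCover.pos_cell, hpos]
    intro h
    cases h
  · have h1 := (hpos i).symm.trans ((congrArg _ h).trans (hpos i'))
    have h2 : ((i : ℕ) : ℝ) + 1 = (i' : ℕ) + 1 := congrArg TropLine.height h1
    exact Fin.ext (Nat.cast_injective (add_right_cancel h2))

end Existence

end TropHurwitz

end

open TropHurwitz

theorem theorem3p3 (g d r : ℕ) (hd : 0 < d) (n : Fin 3 → ℕ) (Δ : ∀ k, Fin (n k) → ℕ)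
    (hΔ : ∀ k i, 0 < Δ k i) (hsum : ∀ k, ∑ i, Δ k i = d)
    (hr : (r : ℤ) = (∑ k, (n k : ℤ)) + 2 * (g : ℤ) - 2 - (d : ℤ)) :
    ∃! N : ℚ, ∀ P : Fin r → TropLine, TropModuli.GeneralPosition g Δ P →
      {Q : TropModuli g r Δ | Q.branchMap = P}.Finite ∧
        TropModuli.branchDegreeAt g Δ P = N := by
  have key : ∀ P : Fin r → TropLine, TropModuli.GeneralPosition g Δ P →
      TropModuli.branchDegreeAt g Δ P = (Nat.card {q : MarkedPath r n (Fin d) //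
        IsPath Δ (fun _ => 0) q.1 q.2} : ℚ) / (d.factorial : ℚ) := by
    intro P hP
    obtain ⟨π, κ, hs⟩ := exists_isSorted hP.1
    rw [branchDegreeAt_eq hd hΔ hsum hr hP hs, card_isPath_eq κ fun _ => 0]
  refine ⟨_, fun P hP => ⟨Set.finite_coe_iff.1 (finite_fibre hsum hP), key P hP⟩, fun N hN => ?_⟩
  obtain ⟨P, hP⟩ := exists_generalPosition (r := r) g hd hΔ hsum
  rw [← (hN P hP).2, key P hP]
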